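/- Let $n\ge 2$, let $\Omega\subset\mathbb{R}^n$ be a bounded open set with smooth boundary $\Gamma=\partial\Omega$, and let $k\in\mathbb{C}$ with $k=0$ or $0\le\arg k<\pi$. Let $\Gamma$ carry the Riemannian metric and the boundary orientation (outer normal first) induced by $\mathbb{R}^n$. For a complex-valued $p$-form write $q=n-p$; $\mathrm d$, $*$ and $\delta=(-1)^p*^{-1}\mathrm d\,*$ are the exterior derivative, Hodge operator ($\omega\wedge*\bar\eta=(\omega,\eta)\mu$, with $(\cdot,\cdot)$ the pointwise inner product and $\mu$ the unit volume form) and coderivative (on $p$-forms) in $\mathbb{R}^n$, $\Delta=\mathrm d\delta+\delta\mathrm d$, and $\hat{\mathrm d},\hat *,\hat\delta=(-1)^p\hat*^{-1}\hat{\mathrm d}\,\hat*$ are the corresponding operators on $\Gamma$. Let $$g_n(X,X')=\begin{cases}\frac i4\left(\frac{k}{2\pi r}\right)^{n/2-1}H^{(1)}_{n/2-1}(kr), & k\neq 0,\\ \frac1{2\pi}\ln\frac{r_0}{r}, & k=0,\ n=2,\\ \frac{1}{(n-2)S_n(1)}\,r^{2-n}, & k=0,\ n\ge 3,\end{cases}\qquad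 r=|X-X'|,$$ be the standard fundamental solution of $(\Delta-k^2)g_n=\delta(X,X')$ (here $\delta(X,X')$ is the Dirac distribution, $r_0>0$ is a constant, $H^{(1)}$ is the Hankel function of the first kind and $S_n(1)$ is the area of the unit sphere), and let $G_p(X,X')=\overline{g_n(X,X')}\,I_p$, where the double $p$-form $I_p$ maps $v_1\wedge\dots\wedge v_p$ at $X'$ to the $p$-covector $v_1^\flat\wedge\dots\wedge v_p^\flat$ at $X$. For a smooth $p$-form $\hat\omega$ on $\Gamma$, $0\le p\le n-1$, define the single- and double-layer potentials on $\Omega$ by $$\Psi_{\mathrm{SL}}\hat\omega=(\hat\omega,\mathrm t\,G_p)_{L^2(\Gamma)},\qquad \Psi_{\mathrm{DL}}\hat\omega=-*\mathrm d\,\Psi_{\mathrm{SL}}(\hat*^{-1}\hat\omega),$$ where $\mathrm t$ is the pullback to $\Gamma$ in the variable $X$ and the $L^2$ inner product (sesquilinear, conjugate-linear in the second argument) is taken in $X$, so that both potentials are $p$-forms in the variable $X'$. Then these integrals converge absolutely for every $X'\in\Omega$, both potentials are smooth forms on $\Omega$, and for every smooth $p$-form on $\Gamma$, $0\le p\le n-1$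 (the form on which the operators act has degree $p$; forms of degree $-1$, and forms of degree $n$ on $\Gamma$, are zero), the following hold on $\Omega$: (i) $\delta\Psi_{\mathrm{SL}}-\Psi_{\mathrm{SL}}\hat\delta=0$; (ii) $(\Delta-k^2)\Psi_{\mathrm{SL}}=0$; (iii) $*\Psi_{\mathrm{DL}}=(-1)^{p+1}\,\mathrm d\,\Psi_{\mathrm{SL}}\hat*$; (iv) $\delta\Psi_{\mathrm{DL}}=0$; (v) $\mathrm d\,\Psi_{\mathrm{DL}}-\Psi_{\mathrm{DL}}\hat{\mathrm d}=k^2*^{-1}\Psi_{\mathrm{SL}}\hat*$; (vi) $*\,\mathrm d\,\Psi_{\mathrm{DL}}=(-1)^p\,\mathrm d\,\Psi_{\mathrm{SL}}\hat*\,\hat{\mathrm d}+k^2\,\Psi_{\mathrm{SL}}\hat*$; (vii) $(\delta\mathrm d-k^2)\Psi_{\mathrm{DL}}=0$. -/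

import Mathlib

open MeasureTheory
open scoped ContDiff Gradient

noncomputable section

namespace LayerPotential

/-! ### Linear algebra of alternating forms -/

section LinearAlgebra

lemma append_update_right {V : Type*} {p q n : ℕ} [inst : DecidableEq (Fin q)] (h : p + q = n)
    (w : Fin p → V) (v : Fin q → V) (i : Fin q) (x : V) :
    (fun j : Fin n => Fin.append w (Function.update v i x) (Fin.cast h.symm j)) =
      Function.update (fun j : Fin n => Fin.append w v (Fin.cast h.symm j))
        (Fin.cast h (Fin.natAdd p i)) x := by
  obtain rfl : inst = instDecidableEqFin q := Subsingleton.elim _ _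
  subst h
  funext j
  refine Fin.addCases (fun a => ?_) (fun b => ?_) j
  · have hne : Fin.castAdd q a ≠ Fin.natAdd p i := by
      intro hh
      have := congrArg Fin.val hh
      simp at this
      omega
    simp [Function.update_of_ne hne]
  · by_cases hb : b = i
    · subst hb; simp
    · have hne : Fin.natAdd p b ≠ Fin.natAdd p i := by
        intro hh; exact hb (by simpa using hh)
      simp [Function.update_of_ne hne, Function.update_of_ne hb]

variable {V : Type*} [NormedAddCommGroup V] [InnerProductSpace ℝ V]

/-- The interior product `i(w₁ ∧ … ∧ w_p, μ)` of an `n`-form `μ` with a simple `p`-vector,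
that is, the `q`-form `(v₁, …, v_q) ↦ μ(w₁, …, w_p, v₁, …, v_q)`, where `p + q = n`. -/
def contract {n p q : ℕ} (h : p + q = n) (μ : V [⋀^Fin n]→L[ℝ] ℝ) (w : Fin p → V) :
    V [⋀^Fin q]→L[ℝ] ℝ where
  toFun v := μ (fun j => Fin.append w v (Fin.cast h.symm j))
  map_update_add' v i x y := by
    rw [append_update_right h, append_update_right h, append_update_right h]
    exact μ.map_update_add _ _ _ _
  map_update_smul' v i c x := by
    rw [append_update_right h, append_update_right h]
    exact μ.map_update_smul _ _ _ _
  cont := by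
    refine μ.cont.comp (continuous_pi fun j => ?_)
    subst h
    refine Fin.addCases (fun a => ?_) (fun b => ?_) j
    · simpa using continuous_const
    · simpa using continuous_apply b
  map_eq_zero_of_eq' v i j hv hij := by
    refine μ.map_eq_zero_of_eq _ (i := Fin.cast h (Fin.natAdd p i))
      (j := Fin.cast h (Fin.natAdd p j)) ?_ ?_
    · simpa using hv
    · intro hh
      apply hij
      have := congrArg Fin.val hh
      simp at this
      exact Fin.ext this

/-- The Hodge operator `*φ = i(g⁻¹φ, μ)` on complex-valued `p`-forms of an `n`-dimensional
oriented Euclidean space with unit volume form `μ`, computed in an orthonormal basis `b`: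
`*φ = ∑_J φ(b_J) i(b_J, μ)` over increasing `p`-indices `J`; by antisymmetry this is `1/p!` times
the sum over all `p`-indices. -/
def hodgeStar {ι : Type*} [Fintype ι] (b : OrthonormalBasis ι ℝ V) {n p q : ℕ} (h : p + q = n)
    (μ : V [⋀^Fin n]→L[ℝ] ℝ) (φ : V [⋀^Fin p]→L[ℝ] ℂ) : V [⋀^Fin q]→L[ℝ] ℂ :=
  ((p.factorial : ℂ)⁻¹) • ∑ J : Fin p → ι,
    φ (fun i => b (J i)) •
      Complex.ofRealCLM.compContinuousAlternatingMap (contract h μ (fun i => b (J i)))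

/-- The inverse Hodge operator `*⁻¹ = (-1)^{pq} *`, mapping `q`-forms to `p`-forms, where
`p + q = n`. -/
def hodgeStarInv {ι : Type*} [Fintype ι] (b : OrthonormalBasis ι ℝ V) {n p q : ℕ} (h : p + q = n)
    (μ : V [⋀^Fin n]→L[ℝ] ℝ) (φ : V [⋀^Fin q]→L[ℝ] ℂ) : V [⋀^Fin p]→L[ℝ] ℂ :=
  ((-1 : ℂ) ^ (p * q)) • hodgeStar b ((Nat.add_comm q p).trans h) μ φ

/-- The inner product `(φ, η) = ∑_J φ(b_J) conj(η(b_J))` of `p`-forms (`b` an orthonormal basis,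
`J` increasing), as a real-linear functional of the second argument `η`. -/
def formInner {ι : Type*} [Fintype ι] (b : OrthonormalBasis ι ℝ V) {p : ℕ}
    (φ : V [⋀^Fin p]→L[ℝ] ℂ) : (V [⋀^Fin p]→L[ℝ] ℂ) →L[ℝ] ℂ :=
  ∑ J : Fin p → ι, ((p.factorial : ℂ)⁻¹ * φ (fun i => b (J i))) •
    (Complex.conjCLE.toContinuousLinearMap ∘L
      ContinuousAlternatingMap.apply ℝ V ℂ (fun i => b (J i)))

lemma abs_det_inner_le {p : ℕ} (v w : Fin p → V) :
    ‖Matrix.det (Matrix.of fun j i => (inner ℝ (v i) (w j) : ℝ))‖ ≤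
      p.factorial * (∏ i, ‖v i‖) * ∏ i, ‖w i‖ := by
  rw [Matrix.det_apply]
  refine (norm_sum_le _ _).trans ?_
  have key : ∀ σ ∈ (Finset.univ : Finset (Equiv.Perm (Fin p))),
      ‖Equiv.Perm.sign σ • ∏ i, Matrix.of (fun j i => (inner ℝ (v i) (w j) : ℝ)) (σ i) i‖ ≤
        (∏ i, ‖v i‖) * ∏ i, ‖w i‖ := by
    intro σ _
    have h1 : ‖Equiv.Perm.sign σ • ∏ i, Matrix.of (fun j i => (inner ℝ (v i) (w j) : ℝ)) (σ i) i‖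
        = ∏ i, ‖(inner ℝ (v i) (w (σ i)) : ℝ)‖ := by
      rcases Int.units_eq_one_or (Equiv.Perm.sign σ) with h | h <;> simp [h]
    rw [h1]
    calc ∏ i, ‖(inner ℝ (v i) (w (σ i)) : ℝ)‖ ≤ ∏ i, ‖v i‖ * ‖w (σ i)‖ :=
          Finset.prod_le_prod (fun _ _ => norm_nonneg _) fun _ _ => norm_inner_le_norm _ _
      _ = (∏ i, ‖v i‖) * ∏ i, ‖w i‖ := by
          rw [Finset.prod_mul_distrib, Equiv.prod_comp σ fun i => ‖w i‖]
  refine (Finset.sum_le_sum key).trans (le_of_eq ?_)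
  simp [Fintype.card_perm, mul_assoc]

lemma inner_update {p : ℕ} [inst : DecidableEq (Fin p)] (v w : Fin p → V) (i : Fin p) (x : V) :
    (Matrix.of fun j k => (inner ℝ (Function.update v i x k) (w j) : ℝ)) =
      Matrix.updateCol (Matrix.of fun j k => (inner ℝ (v k) (w j) : ℝ)) i
        (fun j => inner ℝ x (w j)) := by
  ext j k
  by_cases hk : k = i
  · subst hk; simp
  · simp [hk]

/-- The `p`-form `g(v₁ ∧ … ∧ v_p) = v₁♭ ∧ … ∧ v_p♭`, that is `(w₁, …, w_p) ↦ det ⟪v_i, w_j⟫`, as an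
alternating function of `(v₁, …, v_p)`. -/
def riesz (V : Type*) [NormedAddCommGroup V] [InnerProductSpace ℝ V] (p : ℕ) :
    V [⋀^Fin p]→L[ℝ] (V [⋀^Fin p]→L[ℝ] ℂ) :=
  (ContinuousLinearMap.compContinuousAlternatingMapCLM ℝ V ℝ ℂ (ι := Fin p)
    Complex.ofRealCLM).compContinuousAlternatingMap <|
  AlternatingMap.mkContinuousAlternating
    { toFun := fun v =>
        (Matrix.detRowAlternating (n := Fin p) (R := ℝ)).compLinearMap
          (LinearMap.pi fun i => (innerₗ V (v i)))
      map_update_add' := by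
        intro inst v i x y
        obtain rfl : inst = instDecidableEqFin p := Subsingleton.elim _ _
        ext w
        change Matrix.det (Matrix.of fun j k => (inner ℝ (Function.update v i (x + y) k) (w j) : ℝ))
          = Matrix.det (Matrix.of fun j k => (inner ℝ (Function.update v i x k) (w j) : ℝ)) +
            Matrix.det (Matrix.of fun j k => (inner ℝ (Function.update v i y k) (w j) : ℝ))
        rw [inner_update, inner_update, inner_update, ← Matrix.det_updateCol_add]
        congr 2
        funext j
        simp [inner_add_left]
      map_update_smul' := by
        intro inst v i c x
        obtain rfl : inst = instDecidableEqFin p := Subsingleton.elim _ _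
        ext w
        change Matrix.det (Matrix.of fun j k => (inner ℝ (Function.update v i (c • x) k) (w j) : ℝ))
          = c * Matrix.det (Matrix.of fun j k => (inner ℝ (Function.update v i x k) (w j) : ℝ))
        rw [inner_update, inner_update, ← Matrix.det_updateCol_smul]
        congr 2
        funext j
        simp [inner_smul_left]
      map_eq_zero_of_eq' := by
        intro v i j hv hij
        ext w
        exact Matrix.det_zero_of_column_eq hij fun k => by
          simp [hv] }
    p.factorial (fun v w => abs_det_inner_le v w)

lemma riesz_apply {p : ℕ} (v w : Fin p → V) :
    riesz V p v w = ((Matrix.det (Matrix.of fun j i => (inner ℝ (v i) (w j) : ℝ)) : ℝ) : ℂ) :=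
  rfl

end LinearAlgebra

/-! ### Euclidean space and differential forms -/

/-- Euclidean space `ℝⁿ`. -/
abbrev E (n : ℕ) := EuclideanSpace ℝ (Fin n)

/-- Complex-valued differential `p`-forms on `ℝⁿ` (not necessarily smooth). -/
abbrev Form (n p : ℕ) := E n → E n [⋀^Fin p]→L[ℝ] ℂ

/-- The unit volume form `μ = dx¹ ∧ … ∧ dxⁿ` of `ℝⁿ`. -/
def euclVol (n : ℕ) : E n [⋀^Fin n]→L[ℝ] ℝ where
  toAlternatingMap := (Matrix.detRowAlternating (n := Fin n) (R := ℝ)).compLinearMap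
    (EuclideanSpace.equiv (Fin n) ℝ).toLinearMap
  cont := by
    change Continuous fun v : Fin n → E n => Matrix.det (Matrix.of fun i j => v i j)
    exact Continuous.matrix_det (by fun_prop)

/-- The Hodge operator from `p`-covectors to `q`-covectors of `ℝⁿ`, where `p + q = n`. -/
def euclStar {n p q : ℕ} (h : p + q = n) : (E n [⋀^Fin p]→L[ℝ] ℂ) → E n [⋀^Fin q]→L[ℝ] ℂ :=
  hodgeStar (EuclideanSpace.basisFun (Fin n) ℝ) h (euclVol n)

/-- The inverse Hodge operator from `q`-covectors to `p`-covectors of `ℝⁿ`, where `p + q = n`. -/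
def euclStarInv {n p q : ℕ} (h : p + q = n) : (E n [⋀^Fin q]→L[ℝ] ℂ) → E n [⋀^Fin p]→L[ℝ] ℂ :=
  hodgeStarInv (EuclideanSpace.basisFun (Fin n) ℝ) h (euclVol n)

/-- The coderivative `δα = (-1)^{p+1} *⁻¹ d * α` of a `(p+1)`-form `α`, where `(p+1) + q = n`.
The coderivative of a `0`-form is zero. -/
def coderiv {n p q : ℕ} (h : p + 1 + q = n) (α : Form n (p + 1)) : Form n p := fun x =>
  ((-1 : ℂ) ^ (p + 1)) •
    euclStarInv (q := q + 1) (by omega) (extDeriv (fun y => euclStar h (α y)) x)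

/-- The Laplace-Beltrami operator `Δ = dδ + δd` on `p`-forms, where `p + q = n`; the term `dδ` is
absent for `p = 0`, and the term `δd` is absent for `p = n`. -/
def laplaceBeltrami {n : ℕ} : (p q : ℕ) → p + q = n → Form n p → Form n p
  | 0, 0, _, _ => 0
  | 0, q + 1, h, α => coderiv (q := q) (by omega) (extDeriv α)
  | _ + 1, 0, h, α => extDeriv (coderiv h α)
  | _ + 1, q + 1, h, α =>
      extDeriv (coderiv h α) + coderiv (q := q) (by omega) (extDeriv α)

/-! ### Bounded smooth domains and forms on their boundary -/

/-- `ρ` is a smooth defining function of `Ω` near the boundary point `X`: near `X` the set `Ω` is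
`{ρ < 0}`, and `dρ ≠ 0` at `X`. (Only the germ of `ρ` at `X` matters, so that asking for
smoothness on all of `ℝⁿ` is no restriction.) -/
structure IsDefiningFunctionAt {n : ℕ} (Ω : Set (E n)) (X : E n) (ρ : E n → ℝ) : Prop where
  smooth : ContDiff ℝ ∞ ρ
  gradient_ne_zero : ∇ ρ X ≠ 0
  mem_iff : ∀ᶠ Y in nhds X, Y ∈ Ω ↔ ρ Y < 0

/-- The boundary of `Ω` is smooth: `Ω` has a smooth defining function near every boundary point. -/
def HasSmoothBoundary {n : ℕ} (Ω : Set (E n)) : Prop :=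
  ∀ X ∈ frontier Ω, ∃ ρ, IsDefiningFunctionAt Ω X ρ

open Classical in
/-- The outer unit normal `∇ρ / |∇ρ|` at a point of a smooth boundary, where `ρ` is a defining
function near this point; it does not depend on the choice of `ρ`. -/
def outerNormal {n : ℕ} (Ω : Set (E n)) (X : E n) : E n :=
  if h : ∃ ρ, IsDefiningFunctionAt Ω X ρ then ‖∇ h.choose X‖⁻¹ • ∇ h.choose X else 0

/-- The tangent space `T_X Γ` of the boundary `Γ` of `Ω`: the orthogonal complement of the normal. -/
abbrev TangentAt {n : ℕ} (Ω : Set (E n)) (X : E n) : Submodule ℝ (E n) :=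
  (Submodule.span ℝ {outerNormal Ω X})ᗮ

/-- Complex-valued `p`-forms on the boundary `Γ` of `Ω` (not necessarily smooth): they assign
to every `X ∈ Γ` an alternating `p`-form on `T_X Γ`. -/
abbrev BdryForm {n : ℕ} (Ω : Set (E n)) (p : ℕ) :=
  (X : frontier Ω) → TangentAt Ω (X : E n) [⋀^Fin p]→L[ℝ] ℂ

section Boundary

variable {m : ℕ} {Ω : Set (E (m + 1))}

/-- Restriction of `p`-covectors to the tangent space `T_X Γ`. -/
def restrictAt (Ω : Set (E (m + 1))) (X : E (m + 1)) (p : ℕ) :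
    (E (m + 1) [⋀^Fin p]→L[ℝ] ℂ) →L[ℝ] (TangentAt Ω X [⋀^Fin p]→L[ℝ] ℂ) :=
  ContinuousAlternatingMap.compContinuousLinearMapCLM (TangentAt Ω X).subtypeL

/-- The tangential trace `t`: the pullback of a `p`-form under the inclusion of `Γ`. -/
def tangTrace (Ω : Set (E (m + 1))) {p : ℕ} (α : Form (m + 1) p) : BdryForm Ω p :=
  fun X => restrictAt Ω X p (α X)

/-- A form on the (compact, embedded) boundary `Γ` is smooth if it is the tangential trace of
a smooth form on `ℝⁿ`. -/
def BdryForm.IsSmooth {p : ℕ} (α : BdryForm Ω p) : Prop :=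
  ∃ η : Form (m + 1) p, ContDiff ℝ ∞ η ∧ tangTrace Ω η = α

open Classical in
/-- The exterior derivative of a smooth form on `Γ`: `d (t η) = t (d η)` for smooth `η`. As `d`
commutes with pullback, this does not depend on the choice of `η`. -/
def bdryExtDeriv {p : ℕ} (α : BdryForm Ω p) : BdryForm Ω (p + 1) :=
  if h : α.IsSmooth then tangTrace Ω (extDeriv h.choose) else 0

/-- The volume form of `Γ` at `X` for the boundary orientation: `i(ν, μ)` restricted to `T_X Γ`,
where `ν` is the outer unit normal. -/
def bdryVol (Ω : Set (E (m + 1))) (X : E (m + 1)) : TangentAt Ω X [⋀^Fin m]→L[ℝ] ℝ :=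
  ((euclVol (m + 1)).curryLeft (outerNormal Ω X)).compContinuousLinearMap (TangentAt Ω X).subtypeL

/-- The Hodge operator of `Γ`, from `p`-forms to `r`-forms, where `p + r = dim Γ = m`. -/
def bdryStar {p r : ℕ} (h : p + r = m) (α : BdryForm Ω p) : BdryForm Ω r := fun X =>
  hodgeStar (stdOrthonormalBasis ℝ (TangentAt Ω (X : E (m + 1)))) h (bdryVol Ω X) (α X)

/-- The inverse Hodge operator of `Γ`, from `r`-forms to `p`-forms, where `p + r = dim Γ = m`. -/
def bdryStarInv {p r : ℕ} (h : p + r = m) (α : BdryForm Ω r) : BdryForm Ω p := fun X =>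
  hodgeStarInv (stdOrthonormalBasis ℝ (TangentAt Ω (X : E (m + 1)))) h (bdryVol Ω X) (α X)

/-- The coderivative `(-1)^{p+1} *⁻¹ d *` of a `(p+1)`-form on `Γ`, where `(p+1) + r = m`.
The coderivative of a `0`-form is zero. -/
def bdryCoderiv {p r : ℕ} (h : p + 1 + r = m) (α : BdryForm Ω (p + 1)) : BdryForm Ω p :=
  ((-1 : ℂ) ^ (p + 1)) •
    bdryStarInv (r := r + 1) (by omega) (bdryExtDeriv (bdryStar h α))

/-- The surface measure of `Γ`: the (normalized) `m`-dimensional Hausdorff measure. -/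
def surfaceMeasure (Ω : Set (E (m + 1))) : Measure (frontier Ω) :=
  (μHE[m] : Measure (E (m + 1))).comap Subtype.val

end Boundary

/-! ### Fundamental solution of the Helmholtz equation -/

/-- The Bessel function of the first kind,
`J_ν(z) = (z/2)^ν ∑_j (-z²/4)^j / (j! Γ(ν+j+1))` (principal branch). -/
def besselJ (ν : ℝ) (z : ℂ) : ℂ :=
  (z / 2) ^ (ν : ℂ) *
    ∑' j : ℕ, (-(z ^ 2 / 4)) ^ j / ((j.factorial : ℂ) * Complex.Gamma ((ν : ℂ) + j + 1))

/-- The digamma function at positive integers, `ψ(j+1) = -γ + ∑_{i=1}^j 1/i`. -/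
def digammaSucc (j : ℕ) : ℝ := (harmonic j : ℝ) - Real.eulerMascheroniConstant

/-- The Bessel function of the second kind of integer order `l ≥ 0`. -/
def besselYNat (l : ℕ) (z : ℂ) : ℂ :=
  2 / Real.pi * Complex.log (z / 2) * besselJ l z
    - (z / 2) ^ (-(l : ℤ)) / Real.pi *
        ∑ j ∈ Finset.range l, ((l - j - 1).factorial : ℂ) / j.factorial * (z ^ 2 / 4) ^ j
    - (z / 2) ^ l / Real.pi *
        ∑' j : ℕ, ((digammaSucc j + digammaSucc (l + j) : ℝ) : ℂ) * (-(z ^ 2 / 4)) ^ j /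
          ((j.factorial : ℂ) * (l + j).factorial)

open Classical in
/-- The Bessel function of the second kind of order `ν ≥ 0`: for non-integer `ν`,
`Y_ν = (cos(νπ) J_ν - J_{-ν}) / sin(νπ)`; for integer `ν`, the limit of this expression. -/
def besselY (ν : ℝ) (z : ℂ) : ℂ :=
  if ν = (⌊ν⌋₊ : ℝ) then besselYNat ⌊ν⌋₊ z
  else (Real.cos (ν * Real.pi) * besselJ ν z - besselJ (-ν) z) / Real.sin (ν * Real.pi)

/-- The Hankel function of the first kind of order `ν ≥ 0`, `H⁽¹⁾_ν = J_ν + i Y_ν`. -/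
def hankelOne (ν : ℝ) (z : ℂ) : ℂ := besselJ ν z + Complex.I * besselY ν z

open Classical in
/-- The fundamental solution `g_n(X, X')` of the scalar Helmholtz equation in dimension
`n = m + 1 ≥ 2` with wave number `k`, `k = 0` or `0 ≤ arg k < π`; `r₀ > 0` is a length that matters
only for `k = 0`, `n = 2`. -/
def helmholtzKernel (m : ℕ) (k : ℂ) (r₀ : ℝ) (X X' : E (m + 1)) : ℂ :=
  if k ≠ 0 then
    Complex.I / 4 * (k / (2 * Real.pi * dist X X')) ^ (((m + 1) / 2 - 1 : ℝ) : ℂ) *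
      hankelOne ((m + 1) / 2 - 1) (k * dist X X')
  else if m + 1 = 2 then
    ((1 / (2 * Real.pi) * Real.log (r₀ / dist X X') : ℝ) : ℂ)
  else
    ((1 / (((m + 1 : ℝ) - 2) * (μHE[m] (Metric.sphere (0 : E (m + 1)) 1)).toReal) *
      dist X X' ^ (2 - (m + 1 : ℤ)) : ℝ) : ℂ)

/-! ### Layer potentials -/

section Potentials

variable {m : ℕ} {Ω : Set (E (m + 1))}

/-- Double `p`-forms on `ℝⁿ × ℝⁿ`, evaluated at a pair `(X, X')`. The outer alternating slots
belong to the observation point `X'`, the inner ones to the source point `X`. -/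
abbrev DoubleForm (n p : ℕ) := E n → E n → E n [⋀^Fin p]→L[ℝ] (E n [⋀^Fin p]→L[ℝ] ℂ)

/-- The Green kernel `G_p = conj(g_n) I_p`, where the identity double form `I_p` maps a `p`-vector
`v` at `X'` to the `p`-covector `g v` at `X`. -/
def greenKernel (m p : ℕ) (k : ℂ) (r₀ : ℝ) : DoubleForm (m + 1) p := fun X X' =>
  ((starRingEnd ℂ) (helmholtzKernel m k r₀ X X')) • riesz (E (m + 1)) p

/-- The pointwise inner product at `X ∈ Γ`, with respect to the source slots, of a form on `Γ` with
the tangential trace of a double form; it is a `p`-covector at `X'`. -/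
def traceInner {p : ℕ} (α : BdryForm Ω p) (G : DoubleForm (m + 1) p) (X' : E (m + 1))
    (X : frontier Ω) : E (m + 1) [⋀^Fin p]→L[ℝ] ℂ :=
  ((formInner (stdOrthonormalBasis ℝ (TangentAt Ω (X : E (m + 1)))) (α X)) ∘L
    restrictAt Ω X p).compContinuousAlternatingMap (G X X')

/-- The single-layer potential `Ψ_SL α = (α, t G_p)_{L²(Γ)}`. -/
def singleLayer (k : ℂ) (r₀ : ℝ) {p : ℕ} (α : BdryForm Ω p) : Form (m + 1) p := fun X' =>
  ∫ X, traceInner α (greenKernel m p k r₀) X' X ∂surfaceMeasure Ω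

/-- The double-layer potential `Ψ_DL α = -* d Ψ_SL (*⁻¹ α)` of a `p`-form `α` on `Γ`, where
`p + r = dim Γ = m`; thus `*⁻¹ α` is an `r`-form on `Γ`. -/
def doubleLayer (k : ℂ) (r₀ : ℝ) {p r : ℕ} (h : p + r = m) (α : BdryForm Ω p) :
    Form (m + 1) p := fun X' =>
  -euclStar (p := r + 1) (q := p) (by omega)
    (extDeriv (singleLayer k r₀ (bdryStarInv (p := r) (r := p) (by omega) α)) X')

end Potentials

end LayerPotential

end

open LayerPotential

/-!
The potentials of a smooth form on `Γ` are reduced to integrals of smooth vector-valued densities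
against a scalar kernel, and all identities follow from the Helmholtz equation for this kernel and
from Stokes' theorem on the closed hypersurface `Γ`.

The outer unit normal extends to a smooth vector field `N` on `ℝⁿ` (`exists_smooth_normal`). If `α`
is the trace of a form `η`, then the double form `I_p` turns the integrand of `Ψ_SL α` into
`g(X' - X) η_X ∘ P_X`, where `P_X` is the projection along `N(X)` (`traceInner_greenKernel`). The
fundamental solution `g` is a radial function, smooth and with `∑ ∂_j² g = -k² g` away from the
origin (`exists_smoothOff_helmholtzKernel`): as a function of `s = |x|²` it solves the equation
`s h'' + n/2 h' + k²/4 h = 0`, which is verified on the power series of the Bessel functions of both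
kinds. Since `Γ` is compact and disjoint from `Ω`, and since its surface measure is finite, the
integrals converge and may be differentiated under the integral sign (`contDiffOn_layer`). In `ℝⁿ`,
the operator `Δ` acts as `-∑ ∂_j²` on the components of a form (`laplaceBeltrami_eq_sum`), so that
`Ψ_SL α` satisfies the Helmholtz equation.

In `δ Ψ_SL α = Ψ_SL δα`, the operator `δ` acts on `Ψ_SL α` through `-∑ i(e_j) ∂_j`
(`coderiv_eq_sum`), and the derivative of the kernel with respect to `X'` is minus the derivative
with respect to `X`. Thus the claim is that the integral over `Γ` of `g δα - i(∇g) α`, evaluated on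
constant vectors `w₁, …, w_p`, vanishes. Under the Hodge operator of `Γ` this form becomes, up to
sign, `d(g *α)`, and its value on `w₁, …, w_p`, times the volume form of `Γ`, becomes the exact form
`d(g *α ∧ w₁♭ ∧ … ∧ w_p♭)` (`integral_coderiv_eq`). Stokes' theorem on `Γ`
(`integral_normalDensity_extDeriv`) is proved in charts, by a partition of unity; the surface
integral, with respect to the Hausdorff measure, is computed in a chart by the area formula
(`euclideanHausdorffMeasure_image_eq_lintegral`).

The remaining identities are algebra. Since `* *` is a sign, `* Ψ_DL` is by definition a multiple of
`d Ψ_SL *`, and `δ Ψ_DL = 0` amounts to `d² = 0`. If the formula for `δ Ψ_SL` is applied to `*⁻¹ α`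
and inserted in the Helmholtz equation, the formula for `d Ψ_DL` results (`extDeriv_doubleLayer`).
Its Hodge dual is the formula for `* d Ψ_DL`, and its coderivative is the equation
`δ d Ψ_DL = k² Ψ_DL`.
-/

noncomputable section

namespace LayerPotential

/-! ### Exterior and interior products -/

section Wedge

variable {V : Type*} [NormedAddCommGroup V] [NormedSpace ℝ V]
variable {W : Type*} [NormedAddCommGroup W] [NormedSpace ℝ W]
variable {F : Type*} [NormedAddCommGroup F] [NormedSpace ℝ F]

/-- The exterior product `ℓ ∧ η` of a covector with a form, in the normalization
`(ℓ ∧ η)(v₀, …, v_k) = ∑ᵢ (-1)ⁱ ℓ(vᵢ) η(v₀, …, v̂ᵢ, …, v_k)`. -/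
def wedge {k : ℕ} (l : V →L[ℝ] ℝ) (η : V [⋀^Fin k]→L[ℝ] F) : V [⋀^Fin (k + 1)]→L[ℝ] F :=
  ContinuousAlternatingMap.alternatizeUncurryFin (l.smulRight η)

lemma wedge_apply {k : ℕ} (l : V →L[ℝ] ℝ) (η : V [⋀^Fin k]→L[ℝ] F) (v : Fin (k + 1) → V) :
    wedge l η v = ∑ i : Fin (k + 1), (-1 : ℤ) ^ (i : ℕ) • (l (v i) • η (i.removeNth v)) := by
  simp [wedge, ContinuousAlternatingMap.alternatizeUncurryFin_apply]

lemma wedge_add {k : ℕ} (l : V →L[ℝ] ℝ) (η ζ : V [⋀^Fin k]→L[ℝ] F) :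
    wedge l (η + ζ) = wedge l η + wedge l ζ := by
  ext v; simp [wedge_apply, Finset.sum_add_distrib]

lemma wedge_zero {k : ℕ} (l : V →L[ℝ] ℝ) : wedge l (0 : V [⋀^Fin k]→L[ℝ] F) = 0 := by
  ext v; simp [wedge_apply]

lemma wedge_sum {k : ℕ} {ι : Type*} (s : Finset ι) (l : V →L[ℝ] ℝ)
    (η : ι → V [⋀^Fin k]→L[ℝ] F) : wedge l (∑ i ∈ s, η i) = ∑ i ∈ s, wedge l (η i) := by
  classical
  induction s using Finset.induction_on with
  | empty => simp [wedge_zero]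
  | insert a s ha ih => rw [Finset.sum_insert ha, Finset.sum_insert ha, wedge_add, ih]

lemma wedge_smul {k : ℕ} (l : V →L[ℝ] ℝ) (c : ℂ) (η : V [⋀^Fin k]→L[ℝ] ℂ) :
    wedge l (c • η) = c • wedge l η := by
  ext v
  simp only [wedge_apply, ContinuousAlternatingMap.smul_apply, Finset.smul_sum]
  refine Finset.sum_congr rfl fun i _ => ?_
  rw [smul_comm (l (v i)) c, smul_comm _ c]

lemma wedge_comp {k : ℕ} (l : V →L[ℝ] ℝ) (η : V [⋀^Fin k]→L[ℝ] F) (T : W →L[ℝ] V) :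
    (wedge l η).compContinuousLinearMap T = wedge (l ∘L T) (η.compContinuousLinearMap T) := by
  ext v
  simp only [ContinuousAlternatingMap.compContinuousLinearMap_apply, wedge_apply]
  rfl

/-- The interior product is an antiderivation: `i(u) (ℓ ∧ η) = ℓ(u) η - ℓ ∧ i(u) η`. -/
lemma curryLeft_wedge {k : ℕ} (l : V →L[ℝ] ℝ) (η : V [⋀^Fin (k + 1)]→L[ℝ] F) (u : V) :
    (wedge l η).curryLeft u = l u • η - wedge l (η.curryLeft u) := by
  ext v
  simp only [ContinuousAlternatingMap.curryLeft_apply_apply, wedge_apply,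
    ContinuousAlternatingMap.sub_apply, ContinuousAlternatingMap.smul_apply]
  rw [Fin.sum_univ_succ, sub_eq_add_neg, ← Finset.sum_neg_distrib]
  congr 1
  · simp [Matrix.vecCons]
  · refine Finset.sum_congr rfl fun i _ => ?_
    have : (i.succ).removeNth (Matrix.vecCons u v) = Matrix.vecCons u (i.removeNth v) := by
      funext j
      refine Fin.cases ?_ (fun j => ?_) j <;> simp [Fin.removeNth, Matrix.vecCons]
    rw [this]
    simp [pow_succ, Matrix.vecCons]

lemma curryLeft_wedge_zero (l : V →L[ℝ] ℝ) (η : V [⋀^Fin 0]→L[ℝ] F) (u : V) :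
    (wedge l η).curryLeft u = l u • η := by
  ext v
  have h : (0 : Fin 1).removeNth (Matrix.vecCons u v) = v := Subsingleton.elim _ _
  simp [wedge_apply, h]

lemma curryLeft_curryLeft {k : ℕ} (η : V [⋀^Fin (k + 2)]→L[ℝ] F) (u w : V) :
    (η.curryLeft u).curryLeft w = -(η.curryLeft w).curryLeft u := by
  ext v
  simp only [ContinuousAlternatingMap.curryLeft_apply_apply, ContinuousAlternatingMap.neg_apply]
  have := η.toAlternatingMap.map_swap (Matrix.vecCons u (Matrix.vecCons w v))
    (i := 0) (j := 1) (by simp)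
  have h2 : (Matrix.vecCons u (Matrix.vecCons w v)) ∘ (Equiv.swap (0 : Fin (k+2)) 1) =
      Matrix.vecCons w (Matrix.vecCons u v) := by
    funext j
    refine Fin.cases ?_ (fun j => Fin.cases ?_ (fun j => ?_) j) j
    · simp
    · simp
    · rw [Function.comp_apply, Equiv.swap_apply_of_ne_of_ne] <;> simp [Fin.ext_iff]
  rw [h2] at this
  simpa [neg_eq_iff_eq_neg] using (congrArg Neg.neg this).symm

lemma ext_curryLeft {k : ℕ} {η ζ : V [⋀^Fin (k + 1)]→L[ℝ] F}
    (h : ∀ u, η.curryLeft u = ζ.curryLeft u) : η = ζ := by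
  ext v
  have := DFunLike.congr_fun (h (v 0)) (Fin.tail v)
  simpa [Matrix.vecCons] using this

/-- Covectors anticommute. This is the algebraic identity behind `d² = 0`, applied to the symmetric
bilinear map `a ⊗ b + b ⊗ a`. -/
lemma wedge_wedge {k : ℕ} (a b : V →L[ℝ] ℝ) (η : V [⋀^Fin k]→L[ℝ] F) :
    wedge a (wedge b η) = -wedge b (wedge a η) := by
  have key := ContinuousAlternatingMap.alternatizeUncurryFin_alternatizeUncurryFinCLM_comp_of_symmetric
    (f := a.smulRight (b.smulRight η) + b.smulRight (a.smulRight η)) (by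
      intro x y
      simp only [add_apply, ContinuousLinearMap.smulRight_apply,
        smul_apply, smul_smul]
      rw [mul_comm (b x), mul_comm (a x), add_comm])
  rw [ContinuousLinearMap.comp_add, ContinuousAlternatingMap.alternatizeUncurryFin_add] at key
  rw [eq_neg_iff_add_eq_zero]
  convert key using 2
  · rw [wedge]; congr 1; ext; simp [wedge]
  · rw [wedge]; congr 1; ext; simp [wedge]

lemma wedge_eq_zero_of_finrank_lt [FiniteDimensional ℝ V] {k : ℕ} (hk : Module.finrank ℝ V ≤ k)
    (l : V →L[ℝ] ℝ) (η : V [⋀^Fin k]→L[ℝ] F) : wedge l η = 0 := by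
  ext v
  refine (wedge l η).toAlternatingMap.map_linearDependent v fun h => ?_
  have := h.fintype_card_le_finrank
  simp at this
  omega

/-- The exterior product `η ∧ ℓ` of a form with a covector from the right. -/
def wedgeR {k : ℕ} (l : V →L[ℝ] ℝ) (η : V [⋀^Fin k]→L[ℝ] ℂ) : V [⋀^Fin (k + 1)]→L[ℝ] ℂ :=
  (-1 : ℂ) ^ k • wedge l η

lemma wedge_wedgeR {k : ℕ} (a b : V →L[ℝ] ℝ) (η : V [⋀^Fin k]→L[ℝ] ℂ) :
    wedge a (wedgeR b η) = wedgeR b (wedge a η) := by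
  rw [wedgeR, wedgeR, wedge_smul, wedge_wedge, pow_succ]
  simp

/-- The iterated exterior product `η ∧ ℓ₁ ∧ … ∧ ℓ_p`. -/
def wedgesR {r : ℕ} (η : V [⋀^Fin r]→L[ℝ] ℂ) :
    (p : ℕ) → (Fin p → V →L[ℝ] ℝ) → V [⋀^Fin (r + p)]→L[ℝ] ℂ
  | 0, _ => η
  | p + 1, l => wedgeR (l (Fin.last p)) (wedgesR η p (Fin.init l))

end Wedge

/-! ### Multilinear forms in orthonormal bases -/

section Pairing

variable {V : Type*} [NormedAddCommGroup V] [InnerProductSpace ℝ V]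
variable {W : Type*} [NormedAddCommGroup W] [InnerProductSpace ℝ W]
variable {ι κ : Type*} [Fintype ι] [Fintype κ]

/-- A multilinear form is determined by its values on an orthonormal basis. -/
lemma apply_eq_sum_prod_inner_mul (b : OrthonormalBasis ι ℝ W) {p : ℕ}
    (θ : MultilinearMap ℝ (fun _ : Fin p => W) ℂ) (w : Fin p → W) :
    θ w = ∑ K : Fin p → ι, ((∏ i, inner ℝ (b (K i)) (w i) : ℝ) : ℂ) * θ (fun i => b (K i)) := by
  classical
  have h1 : w = fun i => ∑ a, (inner ℝ (b a) (w i) : ℝ) • b a := by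
    funext i
    exact (b.sum_repr' (w i)).symm
  conv_lhs => rw [h1]
  refine (θ.map_sum (fun i a => (inner ℝ (b a) (w i) : ℝ) • b a)).trans
    (Finset.sum_congr rfl fun K _ => ?_)
  exact (θ.map_smul_univ (fun i => (inner ℝ (b (K i)) (w i) : ℝ))
    (fun i => b (K i))).trans Complex.real_smul

/-- If `Q Q* = 1` (that is, `Q` is a coisometry), sums of products of two multilinear forms over an
orthonormal basis are unchanged under `Q`. For `Q = 1` this is independence of the basis. -/
lemma sum_mul_apply_eq_of_coisometry (e : OrthonormalBasis κ ℝ V) (b : OrthonormalBasis ι ℝ W)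
    (Q : V →L[ℝ] W) (hQ : ∀ x y : W, ∑ j, inner ℝ x (Q (e j)) * inner ℝ y (Q (e j)) = inner ℝ x y)
    {p : ℕ} (φ ψ : MultilinearMap ℝ (fun _ : Fin p => W) ℂ) :
    ∑ J : Fin p → κ, φ (fun i => Q (e (J i))) * ψ (fun i => Q (e (J i))) =
      ∑ K : Fin p → ι, φ (fun i => b (K i)) * ψ (fun i => b (K i)) := by
  classical
  have hδ : ∀ K L : Fin p → ι, ∑ J : Fin p → κ,
      (∏ i, inner ℝ (b (K i)) (Q (e (J i))) : ℝ) * (∏ i, inner ℝ (b (L i)) (Q (e (J i))) : ℝ) =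
        if K = L then 1 else 0 := by
    intro K L
    simp_rw [← Finset.prod_mul_distrib]
    rw [← Fintype.piFinset_univ, ← Finset.prod_univ_sum (fun _ => Finset.univ)
      (fun i j => inner ℝ (b (K i)) (Q (e j)) * inner ℝ (b (L i)) (Q (e j)))]
    simp_rw [hQ, b.inner_eq_ite]
    by_cases h : K = L
    · simp [h]
    · obtain ⟨i, hi⟩ := Function.ne_iff.mp h
      rw [if_neg h]
      exact Finset.prod_eq_zero (Finset.mem_univ i) (if_neg hi)
  calc ∑ J : Fin p → κ, φ (fun i => Q (e (J i))) * ψ (fun i => Q (e (J i)))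
      = ∑ J : Fin p → κ, ∑ K : Fin p → ι, ∑ L : Fin p → ι,
          (((∏ i, inner ℝ (b (K i)) (Q (e (J i))) : ℝ) *
            (∏ i, inner ℝ (b (L i)) (Q (e (J i))) : ℝ) : ℝ) : ℂ) *
            (φ (fun i => b (K i)) * ψ (fun i => b (L i))) := by
        refine Finset.sum_congr rfl fun J _ => ?_
        rw [apply_eq_sum_prod_inner_mul b φ, apply_eq_sum_prod_inner_mul b ψ, Finset.sum_mul_sum]
        refine Finset.sum_congr rfl fun K _ => Finset.sum_congr rfl fun L _ => ?_
        push_cast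
        ring
    _ = ∑ K : Fin p → ι, ∑ L : Fin p → ι, (((if K = L then 1 else 0 : ℝ)) : ℂ) *
            (φ (fun i => b (K i)) * ψ (fun i => b (L i))) := by
        rw [Finset.sum_comm]
        refine Finset.sum_congr rfl fun K _ => ?_
        rw [Finset.sum_comm]
        refine Finset.sum_congr rfl fun L _ => ?_
        rw [← Finset.sum_mul, ← hδ K L]
        push_cast
        rfl
    _ = _ := by
        refine Finset.sum_congr rfl fun K _ => ?_
        rw [Finset.sum_eq_single K] <;> simp +contextual [eq_comm]

/-- A form is reproduced by the double form `riesz`. -/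
lemma sum_mul_riesz (b : OrthonormalBasis ι ℝ V) {p : ℕ} (φ : V [⋀^Fin p]→L[ℝ] ℂ)
    (v : Fin p → V) :
    (p.factorial : ℂ)⁻¹ * ∑ J : Fin p → ι, φ (fun i => b (J i)) * riesz V p v (fun i => b (J i)) =
      φ v := by
  classical
  have expand : ∀ w : Fin p → V,
      φ w = ∑ K : Fin p → ι, ((∏ i, inner ℝ (b (K i)) (w i) : ℝ) : ℂ) * φ (fun i => b (K i)) :=
    apply_eq_sum_prod_inner_mul b φ.toMultilinearMap
  -- each of the `p!` terms of the determinant contributes `φ v`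
  have hσ : ∀ σ : Equiv.Perm (Fin p), ∑ J : Fin p → ι, φ (fun i => b (J i)) *
      ((Equiv.Perm.sign σ • ∏ i, (inner ℝ (v i) (b (J (σ i))) : ℝ) : ℝ) : ℂ) = φ v := by
    intro σ
    have h2 : φ (v ∘ σ.symm) = Equiv.Perm.sign σ • φ v := by
      rw [← Equiv.Perm.sign_symm]
      exact φ.toAlternatingMap.map_perm v σ.symm
    have h3 : φ v = Equiv.Perm.sign σ • φ (v ∘ σ.symm) := by
      rw [h2, smul_smul, Int.units_mul_self, one_smul]
    rw [h3, expand, Finset.smul_sum]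
    refine Finset.sum_congr rfl fun J _ => ?_
    have h4 : ∏ i, (inner ℝ (v i) (b (J (σ i))) : ℝ) =
        ∏ i, (inner ℝ (b (J i)) ((v ∘ σ.symm) i) : ℝ) := by
      rw [← Equiv.prod_comp σ fun i => (inner ℝ (b (J i)) ((v ∘ σ.symm) i) : ℝ)]
      refine Finset.prod_congr rfl fun i _ => ?_
      rw [real_inner_comm]
      simp
    rw [h4]
    rcases Int.units_eq_one_or (Equiv.Perm.sign σ) with h | h <;> simp [h, mul_comm]
  have h5 : ∑ J : Fin p → ι, φ (fun i => b (J i)) * riesz V p v (fun i => b (J i)) =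
      ∑ σ : Equiv.Perm (Fin p), φ v := by
    simp_rw [riesz_apply, Matrix.det_apply]
    rw [← Finset.sum_congr rfl fun σ _ => hσ σ, Finset.sum_comm]
    refine Finset.sum_congr rfl fun J _ => ?_
    rw [← Finset.mul_sum, Complex.ofReal_sum]
    rfl
  rw [h5]
  have : (p.factorial : ℂ) ≠ 0 := Nat.cast_ne_zero.mpr p.factorial_ne_zero
  simp [Fintype.card_perm]
  field_simp

end Pairing

/-! ### The Hodge operator of a Euclidean vector space -/

section Hodge

variable {V : Type*} [NormedAddCommGroup V] [InnerProductSpace ℝ V]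
variable {ι : Type*} [Fintype ι] (b : OrthonormalBasis ι ℝ V) {n : ℕ}
variable (μ : V [⋀^Fin n]→L[ℝ] ℝ)

lemma contract_apply {p q : ℕ} (h : p + q = n) (w : Fin p → V) (v : Fin q → V) :
    contract h μ w v = μ (fun j => Fin.append w v (Fin.cast h.symm j)) := rfl

lemma hodgeStar_apply {p q : ℕ} (h : p + q = n) (φ : V [⋀^Fin p]→L[ℝ] ℂ) (v : Fin q → V) :
    hodgeStar b h μ φ v = (p.factorial : ℂ)⁻¹ * ∑ J : Fin p → ι, φ (fun i => b (J i)) *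
      ((contract h μ (fun i => b (J i)) v : ℝ) : ℂ) := by
  simp [hodgeStar]

lemma hodgeStar_add {p q : ℕ} (h : p + q = n) (φ ψ : V [⋀^Fin p]→L[ℝ] ℂ) :
    hodgeStar b h μ (φ + ψ) = hodgeStar b h μ φ + hodgeStar b h μ ψ := by
  ext v
  simp [hodgeStar_apply, add_mul, Finset.sum_add_distrib, mul_add]

lemma hodgeStar_smul {p q : ℕ} (h : p + q = n) (c : ℂ) (φ : V [⋀^Fin p]→L[ℝ] ℂ) :
    hodgeStar b h μ (c • φ) = c • hodgeStar b h μ φ := by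
  ext v
  simp only [hodgeStar_apply, ContinuousAlternatingMap.smul_apply, smul_eq_mul, mul_assoc,
    ← Finset.mul_sum]
  ring

/-- The Hodge operator as a complex-linear map. -/
def hodgeStarₗ {p q : ℕ} (h : p + q = n) : (V [⋀^Fin p]→L[ℝ] ℂ) →ₗ[ℂ] V [⋀^Fin q]→L[ℝ] ℂ where
  toFun := hodgeStar b h μ
  map_add' := hodgeStar_add b μ h
  map_smul' := hodgeStar_smul b μ h

lemma hodgeStar_sum {p q : ℕ} (h : p + q = n) {α : Type*} (s : Finset α)
    (φ : α → V [⋀^Fin p]→L[ℝ] ℂ) :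
    hodgeStar b h μ (∑ a ∈ s, φ a) = ∑ a ∈ s, hodgeStar b h μ (φ a) :=
  map_sum (hodgeStarₗ b μ h) φ s

lemma hodgeStar_neg {p q : ℕ} (h : p + q = n) (φ : V [⋀^Fin p]→L[ℝ] ℂ) :
    hodgeStar b h μ (-φ) = -hodgeStar b h μ φ :=
  map_neg (hodgeStarₗ b μ h) φ

lemma hodgeStar_sub {p q : ℕ} (h : p + q = n) (φ ψ : V [⋀^Fin p]→L[ℝ] ℂ) :
    hodgeStar b h μ (φ - ψ) = hodgeStar b h μ φ - hodgeStar b h μ ψ :=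
  map_sub (hodgeStarₗ b μ h) φ ψ

lemma hodgeStar_real_smul {p q : ℕ} (h : p + q = n) (c : ℝ) (φ : V [⋀^Fin p]→L[ℝ] ℂ) :
    hodgeStar b h μ (c • φ) = c • hodgeStar b h μ φ := by
  have : ∀ {k : ℕ} (ψ : V [⋀^Fin k]→L[ℝ] ℂ), c • ψ = (c : ℂ) • ψ := fun ψ => by ext v; simp
  rw [this, this, hodgeStar_smul]

lemma curryLeft_smul_complex {k : ℕ} (c : ℂ) (φ : V [⋀^Fin (k + 1)]→L[ℝ] ℂ) (u : V) :
    (c • φ).curryLeft u = c • φ.curryLeft u := by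
  ext v; simp

lemma curryLeft_sum {k : ℕ} {α : Type*} (s : Finset α) (φ : α → V [⋀^Fin (k + 1)]→L[ℝ] ℂ)
    (u : V) : (∑ a ∈ s, φ a).curryLeft u = ∑ a ∈ s, (φ a).curryLeft u := by
  ext v; simp

lemma sum_inner_smul_curryLeft {k : ℕ} (φ : V [⋀^Fin (k + 1)]→L[ℝ] ℂ) (w : V) :
    ∑ j, (inner ℝ w (b j) : ℝ) • φ.curryLeft (b j) = φ.curryLeft w := by
  have hw : w = ∑ j, (inner ℝ w (b j) : ℝ) • b j := by
    conv_lhs => rw [← b.sum_repr' w]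
    simp [real_inner_comm]
  conv_rhs => rw [hw]
  simp

/-- The Hodge operator expressed through the Hodge operator in degree one less. -/
lemma hodgeStar_succ {p q : ℕ} (h : p + 1 + q = n) (h' : p + (q + 1) = n)
    (φ : V [⋀^Fin (p + 1)]→L[ℝ] ℂ) :
    hodgeStar b h μ φ = ((-1 : ℂ) ^ p * ((p : ℂ) + 1)⁻¹) •
      ∑ j, (hodgeStar b h' μ (φ.curryLeft (b j))).curryLeft (b j) := by
  ext v
  simp only [hodgeStar_apply, ContinuousAlternatingMap.smul_apply,
    ContinuousAlternatingMap.sum_apply, ContinuousAlternatingMap.curryLeft_apply_apply,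
    smul_eq_mul, ← Finset.mul_sum]
  -- split off the last index of `J`; moving it to the front in `φ` costs the sign `(-1)^p`
  have hre : ∑ J : Fin (p + 1) → ι, φ (fun i => b (J i)) *
      ((contract h μ (fun i => b (J i)) v : ℝ) : ℂ) =
      ∑ x : ι × (Fin p → ι), (-1 : ℂ) ^ p * (φ (Matrix.vecCons (b x.1) fun i => b (x.2 i)) *
        ((contract h' μ (fun i => b (x.2 i)) (Matrix.vecCons (b x.1) v) : ℝ) : ℂ)) := by
    refine (Fintype.sum_equiv (Fin.snocEquiv fun _ => ι) _ _ fun x => ?_).symm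
    have h1 : (fun i => b ((Fin.snocEquiv fun _ => ι) x i)) =
        Fin.snoc (fun i => b (x.2 i)) (b x.1) := by
      funext i
      refine Fin.lastCases ?_ (fun j => ?_) i <;> simp [Fin.snocEquiv]
    have h2 : φ (Fin.snoc (fun i => b (x.2 i)) (b x.1)) =
        (-1 : ℂ) ^ p * φ (Matrix.vecCons (b x.1) fun i => b (x.2 i)) := by
      rw [Fin.snoc_eq_cons_rotate]
      have := φ.toAlternatingMap.map_perm (Matrix.vecCons (b x.1) fun i => b (x.2 i))
        (finRotate (p + 1))
      refine this.trans ?_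
      rw [sign_finRotate]
      rcases Nat.even_or_odd p with hp | hp <;> simp [hp.neg_one_pow]
    have h3 : contract h μ (Fin.snoc (fun i => b (x.2 i)) (b x.1)) v =
        contract h' μ (fun i => b (x.2 i)) (Matrix.vecCons (b x.1) v) := by
      rw [contract_apply, contract_apply, Fin.append_left_snoc]
      rfl
    rw [h1, h2, h3, mul_assoc]
  rw [hre, ← Finset.mul_sum, Fintype.sum_prod_type, Nat.factorial_succ]
  push_cast
  rw [mul_inv]
  ring

lemma hodgeStar_zero_form {q : ℕ} (h : 0 + q = n) (φ : V [⋀^Fin 0]→L[ℝ] ℂ) (v : Fin q → V) :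
    hodgeStar b h μ φ v = φ ![] *
      ((μ (fun j => v (Fin.cast (h.symm.trans (Nat.zero_add q)) j)) : ℝ) : ℂ) := by
  have h1 : ∀ w : Fin 0 → V, contract h μ w v =
      μ (fun j => v (Fin.cast (h.symm.trans (Nat.zero_add q)) j)) := by
    intro w
    rw [contract_apply, Fin.append_left_nil _ _ rfl]
    rfl
  rw [hodgeStar_apply]
  simp [h1]
  left
  exact congrArg φ (Subsingleton.elim _ _)

include b in
lemma card_eq_finrank : Fintype.card ι = Module.finrank ℝ V :=
  (Module.finrank_eq_card_basis b.toBasis).symm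

/-- The exterior product with a covector is adjoint, through the Hodge operator, to the interior
product with the corresponding vector. The proof is by induction on the degree, through
`hodgeStar_succ`. -/
lemma wedge_hodgeStar (hn : Fintype.card ι = n) {p : ℕ} : ∀ {q : ℕ} (h : p + 1 + q = n)
    (h' : p + (q + 1) = n) (φ : V [⋀^Fin (p + 1)]→L[ℝ] ℂ) (w : V),
    wedge (innerSL ℝ w) (hodgeStar b h μ φ) =
      (-1 : ℂ) ^ p • hodgeStar b h' μ (φ.curryLeft w) := by
  have hfd : FiniteDimensional ℝ V := b.toBasis.finiteDimensional_of_finite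
  induction p with
  | zero =>
    intro q h h' φ w
    rw [hodgeStar_succ b μ h h', wedge_smul, wedge_sum]
    -- the degree exceeds the dimension
    have hz : ∀ j, wedge (innerSL ℝ w) (hodgeStar b h' μ (φ.curryLeft (b j))) = 0 := fun j =>
      wedge_eq_zero_of_finrank_lt (by rw [← card_eq_finrank b]; omega) _ _
    have : ∀ j, wedge (innerSL ℝ w) ((hodgeStar b h' μ (φ.curryLeft (b j))).curryLeft (b j)) =
        (inner ℝ w (b j) : ℝ) • hodgeStar b h' μ (φ.curryLeft (b j)) := by
      intro j
      have := curryLeft_wedge (innerSL ℝ w) (hodgeStar b h' μ (φ.curryLeft (b j))) (b j)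
      rw [hz] at this
      rw [eq_comm, ← sub_eq_zero]
      simpa using this.symm
    simp_rw [this, ← hodgeStar_real_smul, ← hodgeStar_sum, sum_inner_smul_curryLeft]
    simp
  | succ p ih =>
    intro q h h' φ w
    rw [hodgeStar_succ b μ h h', wedge_smul, wedge_sum]
    have h1 : ∀ j, wedge (innerSL ℝ w) ((hodgeStar b h' μ (φ.curryLeft (b j))).curryLeft (b j)) =
        hodgeStar b h' μ ((inner ℝ w (b j) : ℝ) • φ.curryLeft (b j)) +
        (-1 : ℂ) ^ p • (hodgeStar b (by omega) μ
          ((φ.curryLeft w).curryLeft (b j))).curryLeft (b j) := by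
      intro j
      have h2 := curryLeft_wedge (innerSL ℝ w) (hodgeStar b h' μ (φ.curryLeft (b j))) (b j)
      rw [ih h' (by omega), curryLeft_curryLeft, hodgeStar_neg] at h2
      rw [hodgeStar_real_smul]
      rw [curryLeft_smul_complex] at h2
      have h3 := (sub_eq_iff_eq_add.mp h2.symm)
      rw [innerSL_apply_apply] at h3
      rw [h3]
      ext v
      simp
    simp_rw [h1, Finset.sum_add_distrib, ← hodgeStar_sum, sum_inner_smul_curryLeft,
      ← Finset.smul_sum]
    have hS := hodgeStar_succ b μ h' (by omega : p + (q + 1 + 1) = n) (φ.curryLeft w)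
    rw [hS]
    simp only [smul_smul, ← add_smul]
    congr 1
    have : (p : ℂ) + 1 ≠ 0 := Nat.cast_add_one_ne_zero p
    have : (p : ℂ) + 1 + 1 ≠ 0 := by exact_mod_cast Nat.succ_ne_zero (p + 1)
    push_cast
    field_simp
    ring

/-- The interior product is adjoint, through the Hodge operator, to the exterior product. Here
`n` need not be the dimension of the space. -/
lemma hodgeStar_wedge {p : ℕ} : ∀ {q : ℕ} (h : p + 1 + q = n) (h' : p + (q + 1) = n)
    (φ : V [⋀^Fin p]→L[ℝ] ℂ) (w : V),
    hodgeStar b h μ (wedge (innerSL ℝ w) φ) =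
      (-1 : ℂ) ^ p • (hodgeStar b h' μ φ).curryLeft w := by
  induction p with
  | zero =>
    intro q h h' φ w
    rw [hodgeStar_succ b μ h h']
    simp_rw [curryLeft_wedge_zero, hodgeStar_real_smul, innerSL_apply_apply]
    rw [← sum_inner_smul_curryLeft b _ w]
    simp
  | succ p ih =>
    intro q h h' φ w
    rw [hodgeStar_succ b μ h h']
    have h1 : ∀ j, (hodgeStar b h' μ ((wedge (innerSL ℝ w) φ).curryLeft (b j))).curryLeft (b j) =
        (inner ℝ w (b j) : ℝ) • (hodgeStar b h' μ φ).curryLeft (b j) +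
          (-1 : ℂ) ^ p • ((hodgeStar b (by omega : p + (q + 1 + 1) = n) μ
            (φ.curryLeft (b j))).curryLeft (b j)).curryLeft w := by
      intro j
      rw [curryLeft_wedge, hodgeStar_sub, ih h' (by omega), hodgeStar_real_smul]
      have h2 := curryLeft_curryLeft (hodgeStar b (by omega : p + (q + 1 + 1) = n) μ
            (φ.curryLeft (b j))) w (b j)
      have h3 : ∀ (x : V [⋀^Fin (q + 1)]→L[ℝ] ℂ) (y : V [⋀^Fin (q + 1)]→L[ℝ] ℂ) (c : ℝ),
        (c • x - y).curryLeft (b j) = c • x.curryLeft (b j) - y.curryLeft (b j) := by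
        intro x y c; ext; simp
      rw [h3, innerSL_apply_apply, curryLeft_smul_complex, h2, smul_neg, sub_neg_eq_add]
    simp_rw [h1, Finset.sum_add_distrib, sum_inner_smul_curryLeft, ← Finset.smul_sum,
      ← curryLeft_sum]
    have hS := hodgeStar_succ b μ h' (by omega : p + (q + 1 + 1) = n) φ
    rw [hS, curryLeft_smul_complex]
    simp only [smul_smul, ← add_smul]
    congr 1
    have : (p : ℂ) + 1 ≠ 0 := Nat.cast_add_one_ne_zero p
    have : (p : ℂ) + 1 + 1 ≠ 0 := by exact_mod_cast Nat.succ_ne_zero (p + 1)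
    push_cast
    field_simp
    ring

/-- An `n`-form is a unit volume form if the sum of the squares of its components with respect to
an orthonormal basis, over increasing indices, is `1`. -/
def IsUnitVolume : Prop :=
  (n.factorial : ℝ)⁻¹ * ∑ J : Fin n → ι, μ (fun i => b (J i)) ^ 2 = 1

variable {b μ}

/-- On `p`-forms, `* * = (-1)^{pq}`. In degree `0` this is the normalization of `μ`; the interior
products of both sides are compared by `wedge_hodgeStar` and `hodgeStar_wedge`. -/
lemma hodgeStar_hodgeStar (hn : Fintype.card ι = n) (hμ : IsUnitVolume b μ) {p : ℕ} :
    ∀ {q : ℕ} (h : p + q = n) (h' : q + p = n) (φ : V [⋀^Fin p]→L[ℝ] ℂ),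
    hodgeStar b h' μ (hodgeStar b h μ φ) = (-1 : ℂ) ^ (p * q) • φ := by
  induction p with
  | zero =>
    intro q h h' φ
    obtain rfl : q = n := by omega
    ext v
    have h1 : ∀ w : Fin q → V, contract h' μ w v = μ w := by
      intro w
      rw [contract_apply, Fin.append_right_nil _ _ rfl]
      rfl
    rw [hodgeStar_apply]
    simp_rw [hodgeStar_zero_form, h1]
    have h2 : (q.factorial : ℂ)⁻¹ * ∑ J : Fin q → ι, ((μ (fun i => b (J i)) : ℝ) : ℂ) ^ 2 = 1 := by
      have h3 := congrArg Complex.ofReal hμ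
      push_cast at h3 ⊢
      exact h3
    have h3 : φ v = φ ![] := congrArg φ (Subsingleton.elim _ _)
    simp only [mul_assoc, ← Finset.mul_sum, Fin.cast_eq_self]
    rw [ContinuousAlternatingMap.smul_apply, h3]
    simp only [← pow_two]
    rw [mul_left_comm, h2]
    simp
  | succ p ih =>
    intro q h h' φ
    refine ext_curryLeft fun u => ?_
    have h1 := hodgeStar_wedge b μ (by omega : q + 1 + p = n) h' (hodgeStar b h μ φ) u
    rw [wedge_hodgeStar b μ hn h (by omega), hodgeStar_smul, ih] at h1
    rw [curryLeft_smul_complex]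
    have h2 : (hodgeStar b h' μ (hodgeStar b h μ φ)).curryLeft u =
        (-1 : ℂ) ^ q • ((-1 : ℂ) ^ q • (hodgeStar b h' μ (hodgeStar b h μ φ)).curryLeft u) := by
      rw [smul_smul, ← mul_pow]; simp
    rw [h2, ← h1]
    simp only [smul_smul]
    congr 1
    rcases Nat.even_or_odd p with hp | hp <;> rcases Nat.even_or_odd q with hq | hq <;>
      simp [hp.neg_one_pow, hq.neg_one_pow, pow_add, pow_mul, mul_add, add_mul]

lemma hodgeStar_hodgeStarInv (hn : Fintype.card ι = n) (hμ : IsUnitVolume b μ) {p q : ℕ}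
    (h : p + q = n) (φ : V [⋀^Fin q]→L[ℝ] ℂ) :
    hodgeStar b h μ (hodgeStarInv b h μ φ) = φ := by
  rw [hodgeStarInv, hodgeStar_smul, hodgeStar_hodgeStar hn hμ, smul_smul, mul_comm q p, ← mul_pow]
  simp

lemma hodgeStarInv_hodgeStar (hn : Fintype.card ι = n) (hμ : IsUnitVolume b μ) {p q : ℕ}
    (h : p + q = n) (φ : V [⋀^Fin p]→L[ℝ] ℂ) :
    hodgeStarInv b h μ (hodgeStar b h μ φ) = φ := by
  rw [hodgeStarInv, hodgeStar_hodgeStar hn hμ, smul_smul, ← mul_pow]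
  simp

variable (b μ)

/-- The `(-1)^{(n-1)p}`-multiple of `*α ∧ w₁♭ ∧ … ∧ w_p♭` is `*(i(w_p) ⋯ i(w₁) α)`; for a `p`-form
`α` this is the multiple `α(w₁, …, w_p) μ` of the volume form. -/
lemma wedgesR_hodgeStar_aux (hn : Fintype.card ι = n) (p : ℕ) :
    ∀ {d s q : ℕ} (hd : d + q = n) (h : p + s = d) (h' : s + (q + p) = n)
    (α : V [⋀^Fin d]→L[ℝ] ℂ) (β : V [⋀^Fin s]→L[ℝ] ℂ) (w : Fin p → V),
    (∀ v, β v = α (fun j => Fin.append w v (Fin.cast h.symm j))) →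
    wedgesR (hodgeStar b hd μ α) p (fun i => innerSL ℝ (w i)) =
      (-1 : ℂ) ^ ((n - 1) * p) • hodgeStar b h' μ β := by
  induction p with
  | zero =>
    intro d s q hd h h' α β w hβ
    obtain rfl : s = d := by omega
    have : β = α := by
      ext v
      rw [hβ, Fin.append_left_nil _ _ rfl]
      rfl
    simp [wedgesR, this]
  | succ p ih =>
    intro d s q hd h h' α β w hβ
    subst h
    have hlen : p + 1 + s = p + (s + 1) := by omega
    -- the partial evaluation of `α` in all but the last of the vectors `w`
    let γ : V [⋀^Fin (s + 1)]→L[ℝ] ℂ :=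
      { toFun := fun v => α (fun j => Fin.append (Fin.init w) v (Fin.cast hlen j))
        map_update_add' := by
          intro inst v i x y
          have := append_update_right hlen.symm (Fin.init w) v i
          simp only [this]
          exact α.map_update_add _ _ _ _
        map_update_smul' := by
          intro inst v i c x
          have := append_update_right hlen.symm (Fin.init w) v i
          simp only [this]
          exact α.map_update_smul _ _ _ _
        cont := by
          refine α.cont.comp (continuous_pi fun j => ?_)
          generalize Fin.cast hlen j = k
          refine Fin.addCases (fun a => ?_) (fun b => ?_) k
          · simpa using continuous_const
          · simpa using continuous_apply b
        map_eq_zero_of_eq' := by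
          intro v i j hv hij
          refine α.map_eq_zero_of_eq _ (i := Fin.cast hlen.symm (Fin.natAdd p i))
            (j := Fin.cast hlen.symm (Fin.natAdd p j)) ?_ ?_
          · simpa using hv
          · intro hh
            apply hij
            have := congrArg Fin.val hh
            simp at this
            exact Fin.ext this }
    have hγ : ∀ v, γ v = α (fun j => Fin.append (Fin.init w) v (Fin.cast hlen j)) := fun v => rfl
    have h1 := ih hd (by omega : p + (s + 1) = p + 1 + s) (by omega) α γ (Fin.init w) hγ
    have h2 : γ.curryLeft (w (Fin.last p)) = β := by
      ext v
      rw [ContinuousAlternatingMap.curryLeft_apply_apply, hγ, hβ]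
      congr 1
      conv_rhs => rw [← Fin.snoc_init_self w, Fin.append_left_snoc]
      rfl
    have h3 : wedgesR (hodgeStar b hd μ α) (p + 1) (fun i => innerSL ℝ (w i)) =
      wedgeR (innerSL ℝ (w (Fin.last p)))
        (wedgesR (hodgeStar b hd μ α) p (fun i => innerSL ℝ (Fin.init w i))) := rfl
    rw [h3, h1, wedgeR, wedge_smul, wedge_hodgeStar b μ hn _ (by omega), h2]
    simp only [smul_smul]
    have h4 : hodgeStar b (by omega : s + (q + p + 1) = n) μ β = hodgeStar b h' μ β := rfl
    rw [h4]
    congr 1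
    have h5 : n - 1 = s + (q + p) := by omega
    rw [h5, mul_add, mul_one, pow_add _ _ (s + (q + p)), pow_add _ s]
    ring

/-- If `α` is a `p`-form, then `*α ∧ w₁♭ ∧ … ∧ w_p♭ = (-1)^{(n-1)p} α(w₁, …, w_p) μ`. -/
lemma wedgesR_hodgeStar (hn : Fintype.card ι = n) {p q : ℕ} (h : p + q = n)
    (α : V [⋀^Fin p]→L[ℝ] ℂ) (w : Fin p → V) (v : Fin (q + p) → V) :
    wedgesR (hodgeStar b h μ α) p (fun i => innerSL ℝ (w i)) v =
      (-1 : ℂ) ^ ((n - 1) * p) * α w * ((μ (fun j => v (Fin.cast (by omega) j)) : ℝ) : ℂ) := by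
  rw [wedgesR_hodgeStar_aux b μ hn p h (Nat.add_zero p) (by omega) α
    (ContinuousAlternatingMap.constOfIsEmpty ℝ V (Fin 0) (α w)) w ?_,
    ContinuousAlternatingMap.smul_apply, hodgeStar_zero_form]
  · simp [mul_assoc]
  · intro v
    rw [Fin.append_right_nil _ _ rfl]
    simp

end Hodge

/-! ### The hyperplane orthogonal to a unit vector -/

section UnitNormal

variable {V : Type*} [NormedAddCommGroup V] [InnerProductSpace ℝ V]
variable {ι κ : Type*} [Fintype ι] [Fintype κ]

/-- The projection `v ↦ v - ⟨N, v⟩ N` along `N`; for a unit vector `N` this is the orthogonal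
projection onto the orthogonal complement of `N`. -/
def tangProj (N : V) : V →L[ℝ] V :=
  ContinuousLinearMap.id ℝ V - (innerSL ℝ N).smulRight N

lemma tangProj_apply (N v : V) : tangProj N v = v - (inner ℝ N v : ℝ) • N := rfl

lemma coe_orthogonalProjection_eq_tangProj {N : V} (hN : ‖N‖ = 1) (v : V) :
    ((ℝ ∙ N)ᗮ.orthogonalProjectionOnto v : V) = tangProj N v := by
  rw [tangProj_apply, ← Submodule.starProjection_apply, Submodule.starProjection_orthogonal_val,
    Submodule.starProjection_unit_singleton ℝ hN]

lemma tangProj_of_mem {N v : V} (hv : v ∈ (ℝ ∙ N)ᗮ) : tangProj N v = v := by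
  rw [Submodule.mem_orthogonal_singleton_iff_inner_right] at hv
  simp [tangProj_apply, hv]

lemma tangProj_mem {N : V} (hN : ‖N‖ = 1) (v : V) : tangProj N v ∈ (ℝ ∙ N)ᗮ := by
  rw [Submodule.mem_orthogonal_singleton_iff_inner_right, tangProj_apply, inner_sub_right,
    inner_smul_right, real_inner_self_eq_norm_sq, hN]
  simp

lemma inner_tangProj_left (N v w : V) : inner ℝ (tangProj N v) w = inner ℝ v (tangProj N w) := by
  simp [tangProj_apply, inner_sub_left, inner_sub_right, inner_smul_left, inner_smul_right,
    real_inner_comm]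
  ring

/-- A form annihilated by the interior product with `N` only depends on tangential components. -/
lemma comp_tangProj_of_curryLeft_eq_zero {F : Type*} [NormedAddCommGroup F] [NormedSpace ℝ F]
    (N : V) {k : ℕ} (θ : V [⋀^Fin k]→L[ℝ] F)
    (hθ : ∀ v : Fin k → V, ∀ i, v i = N → θ v = 0) (v : Fin k → V) :
    θ (fun i => tangProj N (v i)) = θ v := by
  classical
  suffices H : ∀ s : Finset (Fin k), θ (fun i => if i ∈ s then tangProj N (v i) else v i) = θ v by
    simpa using H Finset.univ
  intro s
  induction s using Finset.induction_on with
  | empty => simp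
  | insert a s ha ih =>
    rw [← ih]
    have h1 : (fun i => if i ∈ insert a s then tangProj N (v i) else v i) =
        Function.update (fun i => if i ∈ s then tangProj N (v i) else v i) a
          (v a + (-inner ℝ N (v a) : ℝ) • N) := by
      funext i
      by_cases hi : i = a
      · subst hi; simp [tangProj_apply, sub_eq_add_neg]
      · simp [hi]
    have h2 : (fun i => if i ∈ s then tangProj N (v i) else v i) =
        Function.update (fun i => if i ∈ s then tangProj N (v i) else v i) a (v a) := by
      rw [eq_comm, Function.update_eq_self_iff]
      simp [ha]
    have hz : ∀ u, θ (Function.update u a N) = 0 := fun u => hθ _ a (by simp)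
    rw [h1, θ.map_update_add, θ.map_update_smul, hz, smul_zero, add_zero, ← h2]

lemma curryLeft_self_apply_eq_zero {F : Type*} [NormedAddCommGroup F] [NormedSpace ℝ F]
    (N : V) {k : ℕ} (μ : V [⋀^Fin (k + 1)]→L[ℝ] F) (v : Fin k → V) (i : Fin k) (hi : v i = N) :
    μ.curryLeft N v = 0 := by
  rw [ContinuousAlternatingMap.curryLeft_apply_apply]
  exact μ.map_eq_zero_of_eq _ (i := 0) (j := i.succ) (by simp [hi]) (Fin.succ_ne_zero i).symm

variable {m : ℕ} (e : OrthonormalBasis κ ℝ V) {N : V} (μ : V [⋀^Fin (m + 1)]→L[ℝ] ℝ)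

/-- The orthogonal projection onto a hyperplane is a coisometry. -/
lemma sum_inner_tangProj (hN : ‖N‖ = 1) (x y : (ℝ ∙ N)ᗮ) :
    ∑ j, inner ℝ x ((ℝ ∙ N)ᗮ.orthogonalProjectionOnto (e j)) *
      inner ℝ y ((ℝ ∙ N)ᗮ.orthogonalProjectionOnto (e j)) = inner ℝ x y := by
  have h : ∀ (x : (ℝ ∙ N)ᗮ) j, inner ℝ x ((ℝ ∙ N)ᗮ.orthogonalProjectionOnto (e j)) =
      inner ℝ (x : V) (e j) := by
    intro x j
    rw [Submodule.coe_inner, coe_orthogonalProjection_eq_tangProj hN, ← inner_tangProj_left,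
      tangProj_of_mem x.2]
  simp_rw [h]
  rw [Submodule.coe_inner, ← e.sum_inner_mul_inner]
  exact Finset.sum_congr rfl fun j _ => by rw [real_inner_comm (y : V)]

lemma append_update_left {U : Type*} {p q n : ℕ} [DecidableEq (Fin p)] (h : p + q = n)
    (w : Fin p → U) (v : Fin q → U) (i : Fin p) (z : U) :
    (fun j : Fin n => Fin.append (Function.update w i z) v (Fin.cast h.symm j)) =
      Function.update (fun j : Fin n => Fin.append w v (Fin.cast h.symm j))
        (Fin.cast h (Fin.castAdd q i)) z := by
  subst h
  funext j
  refine Fin.addCases (fun a => ?_) (fun c => ?_) j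
  · by_cases ha : a = i
    · subst ha; simp
    · have hne : Fin.castAdd q a ≠ Fin.castAdd q i := fun hh => ha (by simpa using hh)
      simp [Function.update_of_ne hne, Function.update_of_ne ha]
  · have hne : Fin.natAdd p c ≠ Fin.castAdd q i := by
      intro hh
      have := congrArg Fin.val hh
      simp at this
      omega
    simp [Function.update_of_ne hne]

/-- The function `w ↦ μ(w₁, …, w_p, v₁, …, v_q)` of which `contract` is the partial evaluation in
the other group of variables. -/
def contractRight {n p q : ℕ} (h : p + q = n) (μ : V [⋀^Fin n]→L[ℝ] ℝ) (v : Fin q → V) :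
    MultilinearMap ℝ (fun _ : Fin p => V) ℝ where
  toFun w := contract h μ w v
  map_update_add' w i x y := by
    simp only [contract_apply, append_update_left h]
    exact μ.map_update_add _ _ _ _
  map_update_smul' w i c x := by
    simp only [contract_apply, append_update_left h]
    exact μ.map_update_smul _ _ _ _

/-- The Hodge operator of the hyperplane orthogonal to a unit vector `N`, with the volume form
`i(N) μ`, expressed in an orthonormal basis of the ambient space. -/
lemma hodgeStar_restrict (hN : ‖N‖ = 1) (b : OrthonormalBasis ι ℝ (ℝ ∙ N)ᗮ) {p q : ℕ}
    (h : p + q = m) (η : V [⋀^Fin p]→L[ℝ] ℂ) :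
    hodgeStar b h ((μ.curryLeft N).compContinuousLinearMap (ℝ ∙ N)ᗮ.subtypeL)
        (η.compContinuousLinearMap (ℝ ∙ N)ᗮ.subtypeL) =
      (hodgeStar e h (μ.curryLeft N)
        (η.compContinuousLinearMap (tangProj N))).compContinuousLinearMap (ℝ ∙ N)ᗮ.subtypeL := by
  ext v
  rw [hodgeStar_apply, ContinuousAlternatingMap.compContinuousLinearMap_apply, hodgeStar_apply]
  congr 1
  have key := sum_mul_apply_eq_of_coisometry e b (ℝ ∙ N)ᗮ.orthogonalProjectionOnto
    (sum_inner_tangProj e hN)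
    (η.compContinuousLinearMap (ℝ ∙ N)ᗮ.subtypeL).toMultilinearMap
    (Complex.ofRealCLM.toLinearMap.compMultilinearMap
      (contractRight h ((μ.curryLeft N).compContinuousLinearMap (ℝ ∙ N)ᗮ.subtypeL) v))
  refine key.symm.trans (Finset.sum_congr rfl fun J _ => ?_)
  congr 1
  · change η (fun i => ((ℝ ∙ N)ᗮ.orthogonalProjectionOnto (e (J i)) : V)) = η _
    simp_rw [coe_orthogonalProjection_eq_tangProj hN]
    rfl
  · change ((μ.curryLeft N (fun j => ((Fin.append
      (fun i => (ℝ ∙ N)ᗮ.orthogonalProjectionOnto (e (J i))) v (Fin.cast h.symm j) :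
        (ℝ ∙ N)ᗮ) : V)) : ℝ) : ℂ) = _
    rw [contract_apply, ← comp_tangProj_of_curryLeft_eq_zero N (μ.curryLeft N)
      (curryLeft_self_apply_eq_zero N μ) (fun j => Fin.append (fun i => e (J i)) _ _)]
    congr 3
    funext j
    generalize Fin.cast h.symm j = k
    refine Fin.addCases (fun a => ?_) (fun c => ?_) k
    · simp [coe_orthogonalProjection_eq_tangProj hN]
    · simp [tangProj_of_mem (v c).2]

/-- The double form `riesz` of the ambient space, restricted to a hyperplane in one of its
arguments, evaluates a form on the hyperplane at the projections of the other argument. -/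
lemma formInner_restrict_riesz (hN : ‖N‖ = 1) (b : OrthonormalBasis ι ℝ (ℝ ∙ N)ᗮ) {p : ℕ}
    (φ : (ℝ ∙ N)ᗮ [⋀^Fin p]→L[ℝ] ℂ) (v : Fin p → V) :
    formInner b φ ((riesz V p v).compContinuousLinearMap (ℝ ∙ N)ᗮ.subtypeL) =
      φ (fun i => (ℝ ∙ N)ᗮ.orthogonalProjectionOnto (v i)) := by
  rw [← sum_mul_riesz b φ]
  simp only [formInner, sum_apply, smul_apply, Finset.mul_sum]
  refine Finset.sum_congr rfl fun J _ => ?_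
  have : (riesz V p v).compContinuousLinearMap (ℝ ∙ N)ᗮ.subtypeL (fun i => b (J i)) =
      riesz (ℝ ∙ N)ᗮ p (fun i => (ℝ ∙ N)ᗮ.orthogonalProjectionOnto (v i)) (fun i => b (J i)) := by
    rw [ContinuousAlternatingMap.compContinuousLinearMap_apply, riesz_apply, riesz_apply]
    congr 3
    ext j i
    simp only [Function.comp_apply, Submodule.subtypeL_apply, Submodule.coe_inner,
      coe_orthogonalProjection_eq_tangProj hN]
    rw [inner_tangProj_left, tangProj_of_mem (b (J j)).2]
  simp only [ContinuousLinearMap.comp_apply, ContinuousAlternatingMap.apply_apply, this]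
  rw [riesz_apply]
  simp [mul_assoc]

/-- The form `i(N) μ` is a unit volume form on the hyperplane orthogonal to `N`: since `*μ = 1`,
the identity `N♭ ∧ *μ = (-1)^m *(i(N) μ)`, evaluated at `N`, says that its squared norm is `1`. -/
lemma isUnitVolume_restrict (he : Fintype.card κ = m + 1) (hμ : IsUnitVolume e μ) (hN : ‖N‖ = 1)
    (b : OrthonormalBasis ι ℝ (ℝ ∙ N)ᗮ) :
    IsUnitVolume b ((μ.curryLeft N).compContinuousLinearMap (ℝ ∙ N)ᗮ.subtypeL) := by
  have key := sum_mul_apply_eq_of_coisometry e b (ℝ ∙ N)ᗮ.orthogonalProjectionOnto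
    (sum_inner_tangProj e hN)
    (Complex.ofRealCLM.compContinuousAlternatingMap
      ((μ.curryLeft N).compContinuousLinearMap (ℝ ∙ N)ᗮ.subtypeL)).toMultilinearMap
    (Complex.ofRealCLM.compContinuousAlternatingMap
      ((μ.curryLeft N).compContinuousLinearMap (ℝ ∙ N)ᗮ.subtypeL)).toMultilinearMap
  have h1 : ∀ J : Fin m → κ, (Complex.ofRealCLM.compContinuousAlternatingMap
      ((μ.curryLeft N).compContinuousLinearMap (ℝ ∙ N)ᗮ.subtypeL)).toMultilinearMap
        (fun i => (ℝ ∙ N)ᗮ.orthogonalProjectionOnto (e (J i))) =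
      ((μ.curryLeft N (fun i => e (J i)) : ℝ) : ℂ) := by
    intro J
    rw [← comp_tangProj_of_curryLeft_eq_zero N (μ.curryLeft N)
      (curryLeft_self_apply_eq_zero N μ)]
    simp_rw [← coe_orthogonalProjection_eq_tangProj hN]
    rfl
  simp_rw [h1] at key
  -- `*μ = 1`
  have hstar : ∀ v, hodgeStar e (Nat.add_zero (m + 1)) μ
      (Complex.ofRealCLM.compContinuousAlternatingMap μ) v = 1 := by
    intro v
    rw [hodgeStar_apply]
    have h2 : ∀ w : Fin (m + 1) → V, contract (Nat.add_zero (m + 1)) μ w v = μ w := by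
      intro w
      rw [contract_apply, Fin.append_right_nil _ _ rfl]
      rfl
    simp_rw [h2]
    have h3 := congrArg Complex.ofReal hμ
    push_cast at h3
    rw [← h3]
    simp [pow_two]
  have h4 := wedge_hodgeStar e μ he (Nat.add_zero (m + 1)) (rfl : m + (0 + 1) = m + 1)
    (Complex.ofRealCLM.compContinuousAlternatingMap μ) N
  have h5 := DFunLike.congr_fun h4 ![N]
  rw [wedge_apply] at h5
  simp only [hstar] at h5
  rw [ContinuousAlternatingMap.smul_apply, hodgeStar_apply] at h5
  have h6 : ∀ w : Fin m → V, contract (rfl : m + (0 + 1) = m + 1) μ w ![N] =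
      (-1) ^ m * μ.curryLeft N w := by
    intro w
    rw [contract_apply, Fin.append_right_eq_snoc, Fin.snoc_eq_cons_rotate]
    refine (μ.toAlternatingMap.map_perm (Matrix.vecCons N w) (finRotate (m + 1))).trans ?_
    rw [sign_finRotate]
    rcases Nat.even_or_odd m with hp | hp <;> simp [hp.neg_one_pow]
  have h7 : ∀ w : Fin m → V, ((Complex.ofRealCLM.compContinuousAlternatingMap μ).curryLeft N) w =
      ((μ.curryLeft N w : ℝ) : ℂ) := fun w => rfl
  simp_rw [h6, h7] at h5
  rw [IsUnitVolume]
  have h8 : ((-1 : ℂ) ^ m) * (-1 : ℂ) ^ m = 1 := by rw [← mul_pow]; simp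
  have h9 : (m.factorial : ℂ)⁻¹ * ∑ J : Fin m → κ, ((μ.curryLeft N fun i => e (J i) : ℝ) : ℂ) *
      ((μ.curryLeft N fun i => e (J i) : ℝ) : ℂ) = 1 := by
    have h10 : (1 : ℂ) = (-1 : ℂ) ^ m • ((m.factorial : ℂ)⁻¹ *
        ∑ x : Fin m → κ, ((μ.curryLeft N fun i => e (x i) : ℝ) : ℂ) *
          (((-1) ^ m * μ.curryLeft N fun i => e (x i) : ℝ) : ℂ)) := by
      rw [← h5]
      simp [hN]
    conv_rhs => rw [h10]
    rw [smul_eq_mul, mul_left_comm]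
    congr 1
    rw [Finset.mul_sum]
    refine Finset.sum_congr rfl fun J _ => ?_
    push_cast
    linear_combination (-1 : ℂ) * ((μ.curryLeft N fun i => e (J i) : ℝ) : ℂ) *
      ((μ.curryLeft N fun i => e (J i) : ℝ) : ℂ) * h8
  rw [key] at h9
  apply Complex.ofReal_injective
  push_cast
  rw [← h9]
  simp_rw [pow_two]
  rfl

end UnitNormal

lemma euclVol_basisFun (n : ℕ) :
    euclVol n (fun i => EuclideanSpace.basisFun (Fin n) ℝ i) = 1 := by
  change Matrix.det (Matrix.of fun i j => (EuclideanSpace.basisFun (Fin n) ℝ i) j) = 1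
  convert Matrix.det_one (n := Fin n) (R := ℝ) using 2
  ext i j
  simp [Matrix.one_apply, eq_comm]

/-- This is the reproducing property of `riesz`, for the volume form itself. -/
lemma isUnitVolume_euclVol (n : ℕ) :
    IsUnitVolume (EuclideanSpace.basisFun (Fin n) ℝ) (euclVol n) := by
  have h1 := sum_mul_riesz (EuclideanSpace.basisFun (Fin n) ℝ)
    (Complex.ofRealCLM.compContinuousAlternatingMap (euclVol n))
    (fun i => EuclideanSpace.basisFun (Fin n) ℝ i)
  have h2 : ∀ J : Fin n → Fin n, riesz (E n) n (fun i => EuclideanSpace.basisFun (Fin n) ℝ i)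
      (fun i => EuclideanSpace.basisFun (Fin n) ℝ (J i)) =
      ((euclVol n (fun i => EuclideanSpace.basisFun (Fin n) ℝ (J i)) : ℝ) : ℂ) := by
    intro J
    rw [riesz_apply]
    congr 1
    change _ = Matrix.det (Matrix.of fun i j => (EuclideanSpace.basisFun (Fin n) ℝ (J i)) j)
    congr 1
    ext i j
    simp [EuclideanSpace.inner_single_left]
  simp_rw [h2] at h1
  rw [IsUnitVolume]
  apply Complex.ofReal_injective
  push_cast
  simp only [ContinuousLinearMap.compContinuousAlternatingMap_coe, Function.comp_apply,
    Complex.ofRealCLM_apply, euclVol_basisFun] at h1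
  simpa [pow_two] using h1

/-! ### Spaces of alternating forms -/

section FormSpace

variable {V : Type*} [NormedAddCommGroup V] [InnerProductSpace ℝ V] {ι : Type*} [Fintype ι]

/-- The forms `b_J♭ / p!` in terms of which every form is expanded, see `sum_smul_basisForm`. -/
def basisForm (b : OrthonormalBasis ι ℝ V) {p : ℕ} (J : Fin p → ι) : V [⋀^Fin p]→L[ℝ] ℂ :=
  ((p.factorial : ℂ)⁻¹) • (ContinuousAlternatingMap.apply ℝ V ℂ
    (fun i => b (J i))).compContinuousAlternatingMap (riesz V p)

lemma sum_smul_basisForm (b : OrthonormalBasis ι ℝ V) {p : ℕ} (φ : V [⋀^Fin p]→L[ℝ] ℂ) :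
    ∑ J : Fin p → ι, φ (fun i => b (J i)) • basisForm b J = φ := by
  ext v
  rw [← sum_mul_riesz b φ v, Finset.mul_sum, ContinuousAlternatingMap.sum_apply]
  refine Finset.sum_congr rfl fun J _ => ?_
  simp [basisForm]
  ring

instance [FiniteDimensional ℝ V] (p : ℕ) : FiniteDimensional ℝ (V [⋀^Fin p]→L[ℝ] ℂ) := by
  let b := stdOrthonormalBasis ℝ V
  let f : (V [⋀^Fin p]→L[ℝ] ℂ) →ₗ[ℝ] ((Fin p → Fin (Module.finrank ℝ V)) → ℂ) :=
    { toFun := fun φ J => φ (fun i => b (J i))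
      map_add' := fun _ _ => rfl
      map_smul' := fun _ _ => rfl }
  refine FiniteDimensional.of_injective f fun φ ψ h => ?_
  rw [← sum_smul_basisForm b φ, ← sum_smul_basisForm b ψ]
  exact Finset.sum_congr rfl fun J _ => by rw [show φ _ = ψ _ from congrFun h J]

variable {X : Type*} [NormedAddCommGroup X] [NormedSpace ℝ X]

lemma contDiffAt_of_apply [FiniteDimensional ℝ V] {p : ℕ} {f : X → V [⋀^Fin p]→L[ℝ] ℂ} {x : X}
    {n : ℕ∞ω} (h : ∀ v, ContDiffAt ℝ n (fun y => f y v) x) : ContDiffAt ℝ n f x := by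
  let b := stdOrthonormalBasis ℝ V
  have : f = fun y => ∑ J : Fin p → Fin (Module.finrank ℝ V),
      f y (fun i => b (J i)) • basisForm b J := by
    funext y
    exact (sum_smul_basisForm b (f y)).symm
  rw [this]
  exact ContDiffAt.sum fun J _ => (h _).smul contDiffAt_const

lemma contDiffAt_apply_apply [FiniteDimensional ℝ V] {p : ℕ} {f : X → V [⋀^Fin p]→L[ℝ] ℂ}
    {v : Fin p → X → V} {x : X} {n : ℕ∞ω} (hf : ContDiffAt ℝ n f x)
    (hv : ∀ i, ContDiffAt ℝ n (v i) x) : ContDiffAt ℝ n (fun y => f y fun i => v i y) x := by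
  let b := stdOrthonormalBasis ℝ V
  have : (fun y => f y fun i => v i y) = fun y => ∑ J : Fin p → Fin (Module.finrank ℝ V),
      f y (fun i => b (J i)) • basisForm b J (fun i => v i y) := by
    funext y
    conv_lhs => rw [← sum_smul_basisForm b (f y)]
    simp
  rw [this]
  simp only [smul_eq_mul]
  refine ContDiffAt.sum fun J _ => ContDiffAt.mul ?_ ?_
  · exact (ContinuousAlternatingMap.apply ℝ V ℂ (fun i => b (J i))).contDiff.contDiffAt.comp x hf
  · exact (basisForm b J).toContinuousMultilinearMap.contDiff.contDiffAt.comp x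
      (contDiffAt_pi.mpr hv)

end FormSpace

/-! ### Exterior derivative, coderivative and Laplacian in coordinates -/

section Derivatives

variable {n : ℕ}

/-- The standard basis vectors of `ℝⁿ`. -/
abbrev basisVec (n : ℕ) (j : Fin n) : E n := EuclideanSpace.basisFun (Fin n) ℝ j

/-- The Hodge operator of `ℝⁿ` as a continuous real-linear map. -/
def euclStarL {n p q : ℕ} (h : p + q = n) :
    (E n [⋀^Fin p]→L[ℝ] ℂ) →L[ℝ] E n [⋀^Fin q]→L[ℝ] ℂ :=
  LinearMap.toContinuousLinearMap
    ((hodgeStarₗ (EuclideanSpace.basisFun (Fin n) ℝ) (euclVol n) h).restrictScalars ℝ)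

/-- The interior product with a vector as a continuous linear map. -/
def interiorL {p : ℕ} (u : E n) : (E n [⋀^Fin (p + 1)]→L[ℝ] ℂ) →L[ℝ] E n [⋀^Fin p]→L[ℝ] ℂ :=
  LinearMap.toContinuousLinearMap
    { toFun := fun φ => φ.curryLeft u
      map_add' := fun _ _ => by ext; simp
      map_smul' := fun _ _ => by ext; simp }

/-- The exterior product with a covector as a continuous linear map. -/
def wedgeL {p : ℕ} (l : E n →L[ℝ] ℝ) : (E n [⋀^Fin p]→L[ℝ] ℂ) →L[ℝ] E n [⋀^Fin (p + 1)]→L[ℝ] ℂ :=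
  LinearMap.toContinuousLinearMap
    { toFun := wedge l
      map_add' := wedge_add l
      map_smul' := fun c φ => by
        have : ∀ {k : ℕ} (ψ : E n [⋀^Fin k]→L[ℝ] ℂ), c • ψ = (c : ℂ) • ψ := fun ψ => by ext v; simp
        rw [this, wedge_smul, ← this]
        rfl }

lemma fderiv_clm_comp_apply {F G : Type*} [NormedAddCommGroup F] [NormedSpace ℝ F]
    [NormedAddCommGroup G] [NormedSpace ℝ G] (T : F →L[ℝ] G) {f : E n → F} {x : E n}
    (hf : DifferentiableAt ℝ f x) (v : E n) :
    fderiv ℝ (fun y => T (f y)) x v = T (fderiv ℝ f x v) :=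
  congrArg (· v) (T.hasFDerivAt.comp x hf.hasFDerivAt).fderiv

lemma extDeriv_eq_sum_wedge {p : ℕ} (β : Form n p) (x : E n) :
    extDeriv β x = ∑ j, wedge (innerSL ℝ (basisVec n j)) (fderiv ℝ β x (basisVec n j)) := by
  have h : fderiv ℝ β x = ∑ j, (innerSL ℝ (basisVec n j)).smulRight
      (fderiv ℝ β x (basisVec n j)) := by
    refine ContinuousLinearMap.ext fun v => ?_
    conv_lhs => rw [← (EuclideanSpace.basisFun (Fin n) ℝ).sum_repr' v]
    simp
  unfold extDeriv
  conv_lhs => rw [h]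
  simp only [wedge, ← ContinuousAlternatingMap.alternatizeUncurryFinCLM_apply]
  rw [map_sum]

lemma coderiv_eq_sum {p q : ℕ} (h : p + 1 + q = n) {α : Form n (p + 1)} {x : E n}
    (hα : DifferentiableAt ℝ α x) :
    coderiv h α x = -∑ j, (fderiv ℝ α x (basisVec n j)).curryLeft (basisVec n j) := by
  have hstar : ∀ v, fderiv ℝ (fun y => euclStar h (α y)) x v = euclStar h (fderiv ℝ α x v) :=
    fun v => fderiv_clm_comp_apply (euclStarL h) hα v
  rw [coderiv, extDeriv_eq_sum_wedge]
  simp_rw [hstar, euclStar]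
  have hw : ∀ j, wedge (innerSL ℝ (basisVec n j)) (hodgeStar (EuclideanSpace.basisFun (Fin n) ℝ) h
      (euclVol n) (fderiv ℝ α x (basisVec n j))) = (-1 : ℂ) ^ p •
        hodgeStar (EuclideanSpace.basisFun (Fin n) ℝ) (by omega : p + (q + 1) = n) (euclVol n)
          ((fderiv ℝ α x (basisVec n j)).curryLeft (basisVec n j)) :=
    fun j => wedge_hodgeStar _ _ (by simp) h _ _ _
  simp_rw [hw, ← Finset.smul_sum, ← hodgeStar_sum, ← hodgeStar_smul]
  rw [euclStarInv, hodgeStarInv_hodgeStar (by simp) (isUnitVolume_euclVol n), smul_smul, pow_succ,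
    mul_right_comm, ← mul_pow]
  ext v
  simp

lemma fderiv_fderiv_comm {F : Type*} [NormedAddCommGroup F] [NormedSpace ℝ F] {α : E n → F}
    {x : E n} (hα : ContDiffAt ℝ 2 α x) (u v : E n) :
    fderiv ℝ (fun y => fderiv ℝ α y u) x v = fderiv ℝ (fun y => fderiv ℝ α y v) x u := by
  have hd : DifferentiableAt ℝ (fderiv ℝ α) x :=
    (hα.fderiv_right (m := 1) (by norm_num)).differentiableAt (by norm_num)
  have h1 : ∀ u v, fderiv ℝ (fun y => fderiv ℝ α y u) x v = fderiv ℝ (fderiv ℝ α) x v u := by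
    intro u v
    rw [fderiv_clm_apply hd (by fun_prop)]
    simp
  rw [h1, h1]
  exact (hα.isSymmSndFDerivAt (by simp)) v u

lemma contDiffAt_fderiv_apply {F : Type*} [NormedAddCommGroup F] [NormedSpace ℝ F] {α : E n → F}
    {x : E n} (hα : ContDiffAt ℝ 2 α x) (u : E n) :
    ContDiffAt ℝ 1 (fun y => fderiv ℝ α y u) x :=
  (hα.fderiv_right (m := 1) (by norm_num)).clm_apply contDiffAt_const

/-- On `ℝⁿ` the Laplace-Beltrami operator acts componentwise, as the negative of the Laplacian. -/
lemma laplaceBeltrami_eq_sum {p q : ℕ} (h : p + (q + 1) = n) {α : Form n p} {x : E n}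
    (hα : ContDiffAt ℝ 2 α x) :
    laplaceBeltrami p (q + 1) h α x =
      -∑ j, fderiv ℝ (fun y => fderiv ℝ α y (basisVec n j)) x (basisVec n j) := by
  have hd2 : ∀ j, DifferentiableAt ℝ (fun y => fderiv ℝ α y (basisVec n j)) x := fun j =>
    (contDiffAt_fderiv_apply hα _).differentiableAt (by norm_num)
  have hext : extDeriv α = fun y => ∑ k, wedgeL (innerSL ℝ (basisVec n k))
      (fderiv ℝ α y (basisVec n k)) := funext fun y => extDeriv_eq_sum_wedge α y
  have hw : ∀ k, DifferentiableAt ℝ (fun y => wedgeL (innerSL ℝ (basisVec n k))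
      (fderiv ℝ α y (basisVec n k))) x := fun k => (wedgeL _).differentiableAt.comp x (hd2 k)
  have hextd : ∀ j, fderiv ℝ (extDeriv α) x (basisVec n j) = ∑ k,
      wedge (innerSL ℝ (basisVec n k))
        (fderiv ℝ (fun y => fderiv ℝ α y (basisVec n k)) x (basisVec n j)) := by
    intro j
    rw [hext, fderiv_fun_sum fun k _ => hw k, sum_apply]
    exact Finset.sum_congr rfl fun k _ => fderiv_clm_comp_apply _ (hd2 k) _
  have hextdiff : DifferentiableAt ℝ (extDeriv α) x := by
    rw [hext]
    exact DifferentiableAt.fun_sum fun k _ => hw k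
  have hδ : ∀ (j k : Fin n), (innerSL ℝ (basisVec n k)) (basisVec n j) = if k = j then 1 else 0 :=
    fun j k => by rw [innerSL_apply_apply, OrthonormalBasis.inner_eq_ite]
  cases p with
  | zero =>
    change coderiv (q := q) (by omega) (extDeriv α) x = _
    rw [coderiv_eq_sum _ hextdiff]
    congr 1
    refine Finset.sum_congr rfl fun j _ => ?_
    rw [hextd, curryLeft_sum, Finset.sum_eq_single j]
    · rw [curryLeft_wedge_zero, hδ, if_pos rfl, one_smul]
    · intro k _ hkj
      rw [curryLeft_wedge_zero, hδ, if_neg hkj, zero_smul]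
    · simp
  | succ p =>
    change extDeriv (coderiv h α) x + coderiv (q := q) (by omega) (extDeriv α) x = _
    have hco : coderiv h α =ᶠ[nhds x] fun y =>
        -∑ j, interiorL (basisVec n j) (fderiv ℝ α y (basisVec n j)) := by
      filter_upwards [hα.eventually (by simp)] with y hy
      exact coderiv_eq_sum h (hy.differentiableAt (by norm_num))
    have hsymm : ∀ j k, fderiv ℝ (fun y => fderiv ℝ α y (basisVec n j)) x (basisVec n k) =
        fderiv ℝ (fun y => fderiv ℝ α y (basisVec n k)) x (basisVec n j) :=
      fun j k => fderiv_fderiv_comm hα _ _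
    have hcod : ∀ k, fderiv ℝ (coderiv h α) x (basisVec n k) = -∑ j,
        (fderiv ℝ (fun y => fderiv ℝ α y (basisVec n k)) x (basisVec n j)).curryLeft
          (basisVec n j) := by
      intro k
      simp_rw [hsymm k]
      have hi : ∀ k, DifferentiableAt ℝ (fun y => interiorL (basisVec n k)
        (fderiv ℝ α y (basisVec n k))) x := fun k => (interiorL _).differentiableAt.comp x (hd2 k)
      rw [hco.fderiv_eq, fderiv_fun_neg, neg_apply, fderiv_fun_sum fun k _ => hi k]
      simp only [sum_apply]
      congr 1
      exact Finset.sum_congr rfl fun j _ => fderiv_clm_comp_apply _ (hd2 j) _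
    -- the mixed terms `e_k♭ ∧ i(e_j) ∂_j ∂_k α` of `d δ α` and `δ d α` cancel
    rw [extDeriv_eq_sum_wedge, coderiv_eq_sum _ hextdiff]
    simp_rw [hcod, hextd, curryLeft_sum, curryLeft_wedge, Finset.sum_sub_distrib, hδ]
    have hneg : ∀ (l : E n →L[ℝ] ℝ) (φ : E n [⋀^Fin p]→L[ℝ] ℂ), wedge l (-φ) = -wedge l φ :=
      fun l φ => map_neg (wedgeL l) φ
    simp_rw [hneg, wedge_sum, Finset.sum_neg_distrib]
    rw [neg_sub, Finset.sum_comm]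
    simp only [ite_smul, one_smul, zero_smul, Finset.sum_ite_eq', Finset.mem_univ, if_true]
    abel

end Derivatives

/-! ### The outer unit normal -/

section Normal

open Filter Topology

variable {n : ℕ} {Ω : Set (E n)} {X : E n} {ρ : E n → ℝ}

lemma inner_gradient (ρ : E n → ℝ) (X v : E n) : inner ℝ (∇ ρ X) v = fderiv ℝ ρ X v := by
  simp [gradient]

lemma contDiff_gradient (hρ : ContDiff ℝ ∞ ρ) : ContDiff ℝ ∞ (∇ ρ) := by
  have h : ContDiff ℝ ∞ (fderiv ℝ ρ) := hρ.fderiv_right (by norm_num)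
  exact (InnerProductSpace.toDual ℝ (E n)).symm.contDiff.comp h

lemma eventually_neg_of_inner_gradient_neg (hρ : ContDiff ℝ ∞ ρ) (h0 : ρ X = 0) {v : E n}
    (hv : inner ℝ (∇ ρ X) v < 0) : ∀ᶠ t : ℝ in 𝓝[>] 0, ρ (X + t • v) < 0 := by
  have hd : HasDerivAt (fun t : ℝ => ρ (X + t • v)) (fderiv ℝ ρ X v) 0 := by
    have h1 : HasFDerivAt ρ (fderiv ℝ ρ X) (X + (0 : ℝ) • v) := by
      simpa using (hρ.differentiable (by simp) X).hasFDerivAt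
    have h2 : HasDerivAt (fun t : ℝ => X + t • v) v 0 := by
      simpa using ((hasDerivAt_id (0 : ℝ)).smul_const v).const_add X
    exact h1.comp_hasDerivAt 0 h2
  rw [inner_gradient] at hv
  have h3 := hd.tendsto_slope_zero_right
  filter_upwards [h3.eventually_lt_const hv, self_mem_nhdsWithin] with t ht ht0
  simp only [zero_add, zero_smul, add_zero, h0, sub_zero, smul_eq_mul] at ht
  have ht0' : (0 : ℝ) < t := ht0
  by_contra hcon
  push Not at hcon
  exact absurd ht (not_lt.mpr (mul_nonneg (inv_nonneg.mpr ht0'.le) hcon))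

lemma tendsto_add_smul_nhds (X v : E n) : Tendsto (fun t : ℝ => X + t • v) (𝓝[>] 0) (𝓝 X) := by
  have : Tendsto (fun t : ℝ => X + t • v) (𝓝 0) (𝓝 (X + (0 : ℝ) • v)) :=
    Continuous.tendsto (by fun_prop) 0
  simpa using this.mono_left nhdsWithin_le_nhds

lemma IsDefiningFunctionAt.mem_frontier_iff (hΩ : IsOpen Ω) (h : IsDefiningFunctionAt Ω X ρ) :
    X ∈ frontier Ω ↔ ρ X = 0 := by
  have hX := h.mem_iff.self_of_nhds
  rw [hΩ.frontier_eq]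
  constructor
  · rintro ⟨hcl, hnot⟩
    refine le_antisymm ?_ (not_lt.mp fun hlt => hnot (hX.mpr hlt))
    by_contra hcon
    push Not at hcon
    have h1 : ∀ᶠ Y in 𝓝 X, 0 < ρ Y := h.smooth.continuous.continuousAt.eventually_const_lt hcon
    obtain ⟨Y, hY, h3⟩ := (mem_closure_iff_frequently.mp hcl).and_eventually (h1.and h.mem_iff)
      |>.exists
    exact absurd (h3.2.mp hY) (not_lt.mpr h3.1.le)
  · intro h0
    refine ⟨?_, fun hmem => absurd (hX.mp hmem) (by simp [h0])⟩
    have hneg : inner ℝ (∇ ρ X) (-∇ ρ X) < 0 := by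
      rw [inner_neg_right, real_inner_self_eq_norm_sq, neg_lt_zero]
      exact pow_pos (norm_pos_iff.mpr h.gradient_ne_zero) 2
    have h1 := eventually_neg_of_inner_gradient_neg h.smooth h0 hneg
    have h2 := (tendsto_add_smul_nhds X (-∇ ρ X)).eventually h.mem_iff
    refine mem_closure_of_tendsto (tendsto_add_smul_nhds X (-∇ ρ X)) ?_
    filter_upwards [h1, h2] with t ht ht'
    exact ht'.mpr ht

/-- If the half-space `⟨a, ·⟩ < 0` lies in `⟨b, ·⟩ ≤ 0`, then `a` and `b` have the same
direction. -/
lemma normalize_eq_of_halfSpace {V : Type*} [NormedAddCommGroup V] [InnerProductSpace ℝ V]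
    {a b : V} (ha : a ≠ 0) (hb : b ≠ 0)
    (h : ∀ v, inner ℝ a v < 0 → inner ℝ b v ≤ 0) : ‖a‖⁻¹ • a = ‖b‖⁻¹ • b := by
  have ha' : ‖‖a‖⁻¹ • a‖ = 1 := by simp [norm_smul, ha]
  have hb' : ‖‖b‖⁻¹ • b‖ = 1 := by simp [norm_smul, hb]
  set x := ‖a‖⁻¹ • a with hx
  set y := ‖b‖⁻¹ • b with hy
  have hax : a = ‖a‖ • x := by simp [hx, smul_smul, ha]
  have hby : b = ‖b‖ • y := by simp [hy, smul_smul, hb]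
  have hapos : 0 < ‖a‖ := norm_pos_iff.mpr ha
  have hbpos : 0 < ‖b‖ := norm_pos_iff.mpr hb
  by_contra hne
  have hc : (inner ℝ x y : ℝ) < 1 := inner_lt_one_iff_real_of_norm_eq_one ha' hb' |>.mpr hne
  have h1 := h (y - x) (by
    rw [hax, inner_smul_left, inner_sub_right, real_inner_self_eq_norm_sq, ha']
    simp only [conj_trivial]
    nlinarith)
  rw [hby, inner_smul_left, inner_sub_right, real_inner_self_eq_norm_sq, hb',
    real_inner_comm] at h1
  simp only [conj_trivial] at h1
  nlinarith

/-- The outer unit normal may be computed from any defining function. -/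
lemma IsDefiningFunctionAt.outerNormal_eq (hΩ : IsOpen Ω) (hX : X ∈ frontier Ω)
    (h : IsDefiningFunctionAt Ω X ρ) : outerNormal Ω X = ‖∇ ρ X‖⁻¹ • ∇ ρ X := by
  have hex : ∃ ρ, IsDefiningFunctionAt Ω X ρ := ⟨ρ, h⟩
  rw [outerNormal, dif_pos hex]
  have h' := hex.choose_spec
  refine normalize_eq_of_halfSpace h'.gradient_ne_zero h.gradient_ne_zero fun v hv => ?_
  by_contra hcon
  push Not at hcon
  have h1 := eventually_neg_of_inner_gradient_neg h'.smooth ((h'.mem_frontier_iff hΩ).mp hX) hv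
  have h2 := eventually_neg_of_inner_gradient_neg (ρ := fun Y => -ρ Y) h.smooth.neg
    (by simpa using (h.mem_frontier_iff hΩ).mp hX) (v := v) (by
      rw [inner_gradient] at hcon ⊢
      rw [fderiv_fun_neg]
      simpa using hcon)
  have h3 := (tendsto_add_smul_nhds X v).eventually (h.mem_iff.and h'.mem_iff)
  obtain ⟨t, ht1, ht2, ht3, ht4⟩ := (h1.and (h2.and h3)).exists
  have := ht3.mp (ht4.mpr ht1)
  simp at ht2
  linarith

lemma norm_outerNormal (hΩs : HasSmoothBoundary Ω) (hX : X ∈ frontier Ω) :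
    ‖outerNormal Ω X‖ = 1 := by
  have hex := hΩs X hX
  rw [outerNormal, dif_pos hex]
  simp [norm_smul, hex.choose_spec.gradient_ne_zero]

/-- A defining function at `X` is a defining function at all nearby points. -/
lemma IsDefiningFunctionAt.eventually (h : IsDefiningFunctionAt Ω X ρ) :
    ∀ᶠ Y in 𝓝 X, IsDefiningFunctionAt Ω Y ρ := by
  have h1 : ∀ᶠ Y in 𝓝 X, ∇ ρ Y ≠ 0 :=
    (contDiff_gradient h.smooth).continuous.continuousAt.eventually_ne h.gradient_ne_zero
  filter_upwards [h1, h.mem_iff.eventually_nhds] with Y h1 h2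
  exact ⟨h.smooth, h1, h2⟩

/-- The outer unit normal extends to a smooth vector field on the whole space. Extensions exist
locally, and they can be patched together since their values on the boundary are prescribed. -/
lemma exists_smooth_normal (hΩ : IsOpen Ω) (hΩs : HasSmoothBoundary Ω) :
    ∃ N : E n → E n, ContDiff ℝ ∞ N ∧ ∀ X ∈ frontier Ω, N X = outerNormal Ω X := by
  classical
  obtain ⟨g, hg⟩ := exists_contMDiffMap_forall_mem_convex_of_local (n := ⊤)
    (modelWithCornersSelf ℝ (E n)) (t := fun X => {y | X ∈ frontier Ω → y = outerNormal Ω X})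
    (F := E n) (M := E n)
    (fun X => by
      by_cases hX : X ∈ frontier Ω
      · simp [hX, convex_singleton]
      · simp [hX, convex_univ])
    (fun X => by
      by_cases hX : X ∈ frontier Ω
      · obtain ⟨ρ, hρ⟩ := hΩs X hX
        refine ⟨_, hρ.eventually, fun Y => ‖∇ ρ Y‖⁻¹ • ∇ ρ Y, ?_, ?_⟩
        · intro Y hY
          have hY' : IsDefiningFunctionAt Ω Y ρ := hY
          have hs : ContDiffAt ℝ ∞ (∇ ρ) Y := (contDiff_gradient hρ.smooth).contDiffAt
          have : ContDiffAt ℝ ∞ (fun Y => ‖∇ ρ Y‖⁻¹ • ∇ ρ Y) Y :=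
            ((hs.norm ℝ hY'.gradient_ne_zero).inv
              (norm_ne_zero_iff.mpr hY'.gradient_ne_zero)).smul hs
          exact this.contMDiffAt.contMDiffWithinAt
        · intro Y hY hYf
          exact ((show IsDefiningFunctionAt Ω Y ρ from hY).outerNormal_eq hΩ hYf).symm
      · refine ⟨(frontier Ω)ᶜ, isClosed_frontier.isOpen_compl.mem_nhds hX, fun _ => 0,
          contMDiffOn_const, fun Y hY hYf => absurd hYf hY⟩)
  exact ⟨g, g.contMDiff.contDiff, hg⟩

end Normal

/-! ### Charts of the boundary -/

section Chart

open Filter Topology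

variable {m : ℕ} {Ω : Set (E (m + 1))}

/-- A local parametrization `Φ : W → Γ ∩ U` of the boundary whose inverse is the restriction of a
linear map `π`, together with a defining function `ρ` on `U`. -/
structure BdryChart (Ω : Set (E (m + 1))) where
  /-- The open set of the ambient space covered by the chart. -/
  U : Set (E (m + 1))
  /-- The domain of the parametrization. -/
  W : Set (E m)
  /-- The parametrization. -/
  Φ : E m → E (m + 1)
  /-- The linear map inverting the parametrization. -/
  π : E (m + 1) →L[ℝ] E m
  /-- The defining function. -/
  ρ : E (m + 1) → ℝ
  isOpen_U : IsOpen U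
  isOpen_W : IsOpen W
  contDiffAt : ∀ y ∈ W, ContDiffAt ℝ 2 Φ y
  mem_frontier : ∀ y ∈ W, Φ y ∈ frontier Ω
  mem_U : ∀ y ∈ W, Φ y ∈ U
  π_Φ : ∀ y ∈ W, π (Φ y) = y
  π_mem : ∀ Y ∈ frontier Ω ∩ U, π Y ∈ W
  Φ_π : ∀ Y ∈ frontier Ω ∩ U, Φ (π Y) = Y
  isDefining : ∀ Y ∈ U, IsDefiningFunctionAt Ω Y ρ

/-- The kernel of some linear map `ℝ^{m+1} → ℝ^m` is contained in a given line. -/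
lemma exists_linearMap_ker_eq_span {N : E (m + 1)} (hN : N ≠ 0) :
    ∃ π : E (m + 1) →L[ℝ] E m, ∀ x, π x = 0 → x ∈ (ℝ ∙ N) := by
  have hfin : Module.finrank ℝ (ℝ ∙ N)ᗮ = m := by
    have : Fact (Module.finrank ℝ (E (m + 1)) = m + 1) := ⟨by simp⟩
    exact Submodule.finrank_orthogonal_span_singleton (𝕜 := ℝ) (n := m) hN
  let b := (stdOrthonormalBasis ℝ (ℝ ∙ N)ᗮ).reindex (finCongr hfin)
  refine ⟨b.repr.toContinuousLinearEquiv.toContinuousLinearMap ∘L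
    (ℝ ∙ N)ᗮ.orthogonalProjectionOnto, fun x hx => ?_⟩
  have h1 : (ℝ ∙ N)ᗮ.orthogonalProjectionOnto x = 0 := by
    have : b.repr ((ℝ ∙ N)ᗮ.orthogonalProjectionOnto x) = 0 := hx
    simpa using this
  rw [Submodule.orthogonalProjectionOnto_eq_zero_iff] at h1
  simpa using h1

/-- Every boundary point lies in the domain of a chart. -/
lemma exists_bdryChart (hΩ : IsOpen Ω) (hΩs : HasSmoothBoundary Ω) {X : E (m + 1)}
    (hX : X ∈ frontier Ω) : ∃ c : BdryChart Ω, X ∈ c.U := by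
  obtain ⟨ρ, hρ⟩ := hΩs X hX
  obtain ⟨π, hπ⟩ := exists_linearMap_ker_eq_span hρ.gradient_ne_zero
  -- by the choice of `π`, the derivative of `Ψ = (ρ, π)` at `X` is invertible
  let Ψ : E (m + 1) → ℝ × E m := fun x => (ρ x, π x)
  have hΨ : ContDiff ℝ ∞ Ψ := hρ.smooth.prodMk π.contDiff
  have hΨ2 : ContDiff ℝ 2 Ψ := by
    simpa using contDiff_infty.mp hΨ 2
  let L : E (m + 1) →L[ℝ] ℝ × E m := (fderiv ℝ ρ X).prod π
  have hLinj : Function.Injective L := by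
    rw [injective_iff_map_eq_zero]
    intro x hx
    have h1 : fderiv ℝ ρ X x = 0 := congrArg Prod.fst hx
    have h2 : π x = 0 := congrArg Prod.snd hx
    obtain ⟨c, rfl⟩ := Submodule.mem_span_singleton.mp (hπ x h2)
    rw [← inner_gradient, inner_smul_right, mul_eq_zero, inner_self_eq_zero] at h1
    rcases h1 with h1 | h1
    · simp [h1]
    · exact absurd h1 hρ.gradient_ne_zero
  have hdim : Module.finrank ℝ (E (m + 1)) = Module.finrank ℝ (ℝ × E m) := by
    simp [add_comm]
  let Le : E (m + 1) ≃L[ℝ] ℝ × E m :=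
    (LinearEquiv.ofInjectiveOfFinrankEq L.toLinearMap hLinj hdim).toContinuousLinearEquiv
  have hLe : (Le : E (m + 1) →L[ℝ] ℝ × E m) = L := by ext x <;> rfl
  have hder : HasFDerivAt Ψ (Le : E (m + 1) →L[ℝ] ℝ × E m) X := by
    rw [hLe]
    exact ((hρ.smooth.differentiable (by simp) X).hasFDerivAt).prodMk π.hasFDerivAt
  let e := hΨ2.contDiffAt.toOpenPartialHomeomorph Ψ hder (by norm_num)
  have he : ∀ x, e x = Ψ x := fun x => rfl
  have hXs : X ∈ e.source := hΨ2.contDiffAt.mem_toOpenPartialHomeomorph_source hder (by norm_num)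
  have hsymm : ContDiffAt ℝ 2 e.symm (e X) := by
    refine e.contDiffAt_symm (e.map_source hXs) (f₀' := Le) ?_ ?_
    · rw [e.left_inv hXs]; exact hder
    · exact hΨ2.contDiffAt
  obtain ⟨N, hNsub, hNopen, hXN⟩ := eventually_nhds_iff.mp (hsymm.eventually (by simp))
  obtain ⟨U₀, hU₀sub, hU₀open, hXU₀⟩ := eventually_nhds_iff.mp hρ.eventually
  have hρ0 : ∀ Y ∈ U₀, (Y ∈ frontier Ω ↔ ρ Y = 0) := fun Y hY =>
    (hU₀sub Y hY).mem_frontier_iff hΩ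
  have hinc : Continuous fun y : E m => ((0 : ℝ), y) := by fun_prop
  refine ⟨{
    U := e.source ∩ e ⁻¹' N ∩ U₀
    W := (fun y : E m => ((0 : ℝ), y)) ⁻¹' (e.target ∩ e.symm ⁻¹' U₀ ∩ N)
    Φ := fun y => e.symm (0, y)
    π := π
    ρ := ρ
    isOpen_U := (e.isOpen_inter_preimage hNopen).inter hU₀open
    isOpen_W := ((e.isOpen_inter_preimage_symm hU₀open).inter hNopen).preimage hinc
    contDiffAt := fun y hy => (hNsub _ hy.2).comp y (by fun_prop)
    mem_frontier := fun y hy => ?_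
    mem_U := fun y hy => ⟨⟨e.map_target hy.1.1, ?_⟩, hy.1.2⟩
    π_Φ := fun y hy => ?_
    π_mem := fun Y hY => ?_
    Φ_π := fun Y hY => ?_
    isDefining := fun Y hY => hU₀sub Y hY.2 }, ⟨hXs, hXN⟩, hXU₀⟩
  · rw [hρ0 _ hy.1.2]
    exact congrArg Prod.fst (e.right_inv hy.1.1)
  · rw [Set.mem_preimage, e.right_inv hy.1.1]
    exact hy.2
  · exact congrArg Prod.snd (e.right_inv hy.1.1)
  · have h0 : ((0 : ℝ), π Y) = e Y := by rw [he, ← (hρ0 Y hY.2.2).mp hY.1]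
    refine ⟨⟨?_, ?_⟩, ?_⟩
    · change ((0 : ℝ), π Y) ∈ e.target
      rw [h0]; exact e.map_source hY.2.1.1
    · change e.symm ((0 : ℝ), π Y) ∈ U₀
      rw [h0, e.left_inv hY.2.1.1]; exact hY.2.2
    · change ((0 : ℝ), π Y) ∈ N
      rw [h0]; exact hY.2.1.2
  · have h0 : ((0 : ℝ), π Y) = e Y := by rw [he, ← (hρ0 Y hY.2.2).mp hY.1]
    change e.symm ((0 : ℝ), π Y) = Y
    rw [h0]
    exact e.left_inv hY.2.1.1

end Chart

/-! ### The area formula for an injective immersion -/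

section Area

open Filter Topology Set
open scoped NNReal ENNReal

/-- If `f` expands distances at most `K` times as much as `g`, then the Hausdorff measures of images
compare accordingly. -/
lemma euclideanHausdorffMeasure_image_le {α X Y : Type*} [MetricSpace X] [MetricSpace Y]
    [MeasurableSpace X] [BorelSpace X] [MeasurableSpace Y] [BorelSpace Y] {d : ℕ}
    {f : α → X} {g : α → Y} {A : Set α} {K : ℝ≥0}
    (h : ∀ x ∈ A, ∀ y ∈ A, dist (f x) (f y) ≤ K * dist (g x) (g y)) :
    μHE[d] (f '' A) ≤ (K : ℝ≥0∞) ^ d * μHE[d] (g '' A) := by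
  classical
  rcases A.eq_empty_or_nonempty with rfl | ⟨a, ha⟩
  · simp
  have : Nonempty α := ⟨a⟩
  let s : Y → α := Function.invFunOn g A
  have hs : ∀ x ∈ A, s (g x) ∈ A ∧ g (s (g x)) = g x := fun x hx =>
    ⟨Function.invFunOn_mem ⟨x, hx, rfl⟩, Function.invFunOn_eq ⟨x, hx, rfl⟩⟩
  have hf : ∀ x ∈ A, f (s (g x)) = f x := by
    intro x hx
    have := h _ (hs x hx).1 x hx
    rw [(hs x hx).2, dist_self, mul_zero] at this
    exact dist_le_zero.mp this
  have himg : f '' A = (f ∘ s) '' (g '' A) := by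
    ext z
    constructor
    · rintro ⟨x, hx, rfl⟩
      exact ⟨g x, ⟨x, hx, rfl⟩, hf x hx⟩
    · rintro ⟨_, ⟨x, hx, rfl⟩, rfl⟩
      exact ⟨x, hx, (hf x hx).symm⟩
  have hlip : LipschitzOnWith K (f ∘ s) (g '' A) := by
    refine LipschitzOnWith.of_dist_le_mul ?_
    rintro _ ⟨x, hx, rfl⟩ _ ⟨y, hy, rfl⟩
    simp only [Function.comp_apply, hf x hx, hf y hy]
    exact h x hx y hy
  rw [himg, Measure.euclideanHausdorffMeasure_def, Measure.euclideanHausdorffMeasure_def,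
    Measure.smul_apply, Measure.smul_apply]
  have := hlip.hausdorffMeasure_image_le (d := (d : ℝ)) (by positivity)
  rw [ENNReal.rpow_natCast] at this
  rw [ENNReal.smul_def, ENNReal.smul_def, smul_eq_mul, smul_eq_mul, mul_left_comm]
  gcongr

/-- A comparison of two measures on small sets implies the comparison on all sets. -/
lemma measure_le_of_local {X : Type*} [TopologicalSpace X] [SecondCountableTopology X]
    [MeasurableSpace X] [OpensMeasurableSpace X] {μ ν : Measure X} {W : Set X} {C : ℝ≥0∞}
    (h : ∀ y ∈ W, ∃ U ∈ 𝓝 y, ∀ A ⊆ U ∩ W, MeasurableSet A → μ A ≤ C * ν A)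
    {A : Set X} (hA : MeasurableSet A) (hAW : A ⊆ W) : μ A ≤ C * ν A := by
  choose! U hU hUA using h
  obtain ⟨t, htW, htc, hcov⟩ := TopologicalSpace.countable_cover_nhdsWithin
    (s := W) (f := fun y => interior (U y))
    fun y hy => mem_nhdsWithin_of_mem_nhds (interior_mem_nhds.mpr (hU y hy))
  rcases t.eq_empty_or_nonempty with rfl | hne
  · have : A = ∅ := by
      refine Set.eq_empty_of_subset_empty (hAW.trans (hcov.trans ?_))
      simp
    simp [this]
  obtain ⟨f, hf⟩ := htc.exists_eq_range hne
  let B : ℕ → Set X := fun i => A ∩ disjointed (fun j => interior (U (f j))) i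
  have hBm : ∀ i, MeasurableSet (B i) := fun i =>
    hA.inter (MeasurableSet.disjointed (fun j => isOpen_interior.measurableSet) i)
  have hBd : Pairwise (Function.onFun Disjoint B) := fun i j hij =>
    ((disjoint_disjointed _) hij).mono inter_subset_right inter_subset_right
  have hBU : ⋃ i, B i = A := by
    rw [← Set.inter_iUnion, iUnion_disjointed, Set.inter_eq_left]
    refine hAW.trans (hcov.trans ?_)
    rw [hf]
    simp
  have hfW : ∀ i, f i ∈ W := fun i => htW (by rw [hf]; exact mem_range_self i)
  rw [← hBU, measure_iUnion hBd hBm, measure_iUnion hBd hBm, ← ENNReal.tsum_mul_left]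
  refine ENNReal.tsum_le_tsum fun i => hUA (f i) (hfW i) _ ?_ (hBm i)
  refine subset_inter ?_ (inter_subset_left.trans hAW)
  exact (inter_subset_right.trans (disjointed_subset _ i)).trans interior_subset

variable {m : ℕ} {V : Type*} [NormedAddCommGroup V] [InnerProductSpace ℝ V]

/-- Near a point where it is strictly differentiable with injective derivative, a map changes
distances as its derivative does, up to a factor arbitrarily close to `1`. -/
lemma exists_nhds_dist_comparison {Φ : E m → V} {L : E m →L[ℝ] V} {y : E m}
    (hΦ : HasStrictFDerivAt Φ L y) (hL : Function.Injective L) {K : ℝ≥0} (hK : 1 < K) :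
    ∃ U ∈ 𝓝 y, ∀ a ∈ U, ∀ b ∈ U, dist (Φ a) (Φ b) ≤ K * dist (L a) (L b) ∧
      dist (L a) (L b) ≤ K * dist (Φ a) (Φ b) := by
  have hK' : (1 : ℝ) < K := by exact_mod_cast hK
  obtain ⟨κ, hκ, hLκ⟩ := L.toLinearMap.exists_antilipschitzWith (LinearMap.ker_eq_bot.mpr hL)
  have hκ' : (0 : ℝ) < κ := by exact_mod_cast hκ
  set c : ℝ := (1 - (K : ℝ)⁻¹) / κ with hc
  have hKinv : (K : ℝ)⁻¹ < 1 := inv_lt_one_of_one_lt₀ hK'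
  have hcpos : 0 < c := div_pos (by linarith) hκ'
  have h1 : ∀ᶠ p : E m × E m in 𝓝 (y, y),
      ‖Φ p.1 - Φ p.2 - L (p.1 - p.2)‖ ≤ c * ‖p.1 - p.2‖ := hΦ.isLittleO.def hcpos
  rw [nhds_prod_eq] at h1
  obtain ⟨U, hU, hUsub⟩ := Filter.mem_prod_same_iff.mp h1
  refine ⟨U, hU, fun a ha b hb => ?_⟩
  have h2 : ‖Φ a - Φ b - L (a - b)‖ ≤ c * ‖a - b‖ := hUsub (Set.mk_mem_prod ha hb)
  have h3 : ‖a - b‖ ≤ κ * ‖L (a - b)‖ := by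
    have := hLκ.le_mul_dist a b
    simpa [dist_eq_norm, ← map_sub] using this
  have h4 : c * ‖a - b‖ ≤ (1 - (K : ℝ)⁻¹) * ‖L (a - b)‖ := by
    calc c * ‖a - b‖ ≤ c * (κ * ‖L (a - b)‖) := by gcongr
      _ = _ := by rw [hc]; field_simp
  have h5 : ‖Φ a - Φ b‖ ≤ ‖Φ a - Φ b - L (a - b)‖ + ‖L (a - b)‖ := by
    simpa using norm_add_le (Φ a - Φ b - L (a - b)) (L (a - b))
  have h6 : ‖L (a - b)‖ ≤ ‖Φ a - Φ b - L (a - b)‖ + ‖Φ a - Φ b‖ := by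
    have := norm_sub_le (Φ a - Φ b) (Φ a - Φ b - L (a - b))
    simpa [add_comm] using this
  rw [dist_eq_norm, dist_eq_norm, ← map_sub]
  have h7 : (K : ℝ) * (K : ℝ)⁻¹ = 1 := mul_inv_cancel₀ (by linarith)
  constructor
  · have h8 : 2 ≤ K + (K : ℝ)⁻¹ := by
      nlinarith [sq_nonneg ((K : ℝ) - 1), inv_pos.mpr (zero_lt_one.trans hK')]
    nlinarith [norm_nonneg (L (a - b))]
  · have h8 : (K : ℝ)⁻¹ * ‖L (a - b)‖ ≤ ‖Φ a - Φ b‖ := by linarith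
    calc ‖L (a - b)‖ = K * ((K : ℝ)⁻¹ * ‖L (a - b)‖) := by rw [← mul_assoc, h7, one_mul]
      _ ≤ _ := by gcongr

variable [MeasurableSpace V] [BorelSpace V]

lemma euclideanHausdorffMeasure_linear_image (L : E m →L[ℝ] V) (A : Set (E m)) :
    μHE[m] (L '' A) = ENNReal.ofReal (L.toLinearMap.normDet) * volume A := by
  have := L.toLinearMap.euclideanHausdorffMeasure_image_eq_normDet_mul_volume A
  simpa using this

lemma exists_one_lt_pow_le {C : ℝ≥0} (hC : 1 < C) (d : ℕ) : ∃ K : ℝ≥0, 1 < K ∧ K ^ d ≤ C := by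
  have h : ContinuousAt (fun x : ℝ≥0 => x ^ d) 1 := by fun_prop
  have h1 : ∀ᶠ x in 𝓝 (1 : ℝ≥0), x ^ d < C := h.eventually_lt_const (by simpa using hC)
  have h2 : ∀ᶠ x in 𝓝[>] (1 : ℝ≥0), x ^ d < C := h1.filter_mono nhdsWithin_le_nhds
  obtain ⟨x, hx, hx1⟩ := (h2.and self_mem_nhdsWithin).exists
  exact ⟨x, hx1, hx.le⟩

/-- **Area formula** for an injective immersion of an open subset of `ℝ^m`, whose inverse is
measurable. -/
theorem euclideanHausdorffMeasure_image_eq_lintegral {Φ : E m → V} {Φ' : E m → E m →L[ℝ] V}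
    {W : Set (E m)} (hW : IsOpen W) (hΦ : ∀ y ∈ W, HasStrictFDerivAt Φ (Φ' y) y)
    (hinj : ∀ y ∈ W, Function.Injective (Φ' y)) {J : E m → ℝ}
    (hJ : ∀ y ∈ W, J y = (Φ' y).toLinearMap.normDet) (hJc : ContinuousOn J W)
    {μ : Measure (E m)} (hμ : ∀ A ⊆ W, MeasurableSet A → μ A = μHE[m] (Φ '' A))
    {A : Set (E m)} (hA : MeasurableSet A) (hAW : A ⊆ W) :
    μ A = ∫⁻ y in A, ENNReal.ofReal (J y) := by
  set ν : Measure (E m) := volume.withDensity (fun y => ENNReal.ofReal (J y)) with hν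
  have hJpos : ∀ y ∈ W, 0 < J y := by
    intro y hy
    rw [hJ y hy]
    refine lt_of_le_of_ne (LinearMap.normDet_nonneg _) (Ne.symm ?_)
    rw [Ne, LinearMap.normDet_eq_zero_iff_ker_ne_bot, not_not]
    exact LinearMap.ker_eq_bot.mpr (hinj y hy)
  -- the local comparison of both measures up to a factor `C > 1`: if distances are distorted by at
  -- most `K`, then `μHE[m]` accounts for `K ^ m`, and the variation of `J` for another factor `K`
  have hloc : ∀ C : ℝ≥0, 1 < C → ∀ y ∈ W, ∃ U ∈ 𝓝 y, ∀ A ⊆ U ∩ W, MeasurableSet A →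
      μ A ≤ C * ν A ∧ ν A ≤ C * μ A := by
    intro C hC y hy
    obtain ⟨K, hK, hKC⟩ := exists_one_lt_pow_le hC (m + 1)
    have hK' : (1 : ℝ) < K := by exact_mod_cast hK
    have hKC' : (K : ℝ≥0∞) ^ m * K ≤ C := by rw [← pow_succ]; exact_mod_cast hKC
    obtain ⟨U, hU, hUd⟩ := exists_nhds_dist_comparison (hΦ y hy) (hinj y hy) hK
    have hJy := hJpos y hy
    have hJcy : ContinuousAt J y := hJc.continuousAt (hW.mem_nhds hy)
    have hb1 : ∀ᶠ z in 𝓝 y, J z < K * J y :=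
      hJcy.eventually_lt_const (by nlinarith)
    have hb2 : ∀ᶠ z in 𝓝 y, (K : ℝ)⁻¹ * J y < J z :=
      hJcy.eventually_const_lt (by
        have := inv_lt_one_of_one_lt₀ hK'
        nlinarith)
    refine ⟨U ∩ {z | J z < K * J y ∧ (K : ℝ)⁻¹ * J y < J z}, inter_mem hU (hb1.and hb2), ?_⟩
    intro A hAU hAm
    have hAU1 : A ⊆ U := fun z hz => (hAU hz).1.1
    have h1 : μ A ≤ (K : ℝ≥0∞) ^ m * (ENNReal.ofReal (J y) * volume A) := by
      rw [hμ A (fun z hz => (hAU hz).2) hAm, hJ y hy, ← euclideanHausdorffMeasure_linear_image]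
      exact euclideanHausdorffMeasure_image_le fun a ha b hb =>
        (hUd a (hAU1 ha) b (hAU1 hb)).1
    have h2 : ENNReal.ofReal (J y) * volume A ≤ (K : ℝ≥0∞) ^ m * μ A := by
      rw [hμ A (fun z hz => (hAU hz).2) hAm, hJ y hy, ← euclideanHausdorffMeasure_linear_image]
      exact euclideanHausdorffMeasure_image_le fun a ha b hb =>
        (hUd a (hAU1 ha) b (hAU1 hb)).2
    have h3 : ν A ≤ K * (ENNReal.ofReal (J y) * volume A) := by
      rw [hν, withDensity_apply _ hAm, ← mul_assoc]
      calc ∫⁻ z in A, ENNReal.ofReal (J z) ≤ ∫⁻ _ in A, K * ENNReal.ofReal (J y) := by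
            refine setLIntegral_mono' hAm fun z hz => ?_
            rw [← ENNReal.ofReal_coe_nnreal, ← ENNReal.ofReal_mul K.coe_nonneg]
            exact ENNReal.ofReal_le_ofReal (hAU hz).1.2.1.le
        _ = _ := by rw [setLIntegral_const]
    have h4 : ENNReal.ofReal (J y) * volume A ≤ K * ν A := by
      rw [hν, withDensity_apply _ hAm, ← lintegral_const_mul' _ _ ENNReal.coe_ne_top,
        ← setLIntegral_const]
      refine setLIntegral_mono' hAm fun z hz => ?_
      rw [← ENNReal.ofReal_coe_nnreal, ← ENNReal.ofReal_mul K.coe_nonneg]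
      refine ENNReal.ofReal_le_ofReal ?_
      have := (hAU hz).1.2.2.le
      calc J y = K * ((K : ℝ)⁻¹ * J y) := by field_simp
        _ ≤ _ := by gcongr
    constructor
    · calc μ A ≤ (K : ℝ≥0∞) ^ m * (ENNReal.ofReal (J y) * volume A) := h1
        _ ≤ (K : ℝ≥0∞) ^ m * (K * ν A) := by gcongr
        _ = (K : ℝ≥0∞) ^ m * K * ν A := by ring
        _ ≤ C * ν A := by gcongr
    · calc ν A ≤ K * (ENNReal.ofReal (J y) * volume A) := h3
        _ ≤ K * ((K : ℝ≥0∞) ^ m * μ A) := by gcongr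
        _ = (K : ℝ≥0∞) ^ m * K * μ A := by ring
        _ ≤ C * μ A := by gcongr
  have hlim : ∀ a b : ℝ≥0∞, (∀ C : ℝ≥0, 1 < C → a ≤ C * b) → a ≤ b := by
    intro a b hab
    have h1 : Tendsto (fun C : ℝ≥0 => (C : ℝ≥0∞) * b) (𝓝[>] 1) (𝓝 ((1 : ℝ≥0) * b)) := by
      refine ENNReal.Tendsto.mul_const ?_ (Or.inl (by simp))
      exact (ENNReal.continuous_coe.tendsto 1).mono_left nhdsWithin_le_nhds
    have h2 := ge_of_tendsto h1 (eventually_nhdsWithin_of_forall fun C hC => hab C hC)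
    simpa using h2
  have h5 : μ A ≤ ν A := hlim _ _ fun C hC => measure_le_of_local
    (fun y hy => by
      obtain ⟨U, hU, h⟩ := hloc C hC y hy
      exact ⟨U, hU, fun B hB hBm => (h B hB hBm).1⟩) hA hAW
  have h6 : ν A ≤ μ A := hlim _ _ fun C hC => measure_le_of_local
    (fun y hy => by
      obtain ⟨U, hU, h⟩ := hloc C hC y hy
      exact ⟨U, hU, fun B hB hBm => (h B hB hBm).2⟩) hA hAW
  rw [le_antisymm h5 h6, hν, withDensity_apply _ hA]

end Area

/-! ### Forms of top degree on a hyperplane -/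

section NormalDensity

variable {m : ℕ}

/-- A form of top degree is a multiple of the volume form. -/
lemma eq_apply_basisVec_mul_euclVol {n : ℕ} (θ : E n [⋀^Fin n]→L[ℝ] ℂ) (v : Fin n → E n) :
    θ v = θ (basisVec n) * (euclVol n v : ℝ) := by
  have h := hodgeStar_hodgeStar (by simp) (isUnitVolume_euclVol n) (Nat.add_zero n)
    (Nat.zero_add n) θ
  have h1 : ∀ w, θ w = (hodgeStar (EuclideanSpace.basisFun (Fin n) ℝ) (Nat.add_zero n) (euclVol n)
      θ) ![] * (euclVol n w : ℝ) := by
    intro w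
    have h2 := DFunLike.congr_fun h w
    rw [hodgeStar_zero_form] at h2
    simpa using h2.symm
  have h3 : euclVol n (basisVec n) = 1 := euclVol_basisFun n
  rw [h1 v, h1 (basisVec n), h3]
  simp

/-- The density, with respect to the volume form `i(N) μ`, of the restriction of an `m`-form on
`ℝ^{m+1}` to the hyperplane orthogonal to the unit vector `N`. -/
def normalDensity (N : E (m + 1)) (β : E (m + 1) [⋀^Fin m]→L[ℝ] ℂ) : ℂ :=
  wedge (innerSL ℝ N) β (basisVec (m + 1))

lemma apply_eq_normalDensity_mul {N : E (m + 1)} (hN : ‖N‖ = 1)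
    (β : E (m + 1) [⋀^Fin m]→L[ℝ] ℂ) {v : Fin m → E (m + 1)} (hv : ∀ i, inner ℝ N (v i) = 0) :
    β v = normalDensity N β * (euclVol (m + 1) (Matrix.vecCons N v) : ℝ) := by
  rw [normalDensity, ← eq_apply_basisVec_mul_euclVol]
  rw [← ContinuousAlternatingMap.curryLeft_apply_apply]
  cases m with
  | zero =>
    rw [curryLeft_wedge_zero]
    simp [hN]
  | succ m =>
    rw [curryLeft_wedge, ContinuousAlternatingMap.sub_apply, wedge_apply]
    simp [hN, hv]

/-- The density is determined by the restriction to the hyperplane. -/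
lemma normalDensity_eq_of_forall {N : E (m + 1)} (hN : ‖N‖ = 1)
    {β : E (m + 1) [⋀^Fin m]→L[ℝ] ℂ} {c : ℂ} (h : ∀ v : Fin m → (ℝ ∙ N)ᗮ,
      β (fun i => (v i : E (m + 1))) =
        c * (euclVol (m + 1) (Matrix.vecCons N fun i => (v i : E (m + 1))) : ℝ)) :
    normalDensity N β = c := by
  have hunit := isUnitVolume_restrict (EuclideanSpace.basisFun (Fin (m + 1)) ℝ) (euclVol (m + 1))
    (by simp) (isUnitVolume_euclVol (m + 1)) hN (stdOrthonormalBasis ℝ (ℝ ∙ N)ᗮ)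
  have hex : ∃ v : Fin m → (ℝ ∙ N)ᗮ,
      euclVol (m + 1) (Matrix.vecCons N fun i => (v i : E (m + 1))) ≠ 0 := by
    by_contra hcon
    push Not at hcon
    have h0 : ∀ v : Fin m → (ℝ ∙ N)ᗮ, (((euclVol (m + 1)).curryLeft N).compContinuousLinearMap
        (ℝ ∙ N)ᗮ.subtypeL) v = 0 := hcon
    rw [IsUnitVolume] at hunit
    simp [h0] at hunit
  obtain ⟨v, hv⟩ := hex
  have h1 := h v
  rw [apply_eq_normalDensity_mul hN β fun i =>
    Submodule.mem_orthogonal_singleton_iff_inner_right.mp (v i).2] at h1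
  exact mul_right_cancel₀ (by exact_mod_cast hv) h1

lemma continuous_normalDensity {Y : Type*} [TopologicalSpace Y] {N : Y → E (m + 1)}
    {β : Y → E (m + 1) [⋀^Fin m]→L[ℝ] ℂ} (hN : Continuous N) (hβ : Continuous β) :
    Continuous fun y => normalDensity (N y) (β y) := by
  simp only [normalDensity, wedge_apply, innerSL_apply_apply]
  refine continuous_finsetSum _ fun i _ => Continuous.const_smul (Continuous.smul ?_ ?_) _
  · exact Complex.continuous_ofReal.comp (hN.inner continuous_const)
  · exact (ContinuousAlternatingMap.apply ℝ (E (m + 1)) ℂ _).continuous.comp hβ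

lemma normalDensity_zero (N : E (m + 1)) :
    normalDensity N (0 : E (m + 1) [⋀^Fin m]→L[ℝ] ℂ) = 0 := by
  simp [normalDensity, wedge_zero]

end NormalDensity

/-! ### Surface integrals in charts -/

namespace BdryChart

open Filter Topology Set

variable {m : ℕ} {Ω : Set (E (m + 1))} (c : BdryChart Ω)

lemma hasStrictFDerivAt {y : E m} (hy : y ∈ c.W) :
    HasStrictFDerivAt c.Φ (fderiv ℝ c.Φ y) y :=
  (c.contDiffAt y hy).hasStrictFDerivAt (by norm_num)

lemma injective_fderiv {y : E m} (hy : y ∈ c.W) : Function.Injective (fderiv ℝ c.Φ y) := by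
  have h1 : HasFDerivAt (fun z => c.π (c.Φ z)) (c.π ∘L fderiv ℝ c.Φ y) y :=
    c.π.hasFDerivAt.comp y (c.hasStrictFDerivAt hy).hasFDerivAt
  have h2 : (fun z => c.π (c.Φ z)) =ᶠ[𝓝 y] id :=
    (c.isOpen_W.eventually_mem hy).mono fun z hz => c.π_Φ z hz
  have h3 : c.π ∘L fderiv ℝ c.Φ y = ContinuousLinearMap.id ℝ (E m) :=
    (h1.congr_of_eventuallyEq h2.symm).unique (hasFDerivAt_id y)
  intro u v huv
  have := congrArg c.π huv
  have h4 : ∀ w, c.π (fderiv ℝ c.Φ y w) = w := fun w => DFunLike.congr_fun h3 w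
  rwa [h4, h4] at this

lemma inner_outerNormal_fderiv (hΩ : IsOpen Ω) {y : E m} (hy : y ∈ c.W) (v : E m) :
    inner ℝ (outerNormal Ω (c.Φ y)) (fderiv ℝ c.Φ y v) = 0 := by
  have hdef := c.isDefining _ (c.mem_U y hy)
  rw [hdef.outerNormal_eq hΩ (c.mem_frontier y hy), inner_smul_left, inner_gradient]
  have h1 : HasFDerivAt (fun z => c.ρ (c.Φ z)) (fderiv ℝ c.ρ (c.Φ y) ∘L fderiv ℝ c.Φ y) y :=
    (hdef.smooth.differentiable (by simp) _).hasFDerivAt.comp y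
      (c.hasStrictFDerivAt hy).hasFDerivAt
  have h2 : (fun z => c.ρ (c.Φ z)) =ᶠ[𝓝 y] fun _ => 0 :=
    (c.isOpen_W.eventually_mem hy).mono fun z hz =>
      ((c.isDefining _ (c.mem_U z hz)).mem_frontier_iff hΩ).mp (c.mem_frontier z hz)
  have h3 := (h1.congr_of_eventuallyEq h2.symm).unique (hasFDerivAt_const (0 : ℝ) y)
  have h4 : fderiv ℝ c.ρ (c.Φ y) (fderiv ℝ c.Φ y v) = 0 := DFunLike.congr_fun h3 v
  rw [h4, mul_zero]

/-- Every tangent vector of the boundary is tangent to a curve in the chart. -/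
lemma exists_fderiv_eq (hΩ : IsOpen Ω) (hΩs : HasSmoothBoundary Ω) {y : E m} (hy : y ∈ c.W)
    {v : E (m + 1)} (hv : v ∈ TangentAt Ω (c.Φ y)) : ∃ w, fderiv ℝ c.Φ y w = v := by
  have hne : outerNormal Ω (c.Φ y) ≠ 0 := by
    rw [← norm_ne_zero_iff, norm_outerNormal hΩs (c.mem_frontier y hy)]
    norm_num
  have hsub : (fderiv ℝ c.Φ y).range ≤ TangentAt Ω (c.Φ y) := by
    rintro _ ⟨w, rfl⟩
    exact Submodule.mem_orthogonal_singleton_iff_inner_right.mpr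
      (c.inner_outerNormal_fderiv hΩ hy w)
  have hfin : Module.finrank ℝ (TangentAt Ω (c.Φ y)) = m := by
    have : Fact (Module.finrank ℝ (E (m + 1)) = m + 1) := ⟨by simp⟩
    exact Submodule.finrank_orthogonal_span_singleton (𝕜 := ℝ) (n := m) hne
  have heq : (fderiv ℝ c.Φ y).range = TangentAt Ω (c.Φ y) := by
    refine Submodule.eq_of_le_of_finrank_eq hsub ?_
    rw [hfin]
    have := LinearMap.finrank_range_of_inj (f := (fderiv ℝ c.Φ y).toLinearMap)
      (c.injective_fderiv hy)
    simpa using this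
  rw [← heq] at hv
  exact hv

/-- The Jacobian of the chart with respect to the volume form of the boundary. -/
def jac (N : E (m + 1) → E (m + 1)) (y : E m) : ℝ :=
  euclVol (m + 1) (Matrix.vecCons (N (c.Φ y)) fun i => fderiv ℝ c.Φ y (basisVec m i))

lemma continuousOn_fderiv : ContinuousOn (fderiv ℝ c.Φ) c.W := fun y hy =>
  ((c.contDiffAt y hy).fderiv_right (m := 1) (by norm_num)).continuousAt.continuousWithinAt

lemma continuousOn_Φ : ContinuousOn c.Φ c.W := fun y hy =>
  (c.contDiffAt y hy).continuousAt.continuousWithinAt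

lemma continuousOn_jac {N : E (m + 1) → E (m + 1)} (hN : Continuous N) :
    ContinuousOn (c.jac N) c.W := by
  refine (euclVol (m + 1)).cont.comp_continuousOn (continuousOn_pi.mpr fun i => ?_)
  refine Fin.cases ?_ (fun i => ?_) i
  · exact hN.comp_continuousOn c.continuousOn_Φ
  · exact c.continuousOn_fderiv.clm_apply continuousOn_const

/-- The Gram determinant of the unit normal and the columns of the derivative of `Φ` is the Gram
determinant of these columns. -/
lemma abs_jac_eq_normDet (hΩ : IsOpen Ω) (hΩs : HasSmoothBoundary Ω) {N : E (m + 1) → E (m + 1)}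
    (hN : ∀ X ∈ frontier Ω, N X = outerNormal Ω X) {y : E m} (hy : y ∈ c.W) :
    |c.jac N y| = (fderiv ℝ c.Φ y).toLinearMap.normDet := by
  rw [← abs_of_nonneg (LinearMap.normDet_nonneg _), ← sq_eq_sq_iff_abs_eq_abs]
  have h1 := (fderiv ℝ c.Φ y).toLinearMap.normDet_sq_eq_det_gram
    (EuclideanSpace.basisFun (Fin m) ℝ)
  simp only [RCLike.ofReal_real_eq_id, id_eq] at h1
  rw [h1, jac, hN _ (c.mem_frontier y hy)]
  set ν := outerNormal Ω (c.Φ y)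
  have hν : ‖ν‖ = 1 := norm_outerNormal hΩs (c.mem_frontier y hy)
  let w : Fin (m + 1) → E (m + 1) := Matrix.vecCons ν fun i => fderiv ℝ c.Φ y (basisVec m i)
  let M : Matrix (Fin (m + 1)) (Fin (m + 1)) ℝ := Matrix.of fun i j => w i j
  have h2 : euclVol (m + 1) w = M.det := rfl
  change euclVol (m + 1) w ^ 2 = _
  have h3 : ∀ i j, (M * M.transpose) i j = inner ℝ (w i) (w j) := by
    intro i j
    rw [Matrix.mul_apply, PiLp.inner_apply]
    refine Finset.sum_congr rfl fun k _ => ?_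
    simp [M, mul_comm]
  rw [h2, pow_two]
  nth_rewrite 2 [← Matrix.det_transpose]
  rw [← Matrix.det_mul, Matrix.det_succ_row_zero, Finset.sum_eq_single 0]
  · rw [h3]
    have : inner ℝ (w 0) (w 0) = (1 : ℝ) := by
      change inner ℝ ν ν = (1 : ℝ)
      rw [real_inner_self_eq_norm_sq, hν]
      norm_num
    rw [this]
    simp only [Fin.val_zero, pow_zero, one_mul]
    congr 1
    ext i j
    rw [Matrix.submatrix_apply, h3]
    rfl
  · intro j _ hj
    obtain ⟨j, rfl⟩ := Fin.exists_succ_eq.mpr hj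
    rw [h3]
    have : inner ℝ (w 0) (w j.succ) = (0 : ℝ) := c.inner_outerNormal_fderiv hΩ hy _
    simp [this]
  · simp

lemma image_Φ {A : Set (E m)} (hA : A ⊆ c.W) : c.Φ '' A = frontier Ω ∩ c.U ∩ c.π ⁻¹' A := by
  ext Y
  constructor
  · rintro ⟨y, hy, rfl⟩
    refine ⟨⟨c.mem_frontier y (hA hy), c.mem_U y (hA hy)⟩, ?_⟩
    rw [mem_preimage, c.π_Φ y (hA hy)]
    exact hy
  · rintro ⟨hY, hYA⟩
    exact ⟨c.π Y, hYA, c.Φ_π Y hY⟩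

/-- The image of the surface measure in the chart. -/
lemma map_π_restrict (hΩ : IsOpen Ω) (hΩs : HasSmoothBoundary Ω) {N : E (m + 1) → E (m + 1)}
    (hNc : Continuous N) (hN : ∀ X ∈ frontier Ω, N X = outerNormal Ω X) :
    ((μHE[m] : Measure (E (m + 1))).restrict (frontier Ω ∩ c.U)).map c.π =
      (volume.restrict c.W).withDensity fun y => ENNReal.ofReal |c.jac N y| := by
  have hmeas : ∀ A ⊆ c.W, MeasurableSet A →
      (((μHE[m] : Measure (E (m + 1))).restrict (frontier Ω ∩ c.U)).map c.π) A =
        μHE[m] (c.Φ '' A) := by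
    intro A hAW hA
    rw [Measure.map_apply c.π.continuous.measurable hA,
      Measure.restrict_apply (c.π.continuous.measurable hA), c.image_Φ hAW, inter_comm]
  ext A hA
  have h1 : (((μHE[m] : Measure (E (m + 1))).restrict (frontier Ω ∩ c.U)).map c.π) A =
      (((μHE[m] : Measure (E (m + 1))).restrict (frontier Ω ∩ c.U)).map c.π) (A ∩ c.W) := by
    have hAW := hA.inter c.isOpen_W.measurableSet
    rw [Measure.map_apply c.π.continuous.measurable hA,
      Measure.map_apply c.π.continuous.measurable hAW,
      Measure.restrict_apply (c.π.continuous.measurable hA),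
      Measure.restrict_apply (c.π.continuous.measurable hAW)]
    congr 1
    ext Y
    constructor
    · rintro ⟨hYA, hY⟩
      exact ⟨⟨hYA, c.π_mem Y hY⟩, hY⟩
    · rintro ⟨hYA, hY⟩
      exact ⟨hYA.1, hY⟩
  rw [h1, euclideanHausdorffMeasure_image_eq_lintegral c.isOpen_W
    (fun y hy => c.hasStrictFDerivAt hy) (fun y hy => c.injective_fderiv hy)
    (fun y hy => c.abs_jac_eq_normDet hΩ hΩs hN hy) (c.continuousOn_jac hNc).abs hmeas
    (hA.inter c.isOpen_W.measurableSet) inter_subset_right, withDensity_apply _ hA,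
    Measure.restrict_restrict hA]

/-- Surface integrals in the chart. -/
lemma setIntegral_eq (hΩ : IsOpen Ω) (hΩs : HasSmoothBoundary Ω) {N : E (m + 1) → E (m + 1)}
    (hNc : Continuous N) (hN : ∀ X ∈ frontier Ω, N X = outerNormal Ω X) {f : E (m + 1) → ℂ}
    (hf : Continuous f) :
    ∫ X in frontier Ω ∩ c.U, f X ∂(μHE[m] : Measure (E (m + 1))) =
      ∫ y in c.W, |c.jac N y| • f (c.Φ y) := by
  have hWm := c.isOpen_W.measurableSet
  have hjm : AEMeasurable (fun y => ENNReal.ofReal |c.jac N y|) (volume.restrict c.W) :=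
    ((c.continuousOn_jac hNc).abs.aemeasurable hWm).ennreal_ofReal
  have hfm : AEStronglyMeasurable (fun y => f (c.Φ y))
      (((μHE[m] : Measure (E (m + 1))).restrict (frontier Ω ∩ c.U)).map c.π) := by
    rw [c.map_π_restrict hΩ hΩs hNc hN]
    exact ((hf.comp_continuousOn c.continuousOn_Φ).aestronglyMeasurable hWm).mono_ac
      (withDensity_absolutelyContinuous _ _)
  have hm : MeasurableSet (frontier Ω ∩ c.U) :=
    isClosed_frontier.measurableSet.inter c.isOpen_U.measurableSet
  calc ∫ X in frontier Ω ∩ c.U, f X ∂(μHE[m] : Measure (E (m + 1)))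
      = ∫ X in frontier Ω ∩ c.U, f (c.Φ (c.π X)) ∂(μHE[m] : Measure (E (m + 1))) :=
        setIntegral_congr_fun hm fun X hX => by rw [c.Φ_π X hX]
    _ = ∫ y, f (c.Φ y) ∂(((μHE[m] : Measure (E (m + 1))).restrict (frontier Ω ∩ c.U)).map c.π) :=
        (integral_map c.π.continuous.measurable.aemeasurable hfm).symm
    _ = ∫ y in c.W, |c.jac N y| • f (c.Φ y) := by
        rw [c.map_π_restrict hΩ hΩs hNc hN,
          integral_withDensity_eq_integral_toReal_smul₀ hjm (by simp)]
        simp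

/-- A smaller chart. -/
def restrict (W' : Set (E m)) (hW' : IsOpen W') : BdryChart Ω where
  U := c.U ∩ c.π ⁻¹' W'
  W := c.W ∩ W'
  Φ := c.Φ
  π := c.π
  ρ := c.ρ
  isOpen_U := c.isOpen_U.inter (hW'.preimage c.π.continuous)
  isOpen_W := c.isOpen_W.inter hW'
  contDiffAt y hy := c.contDiffAt y hy.1
  mem_frontier y hy := c.mem_frontier y hy.1
  mem_U y hy := ⟨c.mem_U y hy.1, by rw [mem_preimage, c.π_Φ y hy.1]; exact hy.2⟩
  π_Φ y hy := c.π_Φ y hy.1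
  π_mem Y hY := ⟨c.π_mem Y ⟨hY.1, hY.2.1⟩, hY.2.2⟩
  Φ_π Y hY := c.Φ_π Y ⟨hY.1, hY.2.1⟩
  isDefining Y hY := c.isDefining Y hY.1

end BdryChart

section SurfaceMeasure

open Filter Topology Set

variable {m : ℕ} {Ω : Set (E (m + 1))}

/-- Around every boundary point there is a chart whose Jacobian has constant sign. -/
lemma exists_bdryChart_jac (hΩ : IsOpen Ω) (hΩs : HasSmoothBoundary Ω) {N : E (m + 1) → E (m + 1)}
    (hNc : Continuous N) (hN : ∀ X ∈ frontier Ω, N X = outerNormal Ω X) {X : E (m + 1)}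
    (hX : X ∈ frontier Ω) :
    ∃ c : BdryChart Ω, X ∈ c.U ∧ ∃ s : ℝ, ∀ y ∈ c.W, |c.jac N y| = s * c.jac N y := by
  obtain ⟨c, hc⟩ := exists_bdryChart hΩ hΩs hX
  have hy := c.π_mem X ⟨hX, hc⟩
  have hne : c.jac N (c.π X) ≠ 0 := by
    rw [← abs_ne_zero, c.abs_jac_eq_normDet hΩ hΩs hN hy, Ne,
      LinearMap.normDet_eq_zero_iff_ker_ne_bot, not_not]
    exact LinearMap.ker_eq_bot.mpr (c.injective_fderiv hy)
  have hcont := (c.continuousOn_jac hNc).continuousAt (c.isOpen_W.mem_nhds hy)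
  rcases lt_or_gt_of_ne hne with hlt | hgt
  · obtain ⟨W', hW', hopen, hmem⟩ := eventually_nhds_iff.mp (hcont.eventually_lt_const hlt)
    refine ⟨c.restrict W' hopen, ⟨hc, hmem⟩, -1, fun y hy => ?_⟩
    rw [neg_one_mul]
    exact abs_of_neg (hW' y hy.2)
  · obtain ⟨W', hW', hopen, hmem⟩ := eventually_nhds_iff.mp (hcont.eventually_const_lt hgt)
    refine ⟨c.restrict W' hopen, ⟨hc, hmem⟩, 1, fun y hy => ?_⟩
    rw [one_mul]
    exact abs_of_pos (hW' y hy.2)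

lemma isCompact_frontier_of_isBounded {n : ℕ} {Ω : Set (E n)} (hbdd : Bornology.IsBounded Ω) :
    IsCompact (frontier Ω) :=
  Metric.isCompact_of_isClosed_isBounded isClosed_frontier
    (hbdd.closure.subset frontier_subset_closure)

/-- The surface measure of a bounded domain is finite. -/
lemma euclideanHausdorffMeasure_frontier_lt_top (hΩ : IsOpen Ω) (hbdd : Bornology.IsBounded Ω)
    (hΩs : HasSmoothBoundary Ω) : (μHE[m] : Measure (E (m + 1))) (frontier Ω) < ⊤ := by
  obtain ⟨N, hNs, hN⟩ := exists_smooth_normal hΩ hΩs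
  refine (isCompact_frontier_of_isBounded hbdd).measure_lt_top_of_nhdsWithin fun X hX => ?_
  obtain ⟨c, hc⟩ := exists_bdryChart hΩ hΩs hX
  have hy := c.π_mem X ⟨hX, hc⟩
  obtain ⟨B, hB, hBW, hBc⟩ := local_compact_nhds (c.isOpen_W.mem_nhds hy)
  refine ⟨frontier Ω ∩ c.U ∩ c.π ⁻¹' B, ?_, ?_⟩
  · rw [inter_assoc]
    exact inter_mem self_mem_nhdsWithin (mem_nhdsWithin_of_mem_nhds
      (inter_mem (c.isOpen_U.mem_nhds hc) (c.π.continuous.continuousAt hB)))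
  · have h1 := congrArg (fun μ => μ B) (c.map_π_restrict hΩ hΩs hNs.continuous hN)
    simp only at h1
    rw [Measure.map_apply c.π.continuous.measurable hBc.measurableSet,
      Measure.restrict_apply (c.π.continuous.measurable hBc.measurableSet),
      withDensity_apply _ hBc.measurableSet, Measure.restrict_restrict hBc.measurableSet,
      inter_eq_left.mpr hBW] at h1
    rw [inter_comm, h1]
    have hint : IntegrableOn (fun y => |c.jac N y|) B :=
      ((c.continuousOn_jac hNs.continuous).abs.mono hBW).integrableOn_compact hBc
    exact hint.lintegral_lt_top

/-- The integral of a derivative of a compactly supported function vanishes. -/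
lemma integral_fderiv_eq_zero {n : ℕ} {f : E n → ℂ} (hf : ContDiff ℝ 1 f)
    (hc : HasCompactSupport f) (v : E n) : ∫ x, fderiv ℝ f x v = 0 := by
  have h := integral_smul_fderiv_eq_neg_fderiv_smul_of_integrable (μ := volume) (𝕜 := ℝ)
    (f := fun _ : E n => (1 : ℝ)) (g := f) (v := v)
    (by simp) ?_ ?_ (fun x _ => by fun_prop) (fun x _ => hf.differentiable (by norm_num) x)
  · simpa using h
  · simp only [one_smul]
    refine Continuous.integrable_of_hasCompactSupport ?_ (hc.fderiv_apply (𝕜 := ℝ) v)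
    exact (hf.continuous_fderiv (by norm_num)).clm_apply continuous_const
  · simp only [one_smul]
    exact hf.continuous.integrable_of_hasCompactSupport hc

lemma integral_extDeriv_eq_zero {k : ℕ} {ζ : Form (k + 1) k} (hζ : ContDiff ℝ 1 ζ)
    (hc : HasCompactSupport ζ) (v : Fin (k + 1) → E (k + 1)) : ∫ y, extDeriv ζ y v = 0 := by
  have h1 : ∀ y, extDeriv ζ y v = ∑ i : Fin (k + 1), (-1 : ℤ) ^ (i : ℕ) •
      fderiv ℝ (fun z => ζ z (i.removeNth v)) y (v i) := fun y =>
    extDeriv_apply (hζ.differentiable (by norm_num) y) v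
  have hcd : ∀ i : Fin (k + 1), ContDiff ℝ 1 (fun z => ζ z (i.removeNth v)) := fun i =>
    (ContinuousAlternatingMap.apply ℝ (E (k + 1)) ℂ (i.removeNth v)).contDiff.comp hζ
  have hcs : ∀ i : Fin (k + 1), HasCompactSupport (fun z => ζ z (i.removeNth v)) := fun i =>
    hc.comp_left (g := fun φ : E (k + 1) [⋀^Fin k]→L[ℝ] ℂ => φ (i.removeNth v)) rfl
  simp_rw [h1]
  rw [integral_finsetSum _ fun i _ => ?_]
  · refine Finset.sum_eq_zero fun i _ => ?_
    simp_rw [zsmul_eq_mul]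
    rw [integral_const_mul, integral_fderiv_eq_zero (hcd i) (hcs i), mul_zero]
  · simp_rw [zsmul_eq_mul]
    refine Integrable.const_mul (Continuous.integrable_of_hasCompactSupport ?_
      ((hcs i).fderiv_apply (𝕜 := ℝ) (v i))) _
    exact ((hcd i).continuous_fderiv (by norm_num)).clm_apply continuous_const

end SurfaceMeasure

/-! ### Stokes' theorem and the exterior derivative on the boundary -/

section Stokes

open Filter Topology Set

variable {k : ℕ} {Ω : Set (E (k + 1 + 1))}

lemma extDeriv_eventually_zero {n p : ℕ} {η : Form n p} {x : E n} (h : η =ᶠ[𝓝 x] 0) :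
    extDeriv η x = 0 := by
  rw [extDeriv_eq_sum_wedge, h.fderiv_eq]
  simp [wedge_zero]

lemma contDiff_extDeriv {n p : ℕ} {η : Form n p} (hη : ContDiff ℝ ∞ η) :
    ContDiff ℝ ∞ (extDeriv η) := by
  rw [show extDeriv η = fun x => _ from funext fun x => extDeriv_eq_sum_wedge η x]
  refine ContDiff.sum fun j _ => ?_
  exact (wedgeL (innerSL ℝ (basisVec _ j))).contDiff.comp
    ((hη.fderiv_right (m := ∞) (by simp)).clm_apply contDiff_const)

/-- The pullback of a form to the domain of a chart, extended by zero outside this domain. -/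
def BdryChart.pullback {m p : ℕ} {Ω : Set (E (m + 1))} (c : BdryChart Ω) (η : Form (m + 1) p) :
    Form m p :=
  c.W.indicator fun y => (η (c.Φ y)).compContinuousLinearMap (fderiv ℝ c.Φ y)

lemma BdryChart.extDeriv_pullback {m p : ℕ} {Ω : Set (E (m + 1))} (c : BdryChart Ω)
    {η : Form (m + 1) p} (hη : ContDiff ℝ ∞ η) {y : E m} (hy : y ∈ c.W) :
    extDeriv (c.pullback η) y =
      (extDeriv η (c.Φ y)).compContinuousLinearMap (fderiv ℝ c.Φ y) := by
  rw [← _root_.extDeriv_pullback (hη.differentiable (by simp) _) (c.contDiffAt y hy) (by simp)]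
  refine Filter.EventuallyEq.extDeriv_eq ?_
  exact (c.isOpen_W.eventually_mem hy).mono fun z hz => indicator_of_mem hz _

/-- Stokes' theorem for a form supported in the range of a chart. The pullback of such a form has
compact support in the domain of the chart, and the surface integral becomes, up to the sign `s`,
the integral of the exterior derivative of the pullback. -/
lemma integral_normalDensity_extDeriv_of_tsupport_subset (hΩ : IsOpen Ω)
    (hbdd : Bornology.IsBounded Ω) (hΩs : HasSmoothBoundary Ω) {N : E (k + 1 + 1) → E (k + 1 + 1)}
    (hNc : Continuous N) (hN : ∀ X ∈ frontier Ω, N X = outerNormal Ω X) (c : BdryChart Ω) {s : ℝ}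
    (hs : ∀ y ∈ c.W, |c.jac N y| = s * c.jac N y) {η : Form (k + 1 + 1) k}
    (hη : ContDiff ℝ ∞ η) (hsupp : tsupport η ⊆ c.U) :
    ∫ X in frontier Ω, normalDensity (N X) (extDeriv η X)
      ∂(μHE[k + 1] : Measure (E (k + 1 + 1))) = 0 := by
  have hcpt := isCompact_frontier_of_isBounded hbdd
  have hD : Continuous fun X => normalDensity (N X) (extDeriv η X) :=
    continuous_normalDensity hNc (contDiff_extDeriv hη).continuous
  have hout : ∀ X ∉ tsupport η, extDeriv η X = 0 := fun X hX =>
    extDeriv_eventually_zero (notMem_tsupport_iff_eventuallyEq.mp hX)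
  -- a compact set outside which the pullback vanishes
  let C : Set (E (k + 1)) := c.π '' (frontier Ω ∩ tsupport η)
  have hC : IsCompact C := (hcpt.inter_right (isClosed_tsupport η)).image c.π.continuous
  have hCW : C ⊆ c.W := by
    rintro _ ⟨Y, ⟨hY, hYs⟩, rfl⟩
    exact c.π_mem Y ⟨hY, hsupp hYs⟩
  have hzero : ∀ y ∉ C, c.pullback η y = 0 := by
    intro y hy
    by_cases hyW : y ∈ c.W
    · have : c.Φ y ∉ tsupport η := fun hmem =>
        hy ⟨c.Φ y, ⟨c.mem_frontier y hyW, hmem⟩, c.π_Φ y hyW⟩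
      rw [BdryChart.pullback, indicator_of_mem hyW, image_eq_zero_of_notMem_tsupport this]
      ext; simp
    · exact indicator_of_notMem hyW _
  have hev : ∀ y ∉ C, c.pullback η =ᶠ[𝓝 y] 0 := fun y hy =>
    (hC.isClosed.isOpen_compl.eventually_mem hy).mono hzero
  have hζ : ContDiff ℝ 1 (c.pullback η) := by
    rw [contDiff_iff_contDiffAt]
    intro y
    by_cases hyW : y ∈ c.W
    · have heq : c.pullback η =ᶠ[𝓝 y]
          fun y => (η (c.Φ y)).compContinuousLinearMap (fderiv ℝ c.Φ y) :=
        (c.isOpen_W.eventually_mem hyW).mono fun z hz => indicator_of_mem hz _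
      refine ContDiffAt.congr_of_eventuallyEq (contDiffAt_of_apply fun v => ?_) heq
      simp only [ContinuousAlternatingMap.compContinuousLinearMap_apply]
      refine contDiffAt_apply_apply (v := fun i y => fderiv ℝ c.Φ y (v i)) ?_ fun i => ?_
      · exact ((hη.of_le (by simp)).contDiffAt).comp y
          ((c.contDiffAt y hyW).of_le (by norm_num))
      · exact contDiffAt_fderiv_apply (c.contDiffAt y hyW) _
    · exact contDiffAt_const.congr_of_eventuallyEq (hev y fun h => hyW (hCW h))
  have hζc : HasCompactSupport (c.pullback η) := HasCompactSupport.intro hC hzero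
  have hmU : ∫ X in frontier Ω, normalDensity (N X) (extDeriv η X)
        ∂(μHE[k + 1] : Measure (E (k + 1 + 1))) =
      ∫ X in frontier Ω ∩ c.U, normalDensity (N X) (extDeriv η X)
        ∂(μHE[k + 1] : Measure (E (k + 1 + 1))) := by
    refine setIntegral_eq_of_subset_of_forall_sdiff_eq_zero isClosed_frontier.measurableSet
      inter_subset_left fun X hX => ?_
    rw [hout X fun h => hX.2 ⟨hX.1, hsupp h⟩, normalDensity_zero]
  rw [hmU, c.setIntegral_eq hΩ hΩs hNc hN hD]
  have hint : ∀ y ∈ c.W, |c.jac N y| • normalDensity (N (c.Φ y)) (extDeriv η (c.Φ y)) =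
      (s : ℂ) * extDeriv (c.pullback η) y (basisVec (k + 1)) := by
    intro y hy
    have hX := c.mem_frontier y hy
    rw [c.extDeriv_pullback hη hy, ContinuousAlternatingMap.compContinuousLinearMap_apply,
      apply_eq_normalDensity_mul (N := N (c.Φ y)) (by rw [hN _ hX, norm_outerNormal hΩs hX])
      _ (fun i => by
        rw [hN _ hX]
        exact c.inner_outerNormal_fderiv hΩ hy _), hs y hy, Complex.real_smul]
    change _ = (s : ℂ) * (_ * (c.jac N y : ℂ))
    push_cast
    ring
  rw [setIntegral_congr_fun c.isOpen_W.measurableSet hint,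
    setIntegral_eq_integral_of_forall_compl_eq_zero fun y hy => by
      rw [extDeriv_eventually_zero (hev y fun h => hy (hCW h))]; simp,
    integral_const_mul, integral_extDeriv_eq_zero hζ hζc, mul_zero]

lemma normalDensity_sum {m : ℕ} {ι : Type*} (s : Finset ι) (N : E (m + 1))
    (β : ι → E (m + 1) [⋀^Fin m]→L[ℝ] ℂ) :
    normalDensity N (∑ i ∈ s, β i) = ∑ i ∈ s, normalDensity N (β i) := by
  simp [normalDensity, wedge_sum]

lemma integrableOn_frontier {m : ℕ} {Ω : Set (E (m + 1))} {F : Type*} [NormedAddCommGroup F]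
    [NormedSpace ℝ F] (hΩ : IsOpen Ω) (hbdd : Bornology.IsBounded Ω) (hΩs : HasSmoothBoundary Ω)
    {f : E (m + 1) → F} (hf : ContinuousOn f (frontier Ω)) :
    IntegrableOn f (frontier Ω) (μHE[m] : Measure (E (m + 1))) :=
  hf.integrableOn_of_subset_isCompact (isCompact_frontier_of_isBounded hbdd)
    isClosed_frontier.measurableSet Set.Subset.rfl
    (euclideanHausdorffMeasure_frontier_lt_top hΩ hbdd hΩs).ne

/-- A finite smooth partition of unity on `ℝⁿ`, subordinate to the complement of a compact set and
an open cover of this set. -/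
lemma exists_finite_partition {n : ℕ} {ι : Type*} {K : Set (E n)} (hK : IsCompact K)
    (U : ι → Set (E n)) (hU : ∀ i, IsOpen (U i)) (hKU : K ⊆ ⋃ i, U i) :
    ∃ (t : Finset ι) (χ : Option t → E n → ℝ), (∀ i, ContDiff ℝ ∞ (χ i)) ∧
      (∀ x, ∑ i, χ i x = 1) ∧ tsupport (χ none) ⊆ Kᶜ ∧ ∀ i : t, tsupport (χ (some i)) ⊆ U i := by
  obtain ⟨t, ht⟩ := hK.elim_finite_subcover U hU hKU
  obtain ⟨χ, hχ⟩ := SmoothPartitionOfUnity.exists_isSubordinate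
    (modelWithCornersSelf ℝ (E n)) isClosed_univ
    (fun i : Option t => i.elim Kᶜ fun j => U j)
    (by
      rintro (_ | i)
      · exact hK.isClosed.isOpen_compl
      · exact hU i)
    (by
      intro x _
      by_cases hx : x ∈ K
      · obtain ⟨i, hi, hxi⟩ := mem_iUnion₂.mp (ht hx)
        exact mem_iUnion.mpr ⟨some ⟨i, hi⟩, hxi⟩
      · exact mem_iUnion.mpr ⟨none, hx⟩)
  refine ⟨t, fun i => χ i, fun i => (χ i).contMDiff.contDiff, fun x => ?_, hχ none,
    fun i => hχ (some i)⟩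
  rw [← finsum_eq_sum_of_fintype]
  exact χ.sum_eq_one (mem_univ x)

lemma extDeriv_eq_sum {n p : ℕ} {ι : Type*} [Fintype ι] {χ : ι → E n → ℝ}
    (hχ : ∀ i, ContDiff ℝ ∞ (χ i)) (hsum : ∀ x, ∑ i, χ i x = 1) {η : Form n p}
    (hη : ContDiff ℝ ∞ η) (x : E n) :
    extDeriv η x = ∑ i, extDeriv (fun y => χ i y • η y) x := by
  have h : η = fun y => ∑ i, χ i y • η y := by
    funext y
    rw [← Finset.sum_smul, hsum y, one_smul]
  simp_rw [extDeriv_eq_sum_wedge]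
  rw [Finset.sum_comm]
  refine Finset.sum_congr rfl fun j _ => ?_
  rw [← wedge_sum]
  congr 1
  conv_lhs => rw [h]
  rw [fderiv_fun_sum (A := fun i y => χ i y • η y)
    fun i _ => ((hχ i).smul hη).differentiable (by simp) x]
  simp

/-- Stokes' theorem on the closed hypersurface `Γ`. It follows from the local case by a partition of
unity. -/
lemma integral_normalDensity_extDeriv (hΩ : IsOpen Ω)
    (hbdd : Bornology.IsBounded Ω) (hΩs : HasSmoothBoundary Ω) {N : E (k + 1 + 1) → E (k + 1 + 1)}
    (hNc : Continuous N) (hN : ∀ X ∈ frontier Ω, N X = outerNormal Ω X) {η : Form (k + 1 + 1) k}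
    (hη : ContDiff ℝ ∞ η) :
    ∫ X in frontier Ω, normalDensity (N X) (extDeriv η X)
      ∂(μHE[k + 1] : Measure (E (k + 1 + 1))) = 0 := by
  choose c hc s hs using fun X : frontier Ω => exists_bdryChart_jac hΩ hΩs hNc hN X.2
  obtain ⟨t, χ, hχ, hsum, hnone, hsome⟩ := exists_finite_partition
    (isCompact_frontier_of_isBounded hbdd)
    (fun X : frontier Ω => (c X).U) (fun X => (c X).isOpen_U)
    fun X hX => mem_iUnion.mpr ⟨⟨X, hX⟩, hc ⟨X, hX⟩⟩
  have hη' : ∀ i, ContDiff ℝ ∞ (fun y => χ i y • η y) := fun i => (hχ i).smul hη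
  have hsub : ∀ i, tsupport (fun y => χ i y • η y) ⊆ tsupport (χ i) := fun i =>
    closure_mono (Function.support_smul_subset_left (χ i) η)
  simp_rw [extDeriv_eq_sum hχ hsum hη, normalDensity_sum]
  rw [integral_finsetSum _ fun i _ => integrableOn_frontier hΩ hbdd hΩs
    (continuous_normalDensity hNc (contDiff_extDeriv (hη' i)).continuous).continuousOn]
  refine Finset.sum_eq_zero fun i _ => ?_
  rcases i with (_ | X)
  · refine setIntegral_eq_zero_of_forall_eq_zero fun X hX => ?_
    rw [extDeriv_eventually_zero
      (notMem_tsupport_iff_eventuallyEq.mp fun h => hnone (hsub none h) hX),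
      normalDensity_zero]
  · exact integral_normalDensity_extDeriv_of_tsupport_subset hΩ hbdd hΩs hNc hN (c X)
      (hs X) (hη' _) ((hsub _).trans (hsome X))

/-- The tangential trace of `dη` depends only on that of `η`, as is seen by pulling back to a chart.
Hence the exterior derivative of a form on `Γ` does not depend on the extension. -/
lemma tangTrace_extDeriv_congr {m p : ℕ} {Ω : Set (E (m + 1))} (hΩ : IsOpen Ω)
    (hΩs : HasSmoothBoundary Ω) {η θ : Form (m + 1) p} (hη : ContDiff ℝ ∞ η)
    (hθ : ContDiff ℝ ∞ θ) (h : tangTrace Ω η = tangTrace Ω θ) :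
    tangTrace Ω (extDeriv η) = tangTrace Ω (extDeriv θ) := by
  funext ⟨X, hX⟩
  obtain ⟨c, hc⟩ := exists_bdryChart hΩ hΩs hX
  have hy := c.π_mem X ⟨hX, hc⟩
  have hpull : c.pullback η = c.pullback θ := by
    funext y
    by_cases hyW : y ∈ c.W
    · simp only [BdryChart.pullback, indicator_of_mem hyW]
      ext v
      have h1 := DFunLike.congr_fun (congrFun h ⟨c.Φ y, c.mem_frontier y hyW⟩) fun i =>
        ⟨fderiv ℝ c.Φ y (v i), Submodule.mem_orthogonal_singleton_iff_inner_right.mpr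
          (c.inner_outerNormal_fderiv hΩ hyW _)⟩
      exact h1
    · simp only [BdryChart.pullback, indicator_of_notMem hyW]
  have hd := congrArg (fun ζ => extDeriv ζ (c.π X)) hpull
  simp only [c.extDeriv_pullback hη hy, c.extDeriv_pullback hθ hy] at hd
  ext v
  have hXΦ := c.Φ_π X ⟨hX, hc⟩
  have hex : ∀ i, ∃ w, fderiv ℝ c.Φ (c.π X) w = (v i : E (m + 1)) := fun i =>
    c.exists_fderiv_eq hΩ hΩs hy (by rw [hXΦ]; exact (v i).2)
  choose w hw using hex
  have h1 := DFunLike.congr_fun hd w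
  simp only [ContinuousAlternatingMap.compContinuousLinearMap_apply, hXΦ] at h1
  change extDeriv η X (fun i => (v i : E (m + 1))) = extDeriv θ X (fun i => (v i : E (m + 1)))
  have h2 : (fun i => (v i : E (m + 1))) = fun i => fderiv ℝ c.Φ (c.π X) (w i) :=
    funext fun i => (hw i).symm
  rw [h2]
  exact h1

lemma bdryExtDeriv_tangTrace {m p : ℕ} {Ω : Set (E (m + 1))} (hΩ : IsOpen Ω)
    (hΩs : HasSmoothBoundary Ω) {η : Form (m + 1) p} (hη : ContDiff ℝ ∞ η) :
    bdryExtDeriv (tangTrace Ω η) = tangTrace Ω (extDeriv η) := by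
  have hsm : (tangTrace Ω η).IsSmooth := ⟨η, hη, rfl⟩
  rw [bdryExtDeriv, dif_pos hsm]
  exact tangTrace_extDeriv_congr hΩ hΩs hsm.choose_spec.1 hη hsm.choose_spec.2

end Stokes

/-! ### Forms on the boundary and their extensions -/

section BoundaryForms

variable {m : ℕ} {Ω : Set (E (m + 1))}

lemma finrank_tangentAt (hΩs : HasSmoothBoundary Ω) (X : frontier Ω) :
    Module.finrank ℝ (TangentAt Ω (X : E (m + 1))) = m := by
  have : Fact (Module.finrank ℝ (E (m + 1)) = m + 1) := ⟨by simp⟩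
  refine Submodule.finrank_orthogonal_span_singleton (𝕜 := ℝ) (n := m) ?_
  rw [← norm_ne_zero_iff, norm_outerNormal hΩs X.2]
  norm_num

lemma isUnitVolume_bdryVol (hΩs : HasSmoothBoundary Ω) (X : frontier Ω) :
    IsUnitVolume (stdOrthonormalBasis ℝ (TangentAt Ω (X : E (m + 1)))) (bdryVol Ω X) :=
  isUnitVolume_restrict (EuclideanSpace.basisFun (Fin (m + 1)) ℝ) (euclVol (m + 1)) (by simp)
    (isUnitVolume_euclVol _) (norm_outerNormal hΩs X.2) _

lemma bdryStarInv_eq {p r : ℕ} (h : p + r = m) (h' : r + p = m) (α : BdryForm Ω r) :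
    bdryStarInv h α = (-1 : ℂ) ^ (p * r) • bdryStar h' α := rfl

lemma bdryStar_smul {p r : ℕ} (h : p + r = m) (a : ℂ) (α : BdryForm Ω p) :
    bdryStar h (a • α) = a • bdryStar h α := by
  funext X
  exact hodgeStar_smul _ _ _ _ _

lemma bdryStar_bdryStarInv (hΩs : HasSmoothBoundary Ω) {p r : ℕ} (h : p + r = m)
    (α : BdryForm Ω r) : bdryStar h (bdryStarInv h α) = α := by
  funext X
  exact hodgeStar_hodgeStarInv (by simpa using finrank_tangentAt hΩs X)
    (isUnitVolume_bdryVol hΩs X) h _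

/-- The extension `X ↦ η_X ∘ P_X` of the tangential trace of `η`, where `P_X` is the projection
along a vector field `N` extending the unit normal. -/
def tangPart (N : E (m + 1) → E (m + 1)) {p : ℕ} (η : Form (m + 1) p) : Form (m + 1) p :=
  fun X => (η X).compContinuousLinearMap (tangProj (N X))

lemma tangPart_apply (N : E (m + 1) → E (m + 1)) {p : ℕ} (η : Form (m + 1) p) (X : E (m + 1))
    (v : Fin p → E (m + 1)) : tangPart N η X v = η X fun i => tangProj (N X) (v i) := rfl

lemma tangTrace_apply_proj (hΩs : HasSmoothBoundary Ω) {N : E (m + 1) → E (m + 1)}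
    (hN : ∀ X ∈ frontier Ω, N X = outerNormal Ω X) {p : ℕ} (θ : Form (m + 1) p) (X : frontier Ω)
    (w : Fin p → E (m + 1)) :
    tangTrace Ω θ X (fun i => (TangentAt Ω (X : E (m + 1))).orthogonalProjectionOnto (w i)) =
      tangPart N θ X w := by
  rw [tangPart_apply, hN X X.2]
  change θ X (fun i => ((TangentAt Ω (X : E (m + 1))).orthogonalProjectionOnto (w i) :
    E (m + 1))) = _
  congr 1
  funext i
  exact coe_orthogonalProjection_eq_tangProj (norm_outerNormal hΩs X.2) (w i)

lemma contDiff_tangPart {N : E (m + 1) → E (m + 1)} (hN : ContDiff ℝ ∞ N) {p : ℕ}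
    {η : Form (m + 1) p} (hη : ContDiff ℝ ∞ η) : ContDiff ℝ ∞ (tangPart N η) := by
  rw [contDiff_iff_contDiffAt]
  intro X
  refine contDiffAt_of_apply fun v => contDiffAt_apply_apply
    (v := fun i Y => tangProj (N Y) (v i)) hη.contDiffAt fun i => ?_
  simp only [tangProj_apply]
  exact (contDiff_const.sub ((hN.inner ℝ contDiff_const).smul hN)).contDiffAt

/-- The Hodge operator of `Γ`, extended to a neighbourhood with the help of `N`. -/
def starPart (N : E (m + 1) → E (m + 1)) {p r : ℕ} (h : p + r = m) (η : Form (m + 1) p) :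
    Form (m + 1) r := fun X =>
  hodgeStar (EuclideanSpace.basisFun (Fin (m + 1)) ℝ) h ((euclVol (m + 1)).curryLeft (N X))
    (tangPart N η X)

lemma contDiff_starPart {N : E (m + 1) → E (m + 1)} (hN : ContDiff ℝ ∞ N) {p r : ℕ}
    (h : p + r = m) {η : Form (m + 1) p} (hη : ContDiff ℝ ∞ η) :
    ContDiff ℝ ∞ (starPart N h η) := by
  rw [contDiff_iff_contDiffAt]
  intro X
  refine contDiffAt_of_apply fun v => ?_
  simp only [starPart, hodgeStar_apply, contract_apply]
  refine contDiffAt_const.mul (ContDiffAt.sum fun J _ => ContDiffAt.mul ?_ ?_)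
  · exact contDiffAt_apply_apply (v := fun i _ => _) (contDiff_tangPart hN hη).contDiffAt
      fun i => contDiffAt_const
  · refine Complex.ofRealCLM.contDiff.contDiffAt.comp X ?_
    refine (euclVol (m + 1)).toContinuousMultilinearMap.contDiff.contDiffAt.comp X
      (contDiffAt_pi.mpr fun i => ?_)
    refine Fin.cases ?_ (fun i => ?_) i
    · exact hN.contDiffAt
    · exact contDiffAt_const

lemma bdryStar_tangTrace (hΩs : HasSmoothBoundary Ω) {N : E (m + 1) → E (m + 1)}
    (hN : ∀ X ∈ frontier Ω, N X = outerNormal Ω X) {p r : ℕ} (h : p + r = m)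
    (η : Form (m + 1) p) : bdryStar h (tangTrace Ω η) = tangTrace Ω (starPart N h η) := by
  funext X
  have := hodgeStar_restrict (EuclideanSpace.basisFun (Fin (m + 1)) ℝ) (euclVol (m + 1))
    (norm_outerNormal hΩs X.2) (stdOrthonormalBasis ℝ (TangentAt Ω (X : E (m + 1)))) h (η X)
  have hs : starPart N h η X = hodgeStar (EuclideanSpace.basisFun (Fin (m + 1)) ℝ) h
      ((euclVol (m + 1)).curryLeft (outerNormal Ω X))
      ((η X).compContinuousLinearMap (tangProj (outerNormal Ω X))) := by
    rw [starPart, tangPart, hN X X.2]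
  change _ = restrictAt Ω X r (starPart N h η X)
  rw [hs]
  exact this

lemma tangTrace_smul {p : ℕ} (a : ℂ) (η : Form (m + 1) p) :
    tangTrace Ω (a • η) = a • tangTrace Ω η := rfl

namespace BdryForm.IsSmooth

lemma smul {p : ℕ} {α : BdryForm Ω p} (hα : α.IsSmooth) (a : ℂ) : (a • α).IsSmooth := by
  obtain ⟨η, hη, rfl⟩ := hα
  exact ⟨a • η, contDiff_const.smul hη, rfl⟩

lemma bdryStar (hΩ : IsOpen Ω) (hΩs : HasSmoothBoundary Ω) {p r : ℕ} (h : p + r = m)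
    {α : BdryForm Ω p} (hα : α.IsSmooth) : (bdryStar h α).IsSmooth := by
  obtain ⟨η, hη, rfl⟩ := hα
  obtain ⟨N, hNs, hN⟩ := exists_smooth_normal hΩ hΩs
  exact ⟨_, contDiff_starPart hNs h hη, (bdryStar_tangTrace hΩs hN h η).symm⟩

lemma bdryStarInv (hΩ : IsOpen Ω) (hΩs : HasSmoothBoundary Ω) {p r : ℕ} (h : p + r = m)
    {α : BdryForm Ω r} (hα : α.IsSmooth) : (bdryStarInv h α).IsSmooth := by
  rw [bdryStarInv_eq h ((Nat.add_comm r p).trans h)]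
  exact (hα.bdryStar hΩ hΩs _).smul _

lemma bdryExtDeriv (hΩ : IsOpen Ω) (hΩs : HasSmoothBoundary Ω) {p : ℕ}
    {α : BdryForm Ω p} (hα : α.IsSmooth) : (bdryExtDeriv α).IsSmooth := by
  obtain ⟨η, hη, rfl⟩ := hα
  exact ⟨_, contDiff_extDeriv hη, (bdryExtDeriv_tangTrace hΩ hΩs hη).symm⟩

lemma bdryCoderiv (hΩ : IsOpen Ω) (hΩs : HasSmoothBoundary Ω) {p r : ℕ} (h : p + 1 + r = m)
    {α : BdryForm Ω (p + 1)} (hα : α.IsSmooth) : (bdryCoderiv h α).IsSmooth :=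
  (((hα.bdryStar hΩ hΩs h).bdryExtDeriv hΩ hΩs).bdryStarInv hΩ hΩs _).smul _

end BdryForm.IsSmooth

lemma extDeriv_const_smul_complex {n p : ℕ} {η : Form n p} (a : ℂ) {x : E n}
    (hη : DifferentiableAt ℝ η x) : extDeriv (a • η) x = a • extDeriv η x := by
  simp_rw [extDeriv_eq_sum_wedge, fderiv_const_smul hη a, Finset.smul_sum, ← wedge_smul]
  rfl

/-- The integrand of the single-layer potential: the kernel `I_p` produces the tangential part. -/
lemma traceInner_greenKernel (hΩs : HasSmoothBoundary Ω) {N : E (m + 1) → E (m + 1)}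
    (hN : ∀ X ∈ frontier Ω, N X = outerNormal Ω X) (k : ℂ) (r₀ : ℝ) {p : ℕ} (η : Form (m + 1) p)
    (X' : E (m + 1)) (X : frontier Ω) :
    traceInner (tangTrace Ω η) (greenKernel m p k r₀) X' X =
      helmholtzKernel m k r₀ X X' • tangPart N η X := by
  have hν := norm_outerNormal hΩs X.2
  ext v
  have h1 := formInner_restrict_riesz hν (stdOrthonormalBasis ℝ (TangentAt Ω (X : E (m + 1))))
    (tangTrace Ω η X) v
  have h2 : tangTrace Ω η X
      (fun i => (TangentAt Ω (X : E (m + 1))).orthogonalProjectionOnto (v i)) = tangPart N η X v :=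
    tangTrace_apply_proj hΩs hN η X v
  rw [h2] at h1
  rw [ContinuousAlternatingMap.smul_apply, ← h1]
  change formInner (stdOrthonormalBasis ℝ (TangentAt Ω (X : E (m + 1)))) (tangTrace Ω η X)
    (((starRingEnd ℂ) (helmholtzKernel m k r₀ X X')) •
      (riesz (E (m + 1)) p v).compContinuousLinearMap (TangentAt Ω (X : E (m + 1))).subtypeL) = _
  simp only [formInner, sum_apply, smul_apply, ContinuousLinearMap.comp_apply, Finset.smul_sum]
  refine Finset.sum_congr rfl fun J _ => ?_
  change _ * (starRingEnd ℂ) (_ * _) = _ * (_ * (starRingEnd ℂ) _)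
  rw [map_mul, Complex.conj_conj]
  exact mul_left_comm _ _ _

end BoundaryForms

/-! ### The radial Helmholtz equation and entire power series -/

section RadialEquation

open Set Filter Topology

/-- `h` is smooth on `(0, ∞)`, with derivative `h₁`, and `s h'' + (ν + 1) h' + κ h = f` there. In
dimension `n = 2 ν + 2`, and with `s = |x|²`, the left-hand side is a quarter of
`∑ ∂_j² + 4 κ`, applied to the radial function `h (|x|²)`. -/
def RadialEquation (ν : ℝ) (κ : ℂ) (h h₁ f : ℝ → ℂ) : Prop :=
  ContDiffOn ℝ ∞ h (Ioi 0) ∧ ∃ h₂ : ℝ → ℂ, ∀ s : ℝ, 0 < s → HasDerivAt h (h₁ s) s ∧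
    HasDerivAt h₁ (h₂ s) s ∧ (s : ℂ) * h₂ s + ((ν : ℂ) + 1) * h₁ s + κ * h s = f s

namespace RadialEquation

variable {ν : ℝ} {κ : ℂ} {h h₁ f : ℝ → ℂ}

lemma const_mul (hh : RadialEquation ν κ h h₁ f) (c : ℂ) :
    RadialEquation ν κ (fun s => c * h s) (fun s => c * h₁ s) fun s => c * f s := by
  obtain ⟨hs, h₂, H⟩ := hh
  refine ⟨contDiffOn_const.mul hs, fun s => c * h₂ s, fun s hs => ?_⟩
  obtain ⟨H1, H2, H3⟩ := H s hs
  refine ⟨H1.const_mul c, H2.const_mul c, ?_⟩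
  beta_reduce
  rw [← H3]
  ring

lemma add {g g₁ e : ℝ → ℂ} (hh : RadialEquation ν κ h h₁ f) (hg : RadialEquation ν κ g g₁ e) :
    RadialEquation ν κ (fun s => h s + g s) (fun s => h₁ s + g₁ s) fun s => f s + e s := by
  obtain ⟨hs, h₂, H⟩ := hh
  obtain ⟨gs, g₂, G⟩ := hg
  refine ⟨hs.add gs, fun s => h₂ s + g₂ s, fun s hs => ?_⟩
  obtain ⟨H1, H2, H3⟩ := H s hs
  obtain ⟨G1, G2, G3⟩ := G s hs
  refine ⟨H1.add G1, H2.add G2, ?_⟩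
  beta_reduce
  rw [← H3, ← G3]
  ring

lemma const : RadialEquation ν 0 (fun _ => 1) (fun _ => 0) fun _ => 0 :=
  ⟨contDiffOn_const, fun _ => 0, fun s _ => ⟨hasDerivAt_const s 1, hasDerivAt_const s 0, by simp⟩⟩

lemma congr {h' f' : ℝ → ℂ} (hh : RadialEquation ν κ h h₁ f) (hh' : ∀ s, 0 < s → h' s = h s)
    (hf' : ∀ s, 0 < s → f' s = f s) : RadialEquation ν κ h' h₁ f' := by
  obtain ⟨hs, h₂, H⟩ := hh
  refine ⟨hs.congr hh', h₂, fun s hs => ?_⟩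
  obtain ⟨H1, H2, H3⟩ := H s hs
  refine ⟨H1.congr_of_eventuallyEq ?_, H2, ?_⟩
  · exact Filter.mem_of_superset (Ioi_mem_nhds hs) fun t ht => hh' t ht
  · rw [hh' s hs, hf' s hs, H3]

lemma hasDerivAt_log {s : ℝ} (hs : 0 < s) :
    HasDerivAt (fun s : ℝ => (Real.log s : ℂ)) ((s : ℂ)⁻¹) s := by
  simpa using (Real.hasDerivAt_log hs.ne').ofReal_comp

/-- If `h` solves the equation, then `log s · h` solves it up to the additional terms
`2 h' + ν h / s` on the right-hand side. -/
lemma log_mul (hh : RadialEquation ν κ h h₁ f) :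
    RadialEquation ν κ (fun s => (Real.log s : ℂ) * h s)
      (fun s => (s : ℂ)⁻¹ * h s + (Real.log s : ℂ) * h₁ s)
      fun s => (Real.log s : ℂ) * f s + (2 * h₁ s + ν * ((s : ℂ)⁻¹ * h s)) := by
  obtain ⟨hs, h₂, H⟩ := hh
  refine ⟨?_, fun s => -((s : ℂ) ^ 2)⁻¹ * h s + 2 * ((s : ℂ)⁻¹ * h₁ s) + Real.log s * h₂ s,
    fun s hs => ?_⟩
  · refine ContDiffOn.mul (Complex.ofRealCLM.contDiff.comp_contDiffOn ?_) hs
    exact fun s hs => (Real.contDiffAt_log.mpr (ne_of_gt hs)).contDiffWithinAt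
  · obtain ⟨H1, H2, H3⟩ := H s hs
    have hs' : (s : ℂ) ≠ 0 := by exact_mod_cast hs.ne'
    have hinv : HasDerivAt (fun s : ℝ => (s : ℂ)⁻¹) (-((s : ℂ) ^ 2)⁻¹) s := by
      simpa using (hasDerivAt_inv hs.ne').ofReal_comp
    refine ⟨(hasDerivAt_log hs).mul H1, ?_, ?_⟩
    · refine ((hinv.fun_mul H1).fun_add ((hasDerivAt_log hs).fun_mul H2)).congr_deriv ?_
      ring
    · beta_reduce
      rw [← H3]
      field_simp
      ring

/-- The factor `s^{-ν}` exchanges the equations of orders `-ν` and `ν`. -/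
lemma rpow_mul (hh : RadialEquation (-ν) κ h h₁ f) :
    RadialEquation ν κ (fun s => ((s ^ (-ν) : ℝ) : ℂ) * h s)
      (fun s => (-ν * s ^ (-ν - 1) : ℝ) * h s + ((s ^ (-ν) : ℝ) : ℂ) * h₁ s)
      fun s => ((s ^ (-ν) : ℝ) : ℂ) * f s := by
  obtain ⟨hs, h₂, H⟩ := hh
  have hd : ∀ (c : ℝ) {s : ℝ}, 0 < s →
      HasDerivAt (fun s : ℝ => ((s ^ c : ℝ) : ℂ)) ((c * s ^ (c - 1) : ℝ) : ℂ) s :=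
    fun c s hs => (Real.hasDerivAt_rpow_const (Or.inl hs.ne')).ofReal_comp
  refine ⟨?_, fun s => (-ν * ((-ν - 1) * s ^ (-ν - 1 - 1)) : ℝ) * h s +
    2 * ((-ν * s ^ (-ν - 1) : ℝ) * h₁ s) + ((s ^ (-ν) : ℝ) : ℂ) * h₂ s, fun s hs => ?_⟩
  · refine ContDiffOn.mul (Complex.ofRealCLM.contDiff.comp_contDiffOn ?_) hs
    exact fun s hs => (Real.contDiffAt_rpow_const_of_ne (ne_of_gt hs)).contDiffWithinAt
  · obtain ⟨H1, H2, H3⟩ := H s hs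
    have hs' : (s : ℂ) ≠ 0 := by exact_mod_cast hs.ne'
    have hc : HasDerivAt (fun s : ℝ => ((-ν * s ^ (-ν - 1) : ℝ) : ℂ))
        ((-ν * ((-ν - 1) * s ^ (-ν - 1 - 1)) : ℝ) : ℂ) s := by
      simpa using (hd (-ν - 1) hs).const_mul ((-ν : ℝ) : ℂ)
    refine ⟨(hd (-ν) hs).mul H1, ?_, ?_⟩
    · refine ((hc.fun_mul H1).fun_add ((hd (-ν) hs).fun_mul H2)).congr_deriv ?_
      ring
    · beta_reduce
      rw [← H3, Real.rpow_sub_one hs.ne' (-ν - 1), Real.rpow_sub_one hs.ne' (-ν)]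
      push_cast
      field_simp
      ring

end RadialEquation

/-- The coefficients of an everywhere convergent power series. -/
def EntireCoeff (a : ℕ → ℂ) : Prop := ∀ R : ℝ, 0 ≤ R → Summable fun j => ‖a j‖ * R ^ j

namespace EntireCoeff

variable {a b : ℕ → ℂ}

lemma summable (ha : EntireCoeff a) (z : ℂ) : Summable fun j => a j * z ^ j :=
  Summable.of_norm (by simpa using ha ‖z‖ (norm_nonneg z))

/-- A factor of polynomial growth, here `j + 1`, does not affect the convergence. -/
lemma of_norm_le (ha : EntireCoeff a) {C : ℝ} (h : ∀ j, ‖b j‖ ≤ C * ((j + 1) * ‖a j‖)) :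
    EntireCoeff b := by
  intro R hR
  refine Summable.of_nonneg_of_le (fun j => by positivity) (fun j => ?_)
    ((ha (2 * R) (by positivity)).mul_left |C|)
  have h2 : ((j : ℝ) + 1) ≤ 2 ^ j := by exact_mod_cast Nat.lt_two_pow_self (n := j)
  calc ‖b j‖ * R ^ j ≤ (C * ((j + 1) * ‖a j‖)) * R ^ j := by gcongr; exact h j
    _ ≤ (|C| * (2 ^ j * ‖a j‖)) * R ^ j := by
        gcongr
        exact le_abs_self C
    _ = |C| * (‖a j‖ * (2 * R) ^ j) := by rw [mul_pow]; ring

lemma succ (ha : EntireCoeff a) : EntireCoeff fun j => a (j + 1) := by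
  intro R hR
  have h1 := (summable_nat_add_iff 1).mpr (ha (R + 1) (by positivity))
  refine Summable.of_nonneg_of_le (fun j => by positivity) (fun j => ?_) h1
  gcongr
  calc R ^ j ≤ (R + 1) ^ j := by gcongr; linarith
    _ ≤ (R + 1) ^ (j + 1) := pow_le_pow_right₀ (by linarith) (Nat.le_succ j)

lemma derivCoeff (ha : EntireCoeff a) : EntireCoeff fun j => (j + 1) * a (j + 1) := by
  refine ha.succ.of_norm_le (C := 1) fun j => ?_
  rw [norm_mul, one_mul]
  gcongr
  have : ‖((j : ℂ) + 1)‖ = (j : ℝ) + 1 := by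
    have := Complex.norm_natCast (j + 1)
    push_cast at this
    exact this
  exact this.le

lemma hasDerivAt_tsum (ha : EntireCoeff a) (z : ℂ) :
    HasDerivAt (fun z : ℂ => ∑' j, a j * z ^ j)
      (∑' j : ℕ, ((j : ℂ) + 1) * a (j + 1) * z ^ j) z := by
  have hsum : Summable fun j : ℕ => ‖(j : ℂ) * a j‖ * (‖z‖ + 1) ^ (j - 1) := by
    rw [← summable_nat_add_iff 1]
    simpa using ha.derivCoeff (‖z‖ + 1) (by positivity)
  have h := hasDerivAt_tsum_of_isPreconnected (t := Metric.ball (0 : ℂ) (‖z‖ + 1))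
    (g := fun j z => a j * z ^ j) (g' := fun j z => a j * (j * z ^ (j - 1))) (y₀ := 0) (y := z)
    hsum Metric.isOpen_ball (convex_ball _ _).isPreconnected
    (fun j y _ => (hasDerivAt_pow j y).const_mul _) (fun j y hy => ?_)
    (by simpa using (by positivity : 0 < ‖z‖ + 1)) (ha.summable 0) (by simp)
  · refine h.congr_deriv ?_
    rw [Summable.tsum_eq_zero_add (f := fun j : ℕ => a j * (j * z ^ (j - 1)))]
    · simp only [Nat.cast_zero, zero_mul, mul_zero, zero_add]
      refine tsum_congr fun j => ?_
      push_cast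
      ring
    · rw [← summable_nat_add_iff 1]
      refine (ha.derivCoeff.summable z).congr fun j => ?_
      push_cast
      ring
  · have hy' : ‖y‖ ≤ ‖z‖ + 1 := by
      have := mem_ball_zero_iff.mp hy
      exact this.le
    calc ‖a j * (j * y ^ (j - 1))‖ = ‖(j : ℂ) * a j‖ * ‖y‖ ^ (j - 1) := by
          rw [← mul_assoc, norm_mul, norm_pow, mul_comm (a j)]
      _ ≤ _ := by gcongr

/-- The radial equation for power series. -/
lemma radialEquation (ha : EntireCoeff a) (ν : ℝ) (κ : ℂ)
    (hb : ∀ j : ℕ, ((j : ℂ) + 1) * (ν + j + 1) * a (j + 1) + κ * a j = b j) :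
    RadialEquation ν κ (fun s => ∑' j, a j * (s : ℂ) ^ j)
      (fun s => ∑' j : ℕ, ((j : ℂ) + 1) * a (j + 1) * (s : ℂ) ^ j)
      fun s => ∑' j, b j * (s : ℂ) ^ j := by
  refine ⟨?_, fun s => ∑' j : ℕ, ((j : ℂ) + 1) * (((j + 1 : ℕ) + 1) * a (j + 1 + 1)) * (s : ℂ) ^ j,
    fun s _ => ⟨(ha.hasDerivAt_tsum s).comp_ofReal, ?_, ?_⟩⟩
  · have h1 : Differentiable ℂ fun z : ℂ => ∑' j, a j * z ^ j :=
      fun z => (ha.hasDerivAt_tsum z).differentiableAt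
    exact ((h1.contDiff (n := ∞)).restrict_scalars ℝ |>.comp Complex.ofRealCLM.contDiff).contDiffOn
  · exact (ha.derivCoeff.hasDerivAt_tsum s).comp_ofReal
  · have hs2 := ha.derivCoeff.derivCoeff.summable s
    have hs1 := ha.derivCoeff.summable s
    have hs0 := ha.summable s
    have h2 : (s : ℂ) * ∑' j : ℕ, ((j : ℂ) + 1) * (((j + 1 : ℕ) + 1) * a (j + 1 + 1)) * (s : ℂ) ^ j
        = ∑' j : ℕ, (j : ℂ) * ((j + 1) * a (j + 1)) * (s : ℂ) ^ j := by
      rw [← tsum_mul_left, Summable.tsum_eq_zero_add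
        (f := fun j : ℕ => (j : ℂ) * ((j + 1) * a (j + 1)) * (s : ℂ) ^ j)]
      · simp only [Nat.cast_zero, zero_mul, zero_add]
        refine tsum_congr fun j => ?_
        push_cast
        ring
      · rw [← summable_nat_add_iff 1]
        refine (hs2.mul_left (s : ℂ)).congr fun j => ?_
        push_cast
        ring
    have hs2' : Summable fun j : ℕ => (j : ℂ) * ((j + 1) * a (j + 1)) * (s : ℂ) ^ j := by
      rw [← summable_nat_add_iff 1]
      refine (hs2.mul_left (s : ℂ)).congr fun j => ?_
      push_cast
      ring
    rw [h2, ← tsum_mul_left, ← tsum_mul_left, ← hs2'.tsum_add (hs1.mul_left _),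
      ← (hs2'.add (hs1.mul_left _)).tsum_add (hs0.mul_left _)]
    refine tsum_congr fun j => ?_
    rw [← hb j]
    ring

/-- The ratio test applies to the recurrence of the Bessel series. -/
lemma of_recurrence {ν : ℝ} {κ : ℂ}
    (h : ∀ j : ℕ, ((j : ℂ) + 1) * (ν + j + 1) * a (j + 1) + κ * a j = 0) : EntireCoeff a := by
  intro R hR
  refine summable_of_ratio_norm_eventually_le (r := 1 / 2) (by norm_num) ?_
  -- from this index on, `(j + 1) (ν + j + 1) ≥ 2 ‖κ‖ R`
  filter_upwards [eventually_ge_atTop (⌈|ν| + 2 * (‖κ‖ * R)⌉₊)] with j hj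
  have hj' : |ν| + 2 * (‖κ‖ * R) ≤ j := Nat.ceil_le.mp hj
  have hκ : 0 ≤ ‖κ‖ * R := by positivity
  have h1 : 1 ≤ ν + j + 1 := by
    have := neg_abs_le ν
    linarith
  have h2 : ‖((j : ℂ) + 1) * (ν + j + 1)‖ = ((j : ℝ) + 1) * (ν + j + 1) := by
    have : ((j : ℂ) + 1) * (ν + j + 1) = ((((j : ℝ) + 1) * (ν + j + 1) : ℝ) : ℂ) := by
      push_cast
      ring
    rw [this, Complex.norm_real, Real.norm_of_nonneg (by positivity)]
  have h3 : ((j : ℝ) + 1) * (ν + j + 1) * ‖a (j + 1)‖ = ‖κ‖ * ‖a j‖ := by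
    rw [← h2, ← norm_mul, eq_neg_of_add_eq_zero_left (h j), norm_neg, norm_mul]
  have h4 : ‖a (j + 1)‖ * (2 * (‖κ‖ * R)) ≤ ‖κ‖ * ‖a j‖ := by
    rw [← h3, mul_comm]
    refine mul_le_mul_of_nonneg_right ?_ (norm_nonneg _)
    have := abs_nonneg ν
    nlinarith
  rw [Real.norm_of_nonneg (by positivity), Real.norm_of_nonneg (by positivity), pow_succ]
  rcases eq_or_ne κ 0 with rfl | hκ0
  · have : ‖a (j + 1)‖ = 0 := by
      rw [norm_zero, zero_mul] at h3
      exact (mul_eq_zero.mp h3).resolve_left (by positivity)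
    rw [this]
    simp only [zero_mul]
    positivity
  · have hκp : 0 < ‖κ‖ := norm_pos_iff.mpr hκ0
    have h5 : ‖a (j + 1)‖ * R ≤ 1 / 2 * ‖a j‖ := by
      refine le_of_mul_le_mul_left ?_ hκp
      linarith
    calc ‖a (j + 1)‖ * (R ^ j * R) = (‖a (j + 1)‖ * R) * R ^ j := by ring
      _ ≤ (1 / 2 * ‖a j‖) * R ^ j := by gcongr
      _ = _ := by ring

end EntireCoeff

end RadialEquation

/-! ### Hankel functions and the fundamental solution -/

section Hankel

open Set Filter Topology

/-- The coefficients of `J_ν(z) (z/2)^{-ν}` as a power series in `s`, where `z² = 4 κ s`. -/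
def besselCoeff (ν : ℝ) (κ : ℂ) (j : ℕ) : ℂ :=
  (-κ) ^ j / ((j.factorial : ℂ) * Complex.Gamma ((ν : ℂ) + j + 1))

lemma besselCoeff_recurrence {ν : ℝ} (hν : ∀ j : ℕ, ν + j + 1 ≠ 0) (κ : ℂ) (j : ℕ) :
    ((j : ℂ) + 1) * (ν + j + 1) * besselCoeff ν κ (j + 1) + κ * besselCoeff ν κ j = 0 := by
  have h1 : (ν : ℂ) + j + 1 ≠ 0 := by exact_mod_cast hν j
  have h2 : (ν : ℂ) + (j + 1 : ℕ) + 1 = ((ν : ℂ) + j + 1) + 1 := by push_cast; ring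
  have h3 : ((j : ℂ) + 1) ≠ 0 := by exact_mod_cast j.succ_ne_zero
  rw [besselCoeff, besselCoeff, h2, Complex.Gamma_add_one _ h1, Nat.factorial_succ]
  generalize Complex.Gamma ((ν : ℂ) + j + 1) = g
  push_cast
  rcases eq_or_ne g 0 with rfl | hg
  · simp
  · have : (j.factorial : ℂ) ≠ 0 := by exact_mod_cast j.factorial_ne_zero
    field_simp
    ring

/-- The argument of `r z` is that of `z`, so that no branch of the power is crossed. -/
lemma ofReal_mul_cpow {r : ℝ} (hr : 0 < r) {z : ℂ} (hz : z ≠ 0) (c : ℝ) :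
    ((r : ℂ) * z) ^ (c : ℂ) = ((r ^ c : ℝ) : ℂ) * z ^ (c : ℂ) := by
  have hr' : (r : ℂ) ≠ 0 := by exact_mod_cast hr.ne'
  rw [Complex.cpow_def_of_ne_zero (mul_ne_zero hr' hz), Complex.log_ofReal_mul hr hz, add_mul,
    Complex.exp_add, Complex.ofReal_log hr.le, ← Complex.cpow_def_of_ne_zero hr',
    ← Complex.cpow_def_of_ne_zero hz, Complex.ofReal_cpow hr.le]

lemma besselJ_mul_eq (ν : ℝ) {k : ℂ} (hk : k ≠ 0) {r : ℝ} (hr : 0 < r) :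
    besselJ ν (k * r) = ((r ^ ν : ℝ) : ℂ) * (k / 2) ^ (ν : ℂ) *
      ∑' j, besselCoeff ν (k ^ 2 / 4) j * ((r ^ 2 : ℝ) : ℂ) ^ j := by
  have h1 : k * r / 2 = (r : ℂ) * (k / 2) := by ring
  rw [besselJ, h1, ofReal_mul_cpow hr (by simpa using hk)]
  congr 1
  refine tsum_congr fun j => ?_
  rw [besselCoeff, div_mul_eq_mul_div, ← mul_pow]
  congr 2
  push_cast
  ring

/-- The Hankel function of a non-integer order solves the radial equation: it is a combination of
the Bessel functions of orders `ν` and `-ν`. -/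
lemma exists_radialEquation_of_ne_floor {ν : ℝ} (hν0 : 0 ≤ ν) (hν : ν ≠ (⌊ν⌋₊ : ℝ)) {k : ℂ}
    (hk : k ≠ 0) :
    ∃ h h₁ : ℝ → ℂ, RadialEquation ν (k ^ 2 / 4) h h₁ (fun _ => 0) ∧ ∀ r : ℝ, 0 < r →
      Complex.I / 4 * (k / (2 * Real.pi * r)) ^ (ν : ℂ) * hankelOne ν (k * r) = h (r ^ 2) := by
  have hpos : ∀ j : ℕ, ν + j + 1 ≠ 0 := fun j => by positivity
  have hneg : ∀ j : ℕ, -ν + j + 1 ≠ 0 := by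
    intro j hj
    have : ν = ((j + 1 : ℕ) : ℝ) := by push_cast; linarith
    rw [this, Nat.floor_natCast] at hν
    exact hν rfl
  have R1 := (EntireCoeff.of_recurrence (besselCoeff_recurrence hpos (k ^ 2 / 4))).radialEquation
    ν _ (besselCoeff_recurrence hpos (k ^ 2 / 4))
  have R2 := ((EntireCoeff.of_recurrence (besselCoeff_recurrence hneg (k ^ 2 / 4))).radialEquation
    (-ν) _ (besselCoeff_recurrence hneg (k ^ 2 / 4))).rpow_mul
  have hpi : (Real.pi : ℂ) ≠ 0 := by exact_mod_cast Real.pi_ne_zero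
  have hk2 : k / (2 * Real.pi) ≠ 0 := by simp [hk, hpi]
  refine ⟨_, _, ((R1.const_mul (Complex.I / 4 * (k / (2 * Real.pi)) ^ (ν : ℂ) * (k / 2) ^ (ν : ℂ) *
    (1 + Complex.I * (Real.cos (ν * Real.pi) / Real.sin (ν * Real.pi))))).add
    (R2.const_mul (-(Complex.I / 4 * (k / (2 * Real.pi)) ^ (ν : ℂ) * (k / 2) ^ ((-ν : ℝ) : ℂ) *
      Complex.I / Real.sin (ν * Real.pi))))).congr (fun s _ => rfl) (fun s _ => by simp), ?_⟩
  intro r hr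
  have h1 : k / (2 * Real.pi * r) = ((r⁻¹ : ℝ) : ℂ) * (k / (2 * Real.pi)) := by
    push_cast
    field_simp
  have h2 : (r⁻¹) ^ ν * r ^ ν = 1 := by
    rw [← Real.mul_rpow (by positivity) hr.le, inv_mul_cancel₀ hr.ne', Real.one_rpow]
  have h3 : (r⁻¹) ^ ν * r ^ (-ν) = (r ^ 2) ^ (-ν) := by
    rw [Real.inv_rpow hr.le, ← Real.rpow_neg hr.le, ← Real.mul_rpow hr.le hr.le, pow_two]
  have h2' := congrArg Complex.ofReal h2
  rw [hankelOne, besselY, if_neg hν, besselJ_mul_eq ν hk hr, besselJ_mul_eq (-ν) hk hr, h1,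
    ofReal_mul_cpow (inv_pos.mpr hr) hk2, ← h3]
  push_cast at h2' ⊢
  generalize (k / (2 * Real.pi)) ^ (ν : ℂ) = c1
  generalize (∑' j, besselCoeff ν (k ^ 2 / 4) j * ((r : ℂ) ^ 2) ^ j) = F1
  generalize (∑' j, besselCoeff (-ν) (k ^ 2 / 4) j * ((r : ℂ) ^ 2) ^ j) = F2
  linear_combination (Complex.I / 4 * c1 * (k / 2) ^ (ν : ℂ) * F1 *
    (1 + Complex.I * (Complex.cos (ν * Real.pi) / Complex.sin (ν * Real.pi)))) * h2'

lemma abs_digammaSucc_le (j : ℕ) : |digammaSucc j| ≤ j + 1 := by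
  have h1 : ((harmonic j : ℚ) : ℝ) ≤ j := by
    have : harmonic j ≤ j := by
      rw [harmonic]
      calc ∑ i ∈ Finset.range j, ((i + 1 : ℕ) : ℚ)⁻¹ ≤ ∑ i ∈ Finset.range j, (1 : ℚ) := by
            refine Finset.sum_le_sum fun i _ => inv_le_one_of_one_le₀ ?_
            exact_mod_cast Nat.le_add_left 1 i
        _ = j := by simp
    exact_mod_cast this
  have h2 : (0 : ℝ) ≤ ((harmonic j : ℚ) : ℝ) := by
    have : 0 ≤ harmonic j := by
      rw [harmonic]
      exact Finset.sum_nonneg fun i _ => by positivity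
    exact_mod_cast this
  have h3 := Real.eulerMascheroniConstant_lt_two_thirds
  have h4 := Real.one_half_lt_eulerMascheroniConstant
  rw [digammaSucc, abs_le]
  constructor <;> linarith

lemma digammaSucc_succ (j : ℕ) : digammaSucc (j + 1) = digammaSucc j + ((j : ℝ) + 1)⁻¹ := by
  rw [digammaSucc, digammaSucc, harmonic_succ]
  push_cast
  ring

/-- The coefficients of the series in the Bessel function of the second kind. -/
def neumannCoeff (l : ℕ) (κ : ℂ) (j : ℕ) : ℂ :=
  ((digammaSucc j + digammaSucc (l + j) : ℝ) : ℂ) * besselCoeff l κ j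

lemma besselCoeff_natCast (l : ℕ) (κ : ℂ) (j : ℕ) :
    besselCoeff l κ j = (-κ) ^ j / ((j.factorial : ℂ) * (l + j).factorial) := by
  rw [besselCoeff, ← Complex.Gamma_nat_eq_factorial (l + j)]
  push_cast
  rfl

/-- The right-hand side is the one produced by the logarithm, see `RadialEquation.log_mul`. -/
lemma neumannCoeff_recurrence (l : ℕ) (κ : ℂ) (j : ℕ) :
    ((j : ℂ) + 1) * (((l : ℝ) : ℂ) + j + 1) * neumannCoeff l κ (j + 1) + κ * neumannCoeff l κ j =
      (2 * (j + 1) + l) * besselCoeff l κ (j + 1) := by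
  have h := besselCoeff_recurrence (ν := l) (fun j => by positivity) κ j
  have h1 : ((j : ℂ) + 1) ≠ 0 := by exact_mod_cast j.succ_ne_zero
  have h2 : ((l : ℂ) + j + 1) ≠ 0 := by exact_mod_cast (l + j).succ_ne_zero
  rw [neumannCoeff, neumannCoeff, ← add_assoc l j 1, digammaSucc_succ, digammaSucc_succ]
  push_cast at h ⊢
  have h3 : ((j : ℂ) + 1) * (l + j + 1) * (((j : ℂ) + 1)⁻¹ + ((l : ℂ) + j + 1)⁻¹) =
      2 * (j + 1) + l := by
    field_simp
    ring
  linear_combination ((digammaSucc j : ℂ) + digammaSucc (l + j)) * h +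
    besselCoeff l κ (j + 1) * h3

lemma entireCoeff_neumannCoeff (l : ℕ) (κ : ℂ) : EntireCoeff (neumannCoeff l κ) := by
  refine (EntireCoeff.of_recurrence
    (besselCoeff_recurrence (ν := l) (fun j => by positivity) κ)).of_norm_le (C := l + 2)
    fun j => ?_
  rw [neumannCoeff, norm_mul, Complex.norm_real, ← mul_assoc]
  gcongr
  have h1 := abs_digammaSucc_le j
  have h2 := abs_digammaSucc_le (l + j)
  push_cast at h2
  have hl : (0 : ℝ) ≤ l := Nat.cast_nonneg l
  have hj : (0 : ℝ) ≤ j := Nat.cast_nonneg j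
  calc ‖digammaSucc j + digammaSucc (l + j)‖ ≤ |digammaSucc j| + |digammaSucc (l + j)| :=
        abs_add_le _ _
    _ ≤ (l + 2) * (j + 1) := by nlinarith [mul_nonneg hl hj]

/-- The coefficients of the polar part of the Bessel function of the second kind. -/
def polarCoeff (l : ℕ) (κ : ℂ) (j : ℕ) : ℂ :=
  if j < l then ((l - j - 1).factorial : ℂ) / j.factorial * κ ^ j else 0

lemma entireCoeff_polarCoeff (l : ℕ) (κ : ℂ) : EntireCoeff (polarCoeff l κ) := by
  intro R _
  refine summable_of_ne_finset_zero (s := Finset.range l) fun j hj => ?_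
  rw [polarCoeff, if_neg (by simpa using hj)]
  simp

lemma polarCoeff_recurrence (l : ℕ) (κ : ℂ) (j : ℕ) :
    ((j : ℂ) + 1) * (((-(l : ℝ) : ℝ) : ℂ) + j + 1) * polarCoeff l κ (j + 1) +
      κ * polarCoeff l κ j = if j + 1 = l then κ ^ l / (l - 1).factorial else 0 := by
  have h1 : ((j : ℂ) + 1) ≠ 0 := by exact_mod_cast j.succ_ne_zero
  have h2 : (j.factorial : ℂ) ≠ 0 := by exact_mod_cast j.factorial_ne_zero
  rcases lt_trichotomy (j + 1) l with h | h | h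
  · obtain ⟨d, rfl⟩ : ∃ d, l = j + 2 + d := ⟨l - (j + 2), by omega⟩
    rw [polarCoeff, polarCoeff, if_pos h, if_pos (by omega), if_neg (by omega),
      show j + 2 + d - (j + 1) - 1 = d by omega, show j + 2 + d - j - 1 = d + 1 by omega,
      Nat.factorial_succ, Nat.factorial_succ]
    push_cast
    field_simp
    ring
  · subst h
    rw [polarCoeff, polarCoeff, if_neg (by omega), if_pos (by omega), if_pos rfl,
      show j + 1 - j - 1 = 0 by omega, show j + 1 - 1 = j by omega]
    simp only [Nat.factorial_zero, Nat.cast_one]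
    ring
  · rw [polarCoeff, polarCoeff, if_neg (by omega), if_neg (by omega), if_neg (by omega)]
    simp

/-- The logarithmic terms of the Bessel function of the second kind of integer order solve the
radial equation: the polar part cancels the term `1/s` left by the logarithm. -/
lemma radialEquation_neumann (l : ℕ) (κ : ℂ) :
    ∃ h₁ : ℝ → ℂ, RadialEquation l κ (fun s : ℝ =>
      (κ / Real.pi) ^ l * ((Real.log s : ℂ) * ∑' j, besselCoeff l κ j * (s : ℂ) ^ j) +
      -((κ / Real.pi) ^ l) * (∑' j, neumannCoeff l κ j * (s : ℂ) ^ j) +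
      -((Real.pi : ℂ)⁻¹ ^ l) * (((s ^ (-(l : ℝ)) : ℝ) : ℂ) * ∑' j, polarCoeff l κ j * (s : ℂ) ^ j))
      h₁ (fun _ => 0) := by
  have hrec := besselCoeff_recurrence (ν := l) (fun j => by positivity) κ
  have hf := EntireCoeff.of_recurrence hrec
  have R2 := (hf.radialEquation l κ hrec).log_mul
  have R3 := (entireCoeff_neumannCoeff l κ).radialEquation l κ (neumannCoeff_recurrence l κ)
  have R4 := ((entireCoeff_polarCoeff l κ).radialEquation (-(l : ℝ)) κ
    (polarCoeff_recurrence l κ)).rpow_mul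
  refine ⟨_, (((R2.const_mul ((κ / Real.pi) ^ l)).add
    (R3.const_mul (-((κ / Real.pi) ^ l)))).add (R4.const_mul (-((Real.pi : ℂ)⁻¹ ^ l)))).congr
    (fun s _ => rfl) fun s hs => ?_⟩
  have hs' : (s : ℂ) ≠ 0 := by exact_mod_cast hs.ne'
  have hpi : (Real.pi : ℂ) ≠ 0 := by exact_mod_cast Real.pi_ne_zero
  have h0 : ∑' j, besselCoeff l κ j * (s : ℂ) ^ j = (l.factorial : ℂ)⁻¹ +
      s * ∑' j : ℕ, besselCoeff l κ (j + 1) * (s : ℂ) ^ j := by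
    rw [(hf.summable s).tsum_eq_zero_add, ← tsum_mul_left]
    congr 1
    · simp [besselCoeff_natCast]
    · refine tsum_congr fun j => ?_
      ring
  have h1 : ∑' j : ℕ, (2 * ((j : ℂ) + 1) + l) * besselCoeff l κ (j + 1) * (s : ℂ) ^ j =
      2 * (∑' j : ℕ, ((j : ℂ) + 1) * besselCoeff l κ (j + 1) * (s : ℂ) ^ j) +
        l * ∑' j : ℕ, besselCoeff l κ (j + 1) * (s : ℂ) ^ j := by
    rw [← tsum_mul_left, ← tsum_mul_left, ← ((hf.derivCoeff.summable s).mul_left _).tsum_add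
      ((hf.succ.summable s).mul_left _)]
    refine tsum_congr fun j => ?_
    ring
  -- the only term of the polar part that violates the homogeneous equation
  have h2 : ((s ^ (-(l : ℝ)) : ℝ) : ℂ) * ∑' j : ℕ,
      (if j + 1 = l then κ ^ l / (l - 1).factorial else 0) * (s : ℂ) ^ j =
      κ ^ l * (l * (l.factorial : ℂ)⁻¹ * (s : ℂ)⁻¹) := by
    rcases l with _ | d
    · simp
    · rw [tsum_eq_single d fun j hj => by
        rw [if_neg fun h => hj (Nat.succ_injective h), zero_mul], if_pos rfl,
        Real.rpow_neg hs.le, Real.rpow_natCast, Nat.factorial_succ, Nat.add_sub_cancel]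
      have hd : (d.factorial : ℂ) ≠ 0 := by exact_mod_cast d.factorial_ne_zero
      have hd' : (d : ℂ) + 1 ≠ 0 := by exact_mod_cast d.succ_ne_zero
      push_cast
      field_simp
      ring
  rw [h2, h1, h0]
  simp only [zero_mul, tsum_zero, mul_zero, zero_add, Complex.ofReal_natCast]
  rw [div_pow, inv_pow]
  field_simp
  ring

/-- The Hankel function of an integer order solves the radial equation. -/
lemma exists_radialEquation_natCast (l : ℕ) {k : ℂ} (hk : k ≠ 0) :
    ∃ h h₁ : ℝ → ℂ, RadialEquation l (k ^ 2 / 4) h h₁ (fun _ => 0) ∧ ∀ r : ℝ, 0 < r →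
      Complex.I / 4 * (k / (2 * Real.pi * r)) ^ ((l : ℝ) : ℂ) * hankelOne l (k * r) =
        h (r ^ 2) := by
  have hrec := besselCoeff_recurrence (ν := l) (fun j => by positivity) (k ^ 2 / 4)
  have R1 := (EntireCoeff.of_recurrence hrec).radialEquation l _ hrec
  obtain ⟨h₁, R2⟩ := radialEquation_neumann l (k ^ 2 / 4)
  have hpi : (Real.pi : ℂ) ≠ 0 := by exact_mod_cast Real.pi_ne_zero
  refine ⟨_, _, ((R1.const_mul (Complex.I / 4 * (k ^ 2 / 4 / Real.pi) ^ l *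
    (1 + Complex.I * (2 / Real.pi * Complex.log (k / 2))))).add
    (R2.const_mul (-1 / (4 * Real.pi)))).congr (fun s _ => rfl) (fun s _ => by simp), ?_⟩
  intro r hr
  have hr' : (r : ℂ) ≠ 0 := by exact_mod_cast hr.ne'
  have hF : ∑' j : ℕ, ((digammaSucc j + digammaSucc (l + j) : ℝ) : ℂ) *
      (-((k * r) ^ 2 / 4)) ^ j / ((j.factorial : ℂ) * (l + j).factorial) =
      ∑' j, neumannCoeff l (k ^ 2 / 4) j * ((r ^ 2 : ℝ) : ℂ) ^ j := by
    refine tsum_congr fun j => ?_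
    rw [neumannCoeff, besselCoeff_natCast, mul_div_assoc, mul_assoc, div_mul_eq_mul_div, ← mul_pow]
    congr 3
    push_cast
    ring
  have hP : ∑ j ∈ Finset.range l, ((l - j - 1).factorial : ℂ) / j.factorial *
      ((k * r) ^ 2 / 4) ^ j = ∑' j, polarCoeff l (k ^ 2 / 4) j * ((r ^ 2 : ℝ) : ℂ) ^ j := by
    rw [tsum_eq_sum (s := Finset.range l) fun j hj => by
      rw [polarCoeff, if_neg (by simpa using hj), zero_mul]]
    refine Finset.sum_congr rfl fun j hj => ?_
    rw [polarCoeff, if_pos (by simpa using hj), mul_assoc, ← mul_pow]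
    congr 2
    push_cast
    ring
  -- the logarithm of `k / 2` is absorbed in the coefficient of the regular solution
  have hlog : Complex.log (k * r / 2) = Complex.log (k / 2) + (Real.log (r ^ 2) : ℂ) / 2 := by
    rw [show k * r / 2 = (r : ℂ) * (k / 2) by ring, Complex.log_ofReal_mul hr (by simpa using hk),
      Real.log_pow]
    push_cast
    ring
  rw [hankelOne, besselY, if_pos (by simp), Nat.floor_natCast, besselYNat, besselJ_mul_eq l hk hr,
    hF, hP, hlog, Real.rpow_neg (by positivity), Complex.ofReal_natCast, Complex.cpow_natCast,
    Complex.cpow_natCast, Real.rpow_natCast, Real.rpow_natCast, zpow_neg, zpow_natCast]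
  generalize (∑' j, besselCoeff l (k ^ 2 / 4) j * ((r ^ 2 : ℝ) : ℂ) ^ j) = F
  generalize (∑' j, neumannCoeff l (k ^ 2 / 4) j * ((r ^ 2 : ℝ) : ℂ) ^ j) = G
  generalize (∑' j, polarCoeff l (k ^ 2 / 4) j * ((r ^ 2 : ℝ) : ℂ) ^ j) = P
  have e1 : (k / (2 * Real.pi * r)) ^ l * ((k * r / 2) ^ l) = (k ^ 2 / 4 / Real.pi) ^ l := by
    rw [← mul_pow]
    congr 1
    field_simp
    ring
  have e2 : (k / (2 * Real.pi * r)) ^ l * ((k * r / 2) ^ l)⁻¹ =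
      (Real.pi : ℂ)⁻¹ ^ l * (((r : ℂ) ^ 2) ^ l)⁻¹ := by
    rw [← inv_pow, ← inv_pow, ← mul_pow, ← mul_pow]
    congr 1
    field_simp
  have e3 : (k * r / 2) ^ l = (r : ℂ) ^ l * (k / 2) ^ l := by
    rw [← mul_pow]
    congr 1
    ring
  push_cast
  rw [← e3]
  generalize (k / (2 * Real.pi * r)) ^ l = a at *
  generalize (k ^ 2 / 4 / Real.pi) ^ l = A at *
  generalize Complex.log (k / 2) = L
  have hI := Complex.I_sq
  linear_combination (Complex.I / 4 * (F + Complex.I * (2 / Real.pi *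
    (L + (Real.log (r ^ 2) : ℂ) / 2) * F - G / Real.pi))) * e1 -
    (Complex.I ^ 2 / 4 / Real.pi * P) * e2 +
    (F * A * Real.log (r ^ 2) - (Real.pi : ℂ)⁻¹ ^ l * (((r : ℂ) ^ 2) ^ l)⁻¹ * P - G * A) /
      (4 * Real.pi) * hI

/-- The fundamental solution is a radial function, smooth away from the origin, that solves the
Helmholtz equation there. -/
lemma exists_radialEquation_helmholtzKernel (m : ℕ) (hm : 1 ≤ m) (k : ℂ) (r₀ : ℝ) (hr₀ : 0 < r₀) :
    ∃ h h₁ : ℝ → ℂ, RadialEquation ((m + 1) / 2 - 1) (k ^ 2 / 4) h h₁ (fun _ => 0) ∧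
      ∀ X X' : E (m + 1), X ≠ X' → helmholtzKernel m k r₀ X X' = h (dist X X' ^ 2) := by
  have hm' : (1 : ℝ) ≤ m := by exact_mod_cast hm
  by_cases hk : k = 0
  · subst hk
    rw [zero_pow two_ne_zero, zero_div]
    by_cases hm1 : m = 1
    · subst hm1
      have R := (RadialEquation.const (ν := 0)).log_mul
      refine ⟨_, _, ((((RadialEquation.const (ν := ((1 : ℕ) + 1) / 2 - 1)).const_mul
        ((1 / (2 * Real.pi) * Real.log r₀ : ℝ) : ℂ))).add
        (RadialEquation.const_mul (ν := ((1 : ℕ) + 1) / 2 - 1) (by simpa using R)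
          (-(1 / (4 * Real.pi))))).congr (fun _ _ => rfl) (fun s _ => by simp), ?_⟩
      intro X X' hX
      have hd : dist X X' ≠ 0 := by simpa using hX
      rw [helmholtzKernel, if_neg (by simp), if_pos rfl, Real.log_div hr₀.ne' hd, Real.log_pow]
      push_cast
      ring
    · have R := ((RadialEquation.const (ν := -(((m : ℝ) + 1) / 2 - 1))).rpow_mul).const_mul
        ((1 / (((m + 1 : ℝ) - 2) * (μHE[m] (Metric.sphere (0 : E (m + 1)) 1)).toReal) : ℝ) : ℂ)
      refine ⟨_, _, R.congr (fun _ _ => rfl) (fun s _ => by simp), ?_⟩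
      intro X X' hX
      have hd : 0 < dist X X' := dist_pos.mpr hX
      rw [helmholtzKernel, if_neg (by simp), if_neg (by omega), ← Real.rpow_natCast (dist X X') 2,
        ← Real.rpow_mul hd.le, ← Real.rpow_intCast]
      push_cast
      rw [mul_one]
      congr 3
      ring
  · have hν0 : (0 : ℝ) ≤ (m + 1) / 2 - 1 := by linarith
    have key : ∃ h h₁ : ℝ → ℂ, RadialEquation ((m + 1) / 2 - 1) (k ^ 2 / 4) h h₁ (fun _ => 0) ∧
        ∀ r : ℝ, 0 < r → Complex.I / 4 *
          (k / (2 * Real.pi * r)) ^ ((((m : ℝ) + 1) / 2 - 1 : ℝ) : ℂ) * hankelOne ((m + 1) / 2 - 1) (k * r) =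
            h (r ^ 2) := by
      by_cases hν : ((m : ℝ) + 1) / 2 - 1 = (⌊((m : ℝ) + 1) / 2 - 1⌋₊ : ℝ)
      · rw [hν]
        exact exists_radialEquation_natCast _ hk
      · exact exists_radialEquation_of_ne_floor hν0 hν hk
    obtain ⟨h, h₁, R, H⟩ := key
    refine ⟨h, h₁, R, fun X X' hX => ?_⟩
    rw [helmholtzKernel, if_pos hk, ← H _ (dist_pos.mpr hX)]

end Hankel

/-! ### The kernel as a function of the difference -/

section Radial

/-- `g` is smooth away from the origin. Its value at the origin is irrelevant. -/
def SmoothOff {n : ℕ} (g : E n → ℂ) : Prop := ∀ x, x ≠ 0 → ContDiffAt ℝ ∞ g x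

lemma SmoothOff.fderiv_apply {n : ℕ} {g : E n → ℂ} (hg : SmoothOff g) (v : E n) :
    SmoothOff fun x => fderiv ℝ g x v := fun x hx =>
  ((hg x hx).fderiv_right (m := ∞) (by simp)).clm_apply contDiffAt_const

/-- The fundamental solution is a function of `X' - X` that is smooth and satisfies the Helmholtz
equation away from the origin. -/
lemma exists_smoothOff_helmholtzKernel (m : ℕ) (hm : 1 ≤ m) (k : ℂ) (r₀ : ℝ) (hr₀ : 0 < r₀) :
    ∃ g : E (m + 1) → ℂ, SmoothOff g ∧
      (∀ x, x ≠ 0 → ∑ j, fderiv ℝ (fun y => fderiv ℝ g y (basisVec (m + 1) j)) x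
        (basisVec (m + 1) j) = -k ^ 2 * g x) ∧
      ∀ X X' : E (m + 1), X ≠ X' → helmholtzKernel m k r₀ X X' = g (X' - X) := by
  obtain ⟨h, h₁, ⟨hs, h₂, H⟩, hk⟩ := exists_radialEquation_helmholtzKernel m hm k r₀ hr₀
  have hpos : ∀ x : E (m + 1), x ≠ 0 → 0 < ‖x‖ ^ 2 := fun x hx => by positivity
  have hn : ∀ x : E (m + 1), HasFDerivAt (fun y : E (m + 1) => ‖y‖ ^ 2) (2 • innerSL ℝ x) x :=
    fun x => (hasStrictFDerivAt_norm_sq x).hasFDerivAt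
  have hd1 : ∀ x : E (m + 1), x ≠ 0 → ∀ v, fderiv ℝ (fun y : E (m + 1) => h (‖y‖ ^ 2)) x v =
      ((2 * inner ℝ x v : ℝ) : ℂ) * h₁ (‖x‖ ^ 2) := by
    intro x hx v
    have := (H _ (hpos x hx)).1.hasFDerivAt.comp x (hn x)
    rw [show (fun y : E (m + 1) => h (‖y‖ ^ 2)) = h ∘ fun y => ‖y‖ ^ 2 from rfl, this.fderiv]
    simp
    ring
  refine ⟨fun x => h (‖x‖ ^ 2), fun x hx => ?_, fun x hx => ?_, fun X X' hX => ?_⟩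
  · exact ((hs.contDiffAt (Ioi_mem_nhds (hpos x hx))).comp x (contDiff_norm_sq ℝ).contDiffAt)
  · have hd2 : ∀ v : E (m + 1),
        fderiv ℝ (fun y => fderiv ℝ (fun y : E (m + 1) => h (‖y‖ ^ 2)) y v) x v =
        ((2 * inner ℝ v v : ℝ) : ℂ) * h₁ (‖x‖ ^ 2) +
          ((4 * (inner ℝ x v * inner ℝ x v) : ℝ) : ℂ) * h₂ (‖x‖ ^ 2) := by
      intro v
      have hev : (fun y => fderiv ℝ (fun y : E (m + 1) => h (‖y‖ ^ 2)) y v) =ᶠ[nhds x]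
          fun y => ((2 * inner ℝ y v : ℝ) : ℂ) * h₁ (‖y‖ ^ 2) :=
        (isOpen_ne.eventually_mem hx).mono fun y hy => hd1 y hy v
      have e1 : HasFDerivAt (fun y : E (m + 1) => h₁ (‖y‖ ^ 2)) _ x :=
        (H _ (hpos x hx)).2.1.hasFDerivAt.comp x (hn x)
      have e2 : HasFDerivAt (fun y : E (m + 1) => ((2 * inner ℝ y v : ℝ) : ℂ))
          (Complex.ofRealCLM ∘L ((2 : ℝ) • innerSL ℝ v)) x := by
        have : (fun y : E (m + 1) => ((2 * inner ℝ y v : ℝ) : ℂ)) =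
            Complex.ofRealCLM ∘L ((2 : ℝ) • innerSL ℝ v) := by
          funext y
          simp [real_inner_comm]
        rw [this]
        exact ContinuousLinearMap.hasFDerivAt _
      rw [hev.fderiv_eq, (e2.fun_mul e1).fderiv]
      simp
      ring
    simp_rw [hd2]
    rw [Finset.sum_add_distrib, ← Finset.sum_mul, ← Finset.sum_mul, ← Complex.ofReal_sum,
      ← Complex.ofReal_sum, ← Finset.mul_sum, ← Finset.mul_sum]
    have e1 : ∑ j, inner ℝ x (basisVec (m + 1) j) * inner ℝ x (basisVec (m + 1) j) = ‖x‖ ^ 2 := by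
      rw [← real_inner_self_eq_norm_sq]
      convert (EuclideanSpace.basisFun (Fin (m + 1)) ℝ).sum_inner_mul_inner x x using 2 with j
      rw [real_inner_comm x]
    have e2 : ∑ j, inner ℝ (basisVec (m + 1) j) (basisVec (m + 1) j) = (m : ℝ) + 1 := by
      simp
    rw [e1, e2]
    have := (H _ (hpos x hx)).2.2
    push_cast at this ⊢
    linear_combination 4 * this
  · rw [hk X X' hX, dist_comm, dist_eq_norm]

end Radial

/-! ### Layer potentials of vector-valued densities -/

section Layer

open Set Filter Topology

variable {m : ℕ} {Ω : Set (E (m + 1))} {F : Type*} [NormedAddCommGroup F] [NormedSpace ℝ F]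
  [NormedSpace ℂ F]

/-- The single-layer potential `∫ g(X' - X) A(X)` of a density on the boundary. -/
def layer (Ω : Set (E (m + 1))) (g : E (m + 1) → ℂ) (A : E (m + 1) → F) (X' : E (m + 1)) : F :=
  ∫ X in frontier Ω, g (X' - X) • A X ∂(μHE[m] : Measure (E (m + 1)))

lemma sub_ne_zero_of_mem_frontier (hΩ : IsOpen Ω) {X X' : E (m + 1)} (hX : X ∈ frontier Ω)
    (hX' : X' ∈ Ω) : X' - X ≠ 0 := by
  intro h
  rw [sub_eq_zero.mp h] at hX'
  have := hΩ.frontier_eq ▸ hX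
  exact this.2 hX'

lemma continuousOn_kernel (hΩ : IsOpen Ω) {G : Type*} [TopologicalSpace G] {g : E (m + 1) → G}
    (hg : ∀ x, x ≠ 0 → ContinuousAt g x) {X' : E (m + 1)} (hX' : X' ∈ Ω) :
    ContinuousOn (fun X => g (X' - X)) (frontier Ω) := fun X hX =>
  ((hg _ (sub_ne_zero_of_mem_frontier hΩ hX hX')).comp (f := fun X => X' - X)
    (by fun_prop)).continuousWithinAt

lemma SmoothOff.integrableOn {g : E (m + 1) → ℂ} (hg : SmoothOff g) (hΩ : IsOpen Ω)
    (hbdd : Bornology.IsBounded Ω) (hΩs : HasSmoothBoundary Ω) {A : E (m + 1) → F}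
    (hA : Continuous A) {X' : E (m + 1)} (hX' : X' ∈ Ω) :
    IntegrableOn (fun X => g (X' - X) • A X) (frontier Ω) (μHE[m] : Measure (E (m + 1))) :=
  integrableOn_frontier hΩ hbdd hΩs
    ((continuousOn_kernel hΩ (fun x hx => (hg x hx).continuousAt) hX').smul hA.continuousOn)

/-- Differentiation under the integral sign. The derivative of the kernel is bounded as long as `X'`
stays in a compact neighbourhood of `X₀` in `Ω`. -/
lemma hasFDerivAt_layer [IsScalarTower ℝ ℂ F] (hΩ : IsOpen Ω) (hbdd : Bornology.IsBounded Ω)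
    (hΩs : HasSmoothBoundary Ω) {g : E (m + 1) → ℂ} (hg : SmoothOff g) {A : E (m + 1) → F}
    (hA : Continuous A) {X₀ : E (m + 1)} (hX₀ : X₀ ∈ Ω) :
    HasFDerivAt (layer Ω g A)
      (∫ X in frontier Ω, (ContinuousLinearMap.lsmul ℝ ℂ).flip (A X) ∘L fderiv ℝ g (X₀ - X)
        ∂(μHE[m] : Measure (E (m + 1)))) X₀ := by
  obtain ⟨ε, hε, hball⟩ := Metric.nhds_basis_closedBall.mem_iff.mp (hΩ.mem_nhds hX₀)
  have hcpt := isCompact_frontier_of_isBounded hbdd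
  have hfin := euclideanHausdorffMeasure_frontier_lt_top hΩ hbdd hΩs
  have hdc : ∀ x : E (m + 1), x ≠ 0 → ContinuousAt (fderiv ℝ g) x := fun x hx =>
    ((hg x hx).fderiv_right (m := 0) (by simp)).continuousAt
  obtain ⟨M, hM⟩ := ((isCompact_closedBall X₀ ε).prod hcpt).exists_bound_of_continuousOn
    (f := fun z : E (m + 1) × E (m + 1) =>
      (ContinuousLinearMap.lsmul ℝ ℂ).flip (A z.2) ∘L fderiv ℝ g (z.1 - z.2)) (by
      intro z hz
      have h1 := sub_ne_zero_of_mem_frontier hΩ hz.2 (hball hz.1)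
      have h2 : ContinuousAt (fun z : E (m + 1) × E (m + 1) => fderiv ℝ g (z.1 - z.2)) z :=
        (hdc _ h1).comp (f := fun z : E (m + 1) × E (m + 1) => z.1 - z.2) (by fun_prop)
      have h3 : ContinuousAt (fun z : E (m + 1) × E (m + 1) =>
          (ContinuousLinearMap.lsmul ℝ ℂ (E := F)).flip (A z.2)) z := by fun_prop
      exact (h3.clm_comp h2).continuousWithinAt)
  refine hasFDerivAt_integral_of_dominated_of_fderiv_le (s := Metric.closedBall X₀ ε)
    (bound := fun _ => M) (F' := fun X' X =>
      (ContinuousLinearMap.lsmul ℝ ℂ).flip (A X) ∘L fderiv ℝ g (X' - X))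
    (Metric.closedBall_mem_nhds X₀ hε) ?_ ?_ ?_ ?_ ?_ ?_
  · filter_upwards [hΩ.mem_nhds hX₀] with X' hX'
    exact (hg.integrableOn hΩ hbdd hΩs hA hX').aestronglyMeasurable
  · exact hg.integrableOn hΩ hbdd hΩs hA hX₀
  · refine (ContinuousOn.aestronglyMeasurable_of_isCompact ?_ hcpt isClosed_frontier.measurableSet)
    exact ((ContinuousLinearMap.lsmul ℝ ℂ (E := F)).flip.continuous.comp hA).continuousOn.clm_comp
      (continuousOn_kernel hΩ hdc hX₀)
  · filter_upwards [ae_restrict_mem isClosed_frontier.measurableSet] with X hX X' hX'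
    exact hM (X', X) ⟨hX', hX⟩
  · exact integrableOn_const hfin.ne
  · filter_upwards [ae_restrict_mem isClosed_frontier.measurableSet] with X hX X' hX'
    have h1 := sub_ne_zero_of_mem_frontier hΩ hX (hball hX')
    have h2 : HasFDerivAt (fun X' => g (X' - X)) (fderiv ℝ g (X' - X)) X' :=
      (hasFDerivAt_comp_sub X).mpr ((hg _ h1).differentiableAt (by simp)).hasFDerivAt
    exact ((ContinuousLinearMap.lsmul ℝ ℂ).flip (A X)).hasFDerivAt.comp X' h2

lemma fderiv_layer [IsScalarTower ℝ ℂ F] [CompleteSpace F] (hΩ : IsOpen Ω)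
    (hbdd : Bornology.IsBounded Ω) (hΩs : HasSmoothBoundary Ω) {g : E (m + 1) → ℂ}
    (hg : SmoothOff g) {A : E (m + 1) → F} (hA : Continuous A) {X₀ : E (m + 1)} (hX₀ : X₀ ∈ Ω) (v : E (m + 1)) :
    fderiv ℝ (layer Ω g A) X₀ v = layer Ω (fun x => fderiv ℝ g x v) A X₀ := by
  rw [(hasFDerivAt_layer hΩ hbdd hΩs hg hA hX₀).fderiv, ContinuousLinearMap.integral_apply]
  · rfl
  · refine integrableOn_frontier hΩ hbdd hΩs
      (((ContinuousLinearMap.lsmul ℝ ℂ (E := F)).flip.continuous.comp hA).continuousOn.clm_comp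
        (continuousOn_kernel hΩ (fun x hx => ?_) hX₀))
    exact ((hg x hx).fderiv_right (m := 0) (by simp)).continuousAt

lemma contDiffOn_layer [IsScalarTower ℝ ℂ F] [CompleteSpace F] (hΩ : IsOpen Ω)
    (hbdd : Bornology.IsBounded Ω) (hΩs : HasSmoothBoundary Ω) {g : E (m + 1) → ℂ}
    (hg : SmoothOff g) {A : E (m + 1) → F} (hA : Continuous A) : ContDiffOn ℝ ∞ (layer Ω g A) Ω := by
  rw [contDiffOn_infty]
  intro n
  induction n generalizing g with
  | zero =>
    exact contDiffOn_zero.mpr fun X hX =>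
      (hasFDerivAt_layer hΩ hbdd hΩs hg hA hX).continuousAt.continuousWithinAt
  | succ n ih =>
    push_cast
    rw [contDiffOn_succ_iff_fderiv_of_isOpen hΩ]
    refine ⟨fun X hX =>
      (hasFDerivAt_layer hΩ hbdd hΩs hg hA hX).differentiableAt.differentiableWithinAt,
      by simp, ?_⟩
    rw [contDiffOn_clm_apply]
    intro v
    exact (ih (hg.fderiv_apply v)).congr fun X hX => fderiv_layer hΩ hbdd hΩs hg hA hX v

end Layer

/-! ### Exterior multiplication by constant forms -/

section IteratedWedge

variable {V W : Type*} [NormedAddCommGroup V] [NormedSpace ℝ V] [NormedAddCommGroup W]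
  [NormedSpace ℝ W]

lemma wedgesR_comp {r : ℕ} (η : V [⋀^Fin r]→L[ℝ] ℂ) (T : W →L[ℝ] V) :
    ∀ (p : ℕ) (l : Fin p → V →L[ℝ] ℝ), (wedgesR η p l).compContinuousLinearMap T =
      wedgesR (η.compContinuousLinearMap T) p fun i => l i ∘L T
  | 0, _ => rfl
  | p + 1, l => by
    have ih := wedgesR_comp η T p (Fin.init l)
    change ((-1 : ℂ) ^ (r + p) • wedge (l (Fin.last p)) (wedgesR η p (Fin.init l))
      ).compContinuousLinearMap T = (-1 : ℂ) ^ (r + p) • wedge (l (Fin.last p) ∘L T)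
        (wedgesR (η.compContinuousLinearMap T) p fun i => Fin.init l i ∘L T)
    rw [← ih, ← wedge_comp]
    rfl

lemma wedgeR_congr_cast {d d' : ℕ} (h : d' = d) (b : V →L[ℝ] ℝ) {ξ : V [⋀^Fin d]→L[ℝ] ℂ}
    {ξ' : V [⋀^Fin d']→L[ℝ] ℂ} (hξ : ∀ u, ξ u = ξ' fun j => u (Fin.cast h j))
    (v : Fin (d + 1) → V) :
    wedgeR b ξ v = wedgeR b ξ' fun j => v (Fin.cast (by omega) j) := by
  subst h
  obtain rfl : ξ = ξ' := ContinuousAlternatingMap.ext hξ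
  rfl

lemma wedge_wedgesR {r : ℕ} (a : V →L[ℝ] ℝ) (η : V [⋀^Fin r]→L[ℝ] ℂ) :
    ∀ (p : ℕ) (l : Fin p → V →L[ℝ] ℝ) (v : Fin (r + p + 1) → V), wedge a (wedgesR η p l) v =
      wedgesR (wedge a η) p l fun j => v (Fin.cast (by omega) j)
  | 0, _, _ => rfl
  | p + 1, l, v => by
    have ih := wedge_wedgesR a η p (Fin.init l)
    change wedge a (wedgeR (l (Fin.last p)) (wedgesR η p (Fin.init l))) v =
      wedgeR (l (Fin.last p)) (wedgesR (wedge a η) p (Fin.init l)) _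
    rw [wedge_wedgeR]
    exact wedgeR_congr_cast (by omega) _ ih v

end IteratedWedge

section WedgeForms

variable {n : ℕ}

lemma exists_wedgesRL {r : ℕ} : ∀ (p : ℕ) (l : Fin p → E n →L[ℝ] ℝ),
    ∃ L : (E n [⋀^Fin r]→L[ℝ] ℂ) →L[ℝ] E n [⋀^Fin (r + p)]→L[ℝ] ℂ, ∀ η, L η = wedgesR η p l
  | 0, _ => ⟨ContinuousLinearMap.id ℝ _, fun _ => rfl⟩
  | p + 1, l => by
    obtain ⟨L, hL⟩ := exists_wedgesRL (r := r) p (Fin.init l)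
    refine ⟨(-1 : ℝ) ^ (r + p) • (wedgeL (l (Fin.last p)) ∘L L), fun η => ?_⟩
    change (-1 : ℝ) ^ (r + p) • wedge (l (Fin.last p)) (L η) =
      (-1 : ℂ) ^ (r + p) • wedge (l (Fin.last p)) (wedgesR η p (Fin.init l))
    rw [hL]
    ext v
    simp

/-- The exterior derivative commutes with exterior multiplication by constant forms from the
right. -/
lemma extDeriv_wedgesR {r p : ℕ} {σ : Form n r} {X : E n} (hσ : DifferentiableAt ℝ σ X)
    (l : Fin p → E n →L[ℝ] ℝ) (v : Fin (r + p + 1) → E n) :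
    extDeriv (fun Y => wedgesR (σ Y) p l) X v =
      wedgesR (extDeriv σ X) p l fun j => v (Fin.cast (by omega) j) := by
  obtain ⟨L, hL⟩ := exists_wedgesRL (r := r) p l
  obtain ⟨L', hL'⟩ := exists_wedgesRL (r := r + 1) p l
  have h1 : (fun Y => wedgesR (σ Y) p l) = fun Y => L (σ Y) := funext fun Y => (hL _).symm
  rw [h1, extDeriv_eq_sum_wedge, extDeriv_eq_sum_wedge, ← hL', map_sum,
    ContinuousAlternatingMap.sum_apply, ContinuousAlternatingMap.sum_apply]
  refine Finset.sum_congr rfl fun j _ => ?_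
  rw [fderiv_clm_comp_apply L hσ, hL, hL', wedge_wedgesR]

lemma contDiff_wedgesR {r p : ℕ} {σ : Form n r} (hσ : ContDiff ℝ ∞ σ)
    (l : Fin p → E n →L[ℝ] ℝ) : ContDiff ℝ ∞ fun Y => wedgesR (σ Y) p l := by
  obtain ⟨L, hL⟩ := exists_wedgesRL (r := r) p l
  have h1 : (fun Y => wedgesR (σ Y) p l) = fun Y => L (σ Y) := funext fun Y => (hL _).symm
  rw [h1]
  exact L.contDiff.comp hσ

lemma extDeriv_smul_eq {p : ℕ} {γ : E n → ℂ} {S : Form n p} {X : E n}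
    (hγ : DifferentiableAt ℝ γ X) (hS : DifferentiableAt ℝ S X) :
    extDeriv (fun Y => γ Y • S Y) X = γ X • extDeriv S X +
      ∑ j, fderiv ℝ γ X (basisVec n j) • wedge (innerSL ℝ (basisVec n j)) (S X) := by
  rw [extDeriv_eq_sum_wedge, extDeriv_eq_sum_wedge, Finset.smul_sum, ← Finset.sum_add_distrib]
  refine Finset.sum_congr rfl fun j _ => ?_
  rw [fderiv_fun_smul hγ hS]
  change wedge _ (γ X • fderiv ℝ S X (basisVec n j) + fderiv ℝ γ X (basisVec n j) • S X) = _
  rw [wedge_add, wedge_smul, wedge_smul]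

end WedgeForms

/-! ### The divergence theorem on the boundary -/

section Divergence

variable {m : ℕ} {Ω : Set (E (m + 1))}

lemma innerSL_comp_subtypeL {N : E (m + 1)} (w : E (m + 1)) :
    innerSL ℝ w ∘L (ℝ ∙ N)ᗮ.subtypeL = innerSL ℝ ((ℝ ∙ N)ᗮ.orthogonalProjectionOnto w) := by
  ext v
  simp only [ContinuousLinearMap.comp_apply, innerSL_apply_apply, Submodule.subtypeL_apply]
  rw [← Submodule.inner_orthogonalProjectionOnto_eq_of_mem_right]

/-- If the form `θ` on `Γ` is, up to the Hodge operator, an exact form `dσ`, then the integral over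
`Γ` of each of its values on constant vectors vanishes: up to sign, this value times the volume form
of `Γ` is `d(σ ∧ w₁♭ ∧ … ∧ w_p♭)`. -/
lemma integral_tangPart_eq_zero {p r : ℕ} {Ω : Set (E (r + p + 1 + 1))} (hΩ : IsOpen Ω)
    (hbdd : Bornology.IsBounded Ω) (hΩs : HasSmoothBoundary Ω)
    {N : E (r + p + 1 + 1) → E (r + p + 1 + 1)} (hNs : ContDiff ℝ ∞ N)
    (hN : ∀ X ∈ frontier Ω, N X = outerNormal Ω X) (h : p + (r + 1) = r + p + 1)
    {σ : Form (r + p + 1 + 1) r} (hσ : ContDiff ℝ ∞ σ) {θ : Form (r + p + 1 + 1) p}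
    (hθ : bdryStar h (tangTrace Ω θ) = tangTrace Ω (extDeriv σ)) (w : Fin p → E (r + p + 1 + 1)) :
    ∫ X in frontier Ω, tangPart N θ X w ∂(μHE[r + p + 1] : Measure (E (r + p + 1 + 1))) = 0 := by
  have hst := integral_normalDensity_extDeriv hΩ hbdd hΩs hNs.continuous hN
    (contDiff_wedgesR hσ fun i => innerSL ℝ (w i))
  have hd : ∀ X ∈ frontier Ω, normalDensity (N X)
      (extDeriv (fun Y => wedgesR (σ Y) p fun i => innerSL ℝ (w i)) X) =
      (-1 : ℂ) ^ ((r + p + 1 - 1) * p) * tangPart N θ X w := by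
    intro X hX
    rw [← tangTrace_apply_proj hΩs hN θ ⟨X, hX⟩ w, hN X hX]
    refine normalDensity_eq_of_forall (norm_outerNormal hΩs hX) fun v => ?_
    rw [extDeriv_wedgesR (hσ.differentiable (by simp) X)]
    have h1 := congrFun hθ ⟨X, hX⟩
    have h2 := wedgesR_comp (extDeriv σ X) (TangentAt Ω X).subtypeL p fun i => innerSL ℝ (w i)
    simp only [innerSL_comp_subtypeL] at h2
    have h3 : (extDeriv σ X).compContinuousLinearMap (TangentAt Ω X).subtypeL =
      hodgeStar (stdOrthonormalBasis ℝ (TangentAt Ω X)) h (bdryVol Ω X)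
        (tangTrace Ω θ ⟨X, hX⟩) := h1.symm
    rw [h3] at h2
    have h4 := DFunLike.congr_fun h2 fun j => v (Fin.cast (by omega) j)
    have h5 := wedgesR_hodgeStar (stdOrthonormalBasis ℝ (TangentAt Ω X)) (bdryVol Ω X)
      (by simpa using finrank_tangentAt hΩs ⟨X, hX⟩) h (tangTrace Ω θ ⟨X, hX⟩)
      (fun i => (TangentAt Ω X).orthogonalProjectionOnto (w i))
      (fun j => v (Fin.cast (by omega) j))
    exact h4.trans h5
  rw [setIntegral_congr_fun isClosed_frontier.measurableSet hd, integral_const_mul] at hst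
  exact (mul_eq_zero.mp hst).resolve_left (by simp)

/-- On `Γ`, the interior product of the tangential part of `η` with `u` is that of the trace of `η`
with the projection of `u` to the tangent space. -/
lemma restrictAt_curryLeft_tangPart (hΩs : HasSmoothBoundary Ω) {N : E (m + 1) → E (m + 1)}
    (hN : ∀ X ∈ frontier Ω, N X = outerNormal Ω X) {p : ℕ} (η : Form (m + 1) (p + 1))
    (X : frontier Ω) (u : E (m + 1)) :
    restrictAt Ω X p ((tangPart N η X).curryLeft u) =
      (tangTrace Ω η X).curryLeft
        ((TangentAt Ω (X : E (m + 1))).orthogonalProjectionOnto u) := by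
  ext v
  change η X (fun i => tangProj (N X) (Matrix.vecCons u
    (fun i => (v i : E (m + 1))) i)) = η X fun i =>
      ((Matrix.vecCons ((TangentAt Ω (X : E (m + 1))).orthogonalProjectionOnto u) v i :
        TangentAt Ω (X : E (m + 1))) : E (m + 1))
  congr 1
  funext i
  rw [hN X X.2]
  refine Fin.cases ?_ (fun i => ?_) i
  · exact (coe_orthogonalProjection_eq_tangProj (norm_outerNormal hΩs X.2) _).symm
  · exact tangProj_of_mem (v i).2

/-- On `Γ`, the exterior product of `u♭` with `*η` is, up to the Hodge operator, the interior
product of `η` with the projection of `u` to the tangent space. -/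
lemma restrictAt_wedge_starPart (hΩs : HasSmoothBoundary Ω) {N : E (m + 1) → E (m + 1)}
    (hN : ∀ X ∈ frontier Ω, N X = outerNormal Ω X) {p r : ℕ} (h : p + 1 + r = m)
    (h' : p + (r + 1) = m) (η : Form (m + 1) (p + 1)) (X : frontier Ω) (u : E (m + 1)) :
    restrictAt Ω X (r + 1) (wedge (innerSL ℝ u) (starPart N h η X)) = (-1 : ℂ) ^ p •
      hodgeStar (stdOrthonormalBasis ℝ (TangentAt Ω (X : E (m + 1)))) h' (bdryVol Ω X)
        ((tangTrace Ω η X).curryLeft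
          ((TangentAt Ω (X : E (m + 1))).orthogonalProjectionOnto u)) := by
  have hcard : Fintype.card (Fin (Module.finrank ℝ (TangentAt Ω (X : E (m + 1))))) = m := by
    simpa using finrank_tangentAt hΩs X
  have hstar : tangTrace Ω (starPart N h η) X =
      hodgeStar (stdOrthonormalBasis ℝ (TangentAt Ω (X : E (m + 1)))) h (bdryVol Ω X)
        (tangTrace Ω η X) := congrFun (bdryStar_tangTrace hΩs hN h η).symm X
  rw [← wedge_hodgeStar _ (bdryVol Ω X) hcard h h', ← hstar]
  change (wedge (innerSL ℝ u) (starPart N h η X)).compContinuousLinearMap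
    (TangentAt Ω (X : E (m + 1))).subtypeL = _
  rw [wedge_comp, innerSL_comp_subtypeL]
  rfl

lemma bdryStar_tangTrace_bdryCoderiv (hΩ : IsOpen Ω) (hΩs : HasSmoothBoundary Ω)
    {N : E (m + 1) → E (m + 1)} (hNs : ContDiff ℝ ∞ N)
    (hN : ∀ X ∈ frontier Ω, N X = outerNormal Ω X) {p r : ℕ} (h : p + 1 + r = m)
    (h' : p + (r + 1) = m) {η : Form (m + 1) (p + 1)} (hη : ContDiff ℝ ∞ η) :
    bdryStar h' (bdryCoderiv h (tangTrace Ω η)) =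
      (-1 : ℂ) ^ (p + 1) • tangTrace Ω (extDeriv (starPart N h η)) := by
  rw [bdryCoderiv, bdryStar_smul, bdryStar_bdryStarInv hΩs, bdryStar_tangTrace hΩs hN h η,
    bdryExtDeriv_tangTrace hΩ hΩs (contDiff_starPart hNs h hη)]

/-- The form `(-1)^{p+1} (γ δη - i(∇γ) η)` on `Γ` corresponds to `d(γ * η)` under the Hodge
operator. -/
lemma bdryStar_coderiv_smul (hΩ : IsOpen Ω) (hΩs : HasSmoothBoundary Ω)
    {N : E (m + 1) → E (m + 1)} (hNs : ContDiff ℝ ∞ N)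
    (hN : ∀ X ∈ frontier Ω, N X = outerNormal Ω X) {p r : ℕ} (h : p + 1 + r = m)
    (h' : p + (r + 1) = m) {η : Form (m + 1) (p + 1)} (hη : ContDiff ℝ ∞ η) {θ : Form (m + 1) p}
    (hθ : tangTrace Ω θ = bdryCoderiv h (tangTrace Ω η)) {γ : E (m + 1) → ℂ}
    (hγ : ContDiff ℝ ∞ γ) :
    bdryStar h' (tangTrace Ω fun X => (-1 : ℂ) ^ (p + 1) • (γ X • θ X -
        ∑ j, fderiv ℝ γ X (basisVec (m + 1) j) •
          (tangPart N η X).curryLeft (basisVec (m + 1) j))) =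
      tangTrace Ω (extDeriv fun Y => γ Y • starPart N h η Y) := by
  have hS := contDiff_starPart hNs h hη
  have hθX := bdryStar_tangTrace_bdryCoderiv hΩ hΩs hNs hN h h' hη
  rw [← hθ] at hθX
  funext X
  have hleft : tangTrace Ω (fun X => (-1 : ℂ) ^ (p + 1) • (γ X • θ X -
        ∑ j, fderiv ℝ γ X (basisVec (m + 1) j) •
          (tangPart N η X).curryLeft (basisVec (m + 1) j))) X =
      (-1 : ℂ) ^ (p + 1) • (γ X • tangTrace Ω θ X -
        ∑ j, fderiv ℝ γ X (basisVec (m + 1) j) • restrictAt Ω X p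
          ((tangPart N η X).curryLeft (basisVec (m + 1) j))) := by
    ext v
    simp [tangTrace, restrictAt]
  have hright : tangTrace Ω (extDeriv fun Y => γ Y • starPart N h η Y) X =
      γ X • tangTrace Ω (extDeriv (starPart N h η)) X +
        ∑ j, fderiv ℝ γ X (basisVec (m + 1) j) •
          restrictAt Ω X (r + 1)
            (wedge (innerSL ℝ (basisVec (m + 1) j)) (starPart N h η X)) := by
    rw [tangTrace, extDeriv_smul_eq (hγ.differentiable (by simp) _)
      (hS.differentiable (by simp) _)]
    ext v
    simp [tangTrace, restrictAt]
  have hθX' := congrFun hθX X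
  rw [bdryStar, Pi.smul_apply] at hθX'
  rw [bdryStar, hleft, hright, hodgeStar_smul, hodgeStar_sub, hodgeStar_smul, hodgeStar_sum,
    hθX']
  simp_rw [hodgeStar_smul, restrictAt_wedge_starPart hΩs hN h h',
    restrictAt_curryLeft_tangPart hΩs hN]
  rw [smul_sub, smul_comm (γ X), smul_smul, ← mul_pow, Finset.smul_sum, sub_eq_add_neg,
    ← Finset.sum_neg_distrib]
  congr 1
  · simp
  · refine Finset.sum_congr rfl fun j _ => ?_
    rw [smul_comm (fderiv ℝ γ X (basisVec (m + 1) j)), pow_succ]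
    simp

/-- The divergence theorem on `Γ` behind the commutation of the single-layer potential with the
coderivative. -/
lemma integral_coderiv_eq (hΩ : IsOpen Ω) (hbdd : Bornology.IsBounded Ω)
    (hΩs : HasSmoothBoundary Ω) {N : E (m + 1) → E (m + 1)} (hNs : ContDiff ℝ ∞ N)
    (hN : ∀ X ∈ frontier Ω, N X = outerNormal Ω X) {p r : ℕ} (h : p + 1 + r = m)
    {η : Form (m + 1) (p + 1)} (hη : ContDiff ℝ ∞ η) {θ : Form (m + 1) p}
    (hθ : tangTrace Ω θ = bdryCoderiv h (tangTrace Ω η)) {γ : E (m + 1) → ℂ}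
    (hγ : ContDiff ℝ ∞ γ) (w : Fin p → E (m + 1)) :
    ∫ X in frontier Ω, (γ X * tangPart N θ X w - ∑ j, fderiv ℝ γ X (basisVec (m + 1) j) *
      tangPart N η X (Matrix.vecCons (basisVec (m + 1) j) w))
        ∂(μHE[m] : Measure (E (m + 1))) = 0 := by
  obtain rfl : m = r + p + 1 := by omega
  have hθ' := bdryStar_coderiv_smul hΩ hΩs hNs hN h (by omega) hη hθ hγ
  have hmain := integral_tangPart_eq_zero hΩ hbdd hΩs hNs hN (by omega)
    (hγ.smul (contDiff_starPart hNs h hη)) hθ' w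
  have hval : ∀ X ∈ frontier Ω, tangPart N (fun X => (-1 : ℂ) ^ (p + 1) • (γ X • θ X -
      ∑ j, fderiv ℝ γ X (basisVec _ j) • (tangPart N η X).curryLeft (basisVec _ j))) X w =
      (-1 : ℂ) ^ (p + 1) *
      (γ X * tangPart N θ X w - ∑ j, fderiv ℝ γ X (basisVec _ j) *
      tangPart N η X (Matrix.vecCons (basisVec _ j) w)) := by
    intro X hX
    have hNX : ‖N X‖ = 1 := by rw [hN X hX, norm_outerNormal hΩs hX]
    have hPP : ∀ j, tangPart N η X (Matrix.vecCons (basisVec _ j) fun i => tangProj (N X) (w i)) =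
        tangPart N η X (Matrix.vecCons (basisVec _ j) w) := by
      intro j
      rw [tangPart_apply, tangPart_apply]
      congr 1
      funext i
      refine Fin.cases rfl (fun i => ?_) i
      exact tangProj_of_mem (tangProj_mem hNX _)
    simp_rw [← hPP]
    rw [tangPart_apply]
    simp [tangPart_apply N θ]
  rw [setIntegral_congr_fun isClosed_frontier.measurableSet hval, integral_const_mul] at hmain
  exact (mul_eq_zero.mp hmain).resolve_left (by simp)

end Divergence

/-! ### The single-layer potential -/

section PotentialDerivatives

open Set Filter Topology

variable {m : ℕ} {Ω : Set (E (m + 1))} {k : ℂ} {r₀ : ℝ}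

/-- For `X'` in `Ω`, the function `X ↦ g(X' - X)` agrees near the boundary with a smooth function.
-/
lemma exists_contDiff_eq_kernel (hΩ : IsOpen Ω) {g : E (m + 1) → ℂ} (hg : SmoothOff g)
    {X' : E (m + 1)} (hX' : X' ∈ Ω) : ∃ γ : E (m + 1) → ℂ, ContDiff ℝ ∞ γ ∧
      ∀ X ∈ frontier Ω, γ X = g (X' - X) ∧ ∀ v, fderiv ℝ γ X v = -fderiv ℝ g (X' - X) v := by
  obtain ⟨ε, hε, hball⟩ := Metric.nhds_basis_closedBall.mem_iff.mp (hΩ.mem_nhds hX')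
  -- cut off the singularity at `X'`, away from the boundary
  let χ : ContDiffBump X' := ⟨ε / 2, ε, by positivity, by linarith⟩
  refine ⟨fun X => (1 - χ X) • g (X' - X), ?_, fun X hX => ?_⟩
  · rw [contDiff_iff_contDiffAt]
    intro X
    by_cases hX : X = X'
    · subst hX
      refine (contDiffAt_const (c := (0 : ℂ))).congr_of_eventuallyEq ?_
      filter_upwards [Metric.closedBall_mem_nhds X (by positivity : 0 < ε / 2)] with Y hY
      rw [χ.one_of_mem_closedBall hY, sub_self, zero_smul]
    · have h1 : ContDiffAt ℝ ∞ (fun Y => g (X' - Y)) X :=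
        (hg (X' - X) (sub_ne_zero.mpr fun h => hX h.symm)).comp X (by fun_prop)
      exact (contDiffAt_const.sub χ.contDiffAt).smul h1
  · have hne := sub_ne_zero_of_mem_frontier hΩ hX hX'
    have hnot : X ∉ Metric.closedBall X' ε := fun h =>
      sub_ne_zero_of_mem_frontier hΩ hX (hball h) (sub_self X)
    have hev : (fun X => (1 - χ X) • g (X' - X)) =ᶠ[𝓝 X] fun X => g (X' - X) := by
      filter_upwards [Metric.isClosed_closedBall.isOpen_compl.mem_nhds hnot] with Y hY
      rw [χ.zero_of_le_dist (le_of_lt (not_le.mp hY)), sub_zero, one_smul]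
    refine ⟨hev.self_of_nhds, fun v => ?_⟩
    have h2 : HasFDerivAt (fun Y => g (X' - Y))
        (fderiv ℝ g (X' - X) ∘L (-ContinuousLinearMap.id ℝ (E (m + 1)))) X :=
      ((hg _ hne).differentiableAt (by simp)).hasFDerivAt.comp X
        ((hasFDerivAt_id X).const_sub X')
    rw [hev.fderiv_eq, h2.fderiv]
    simp

/-- The single-layer potential is an integral of a smooth density against a kernel `g(X' - X)`. -/
lemma exists_singleLayer_eq_layer (hm : 1 ≤ m) (hΩ : IsOpen Ω) (hΩs : HasSmoothBoundary Ω)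
    (k : ℂ) (hr₀ : 0 < r₀) : ∃ (N : E (m + 1) → E (m + 1)) (g : E (m + 1) → ℂ),
      ContDiff ℝ ∞ N ∧ (∀ X ∈ frontier Ω, N X = outerNormal Ω X) ∧ SmoothOff g ∧
      (∀ x, x ≠ 0 → ∑ j, fderiv ℝ (fun y => fderiv ℝ g y (basisVec (m + 1) j)) x
        (basisVec (m + 1) j) = -k ^ 2 * g x) ∧
      ∀ {p : ℕ} (η : Form (m + 1) p), ∀ X' ∈ Ω,
        (∀ X : frontier Ω, traceInner (tangTrace Ω η) (greenKernel m p k r₀) X' X =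
          g (X' - X) • tangPart N η X) ∧
        singleLayer k r₀ (tangTrace Ω η) X' = layer Ω g (tangPart N η) X' := by
  obtain ⟨N, hNs, hN⟩ := exists_smooth_normal hΩ hΩs
  obtain ⟨g, hg, hhelm, hk⟩ := exists_smoothOff_helmholtzKernel m hm k r₀ hr₀
  refine ⟨N, g, hNs, hN, hg, hhelm, fun η X' hX' => ?_⟩
  have h1 : ∀ X : frontier Ω, traceInner (tangTrace Ω η) (greenKernel m _ k r₀) X' X =
      g (X' - X) • tangPart N η X := by
    intro X
    rw [traceInner_greenKernel hΩs hN, hk]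
    intro h
    exact sub_ne_zero_of_mem_frontier hΩ X.2 hX' (sub_eq_zero.mpr h.symm)
  refine ⟨h1, ?_⟩
  rw [singleLayer, surfaceMeasure]
  simp_rw [h1]
  exact integral_subtype_comap isClosed_frontier.measurableSet
    fun X => g (X' - X) • tangPart N η X

lemma integrable_traceInner (hm : 1 ≤ m) (hΩ : IsOpen Ω) (hbdd : Bornology.IsBounded Ω)
    (hΩs : HasSmoothBoundary Ω) (k : ℂ) (hr₀ : 0 < r₀) {p : ℕ} {α : BdryForm Ω p}
    (hα : α.IsSmooth) {X' : E (m + 1)} (hX' : X' ∈ Ω) :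
    Integrable (traceInner α (greenKernel m p k r₀) X') (surfaceMeasure Ω) := by
  obtain ⟨η, hη, rfl⟩ := hα
  obtain ⟨N, g, hNs, hN, hg, -, hS⟩ := exists_singleLayer_eq_layer hm hΩ hΩs k hr₀
  rw [show traceInner (tangTrace Ω η) (greenKernel m p k r₀) X' =
    (fun X => g (X' - X) • tangPart N η X) ∘ Subtype.val from funext (hS η X' hX').1]
  exact (integrableOn_iff_comap_subtypeVal isClosed_frontier.measurableSet).mp
    (hg.integrableOn hΩ hbdd hΩs (contDiff_tangPart hNs hη).continuous hX')

lemma contDiffOn_singleLayer (hm : 1 ≤ m) (hΩ : IsOpen Ω) (hbdd : Bornology.IsBounded Ω)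
    (hΩs : HasSmoothBoundary Ω) (hr₀ : 0 < r₀) {p : ℕ} {α : BdryForm Ω p}
    (hα : α.IsSmooth) : ContDiffOn ℝ ∞ (singleLayer k r₀ α) Ω := by
  obtain ⟨η, hη, rfl⟩ := hα
  obtain ⟨N, g, hNs, hN, hg, -, hS⟩ := exists_singleLayer_eq_layer hm hΩ hΩs k hr₀
  exact (contDiffOn_layer hΩ hbdd hΩs hg (contDiff_tangPart hNs hη).continuous).congr
    fun X hX => (hS η X hX).2

lemma singleLayer_smul (hm : 1 ≤ m) (hΩ : IsOpen Ω) (hΩs : HasSmoothBoundary Ω) (hr₀ : 0 < r₀)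
    {p : ℕ} (a : ℂ) {α : BdryForm Ω p} (hα : α.IsSmooth) {X' : E (m + 1)} (hX' : X' ∈ Ω) :
    singleLayer k r₀ (a • α) X' = a • singleLayer k r₀ α X' := by
  obtain ⟨η, hη, rfl⟩ := hα
  obtain ⟨N, g, hNs, hN, hg, -, hS⟩ := exists_singleLayer_eq_layer hm hΩ hΩs k hr₀
  rw [← tangTrace_smul, (hS _ X' hX').2, (hS _ X' hX').2, layer, layer, ← integral_smul]
  congr 1
  funext X
  rw [smul_comm]
  rfl

lemma layer_apply (hΩ : IsOpen Ω) (hbdd : Bornology.IsBounded Ω)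
    (hΩs : HasSmoothBoundary Ω) {g : E (m + 1) → ℂ} (hg : SmoothOff g) {p : ℕ}
    {A : Form (m + 1) p} (hA : Continuous A) {X' : E (m + 1)} (hX' : X' ∈ Ω)
    (v : Fin p → E (m + 1)) :
    layer Ω g A X' v = ∫ X in frontier Ω, g (X' - X) * A X v
      ∂(μHE[m] : Measure (E (m + 1))) :=
  ((ContinuousAlternatingMap.apply ℝ (E (m + 1)) ℂ v).integral_comp_comm
    (hg.integrableOn hΩ hbdd hΩs hA hX')).symm

/-- The coderivative commutes with the single-layer potential. -/
lemma coderiv_singleLayer (hm : 1 ≤ m) (hΩ : IsOpen Ω) (hbdd : Bornology.IsBounded Ω)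
    (hΩs : HasSmoothBoundary Ω) (hr₀ : 0 < r₀) {p r : ℕ} (h : p + 1 + r = m)
    (h' : p + 1 + (r + 1) = m + 1) {α : BdryForm Ω (p + 1)} (hα : α.IsSmooth) {X' : E (m + 1)}
    (hX' : X' ∈ Ω) :
    coderiv h' (singleLayer k r₀ α) X' = singleLayer k r₀ (bdryCoderiv h α) X' := by
  obtain ⟨θ, hθ, hθα⟩ := hα.bdryCoderiv hΩ hΩs h
  have hdiff := ((contDiffOn_singleLayer (k := k) hm hΩ hbdd hΩs hr₀ hα).contDiffAt
    (hΩ.mem_nhds hX')).differentiableAt (by simp)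
  obtain ⟨η, hη, rfl⟩ := hα
  obtain ⟨N, g, hNs, hN, hg, -, hS⟩ := exists_singleLayer_eq_layer hm hΩ hΩs k hr₀
  have hA := (contDiff_tangPart hNs hη).continuous
  have hB := (contDiff_tangPart hNs hθ).continuous
  have hev : singleLayer k r₀ (tangTrace Ω η) =ᶠ[𝓝 X'] layer Ω g (tangPart N η) :=
    (hΩ.eventually_mem hX').mono fun X hX => (hS η X hX).2
  obtain ⟨γ, hγ, hγg⟩ := exists_contDiff_eq_kernel hΩ hg hX'
  rw [coderiv_eq_sum h' hdiff, ← hθα, (hS θ X' hX').2, hev.fderiv_eq]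
  ext v
  -- the derivatives of the kernel with respect to `X` and `X'` differ by a sign
  have hstokes := integral_coderiv_eq hΩ hbdd hΩs hNs hN h hη hθα hγ v
  have hint : ∀ X ∈ frontier Ω, (γ X * tangPart N θ X v - ∑ j, fderiv ℝ γ X (basisVec (m + 1) j) *
      tangPart N η X (Matrix.vecCons (basisVec (m + 1) j) v)) = g (X' - X) * tangPart N θ X v +
      ∑ j, fderiv ℝ g (X' - X) (basisVec (m + 1) j) *
        tangPart N η X (Matrix.vecCons (basisVec (m + 1) j) v) := by
    intro X hX
    rw [(hγg X hX).1, sub_eq_add_neg, ← Finset.sum_neg_distrib]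
    congr 1
    refine Finset.sum_congr rfl fun j _ => ?_
    rw [(hγg X hX).2, neg_mul, neg_neg]
  have hi : ∀ {q : ℕ} {f : E (m + 1) → ℂ} (_ : SmoothOff f) {A : Form (m + 1) q}
      (_ : Continuous A) (u : Fin q → E (m + 1)), IntegrableOn (fun X => f (X' - X) * A X u)
        (frontier Ω) (μHE[m] : Measure (E (m + 1))) := fun hf A hA u =>
    hf.integrableOn hΩ hbdd hΩs (A := fun X => A X u)
      ((ContinuousAlternatingMap.apply ℝ (E (m + 1)) ℂ u).continuous.comp hA) hX'
  rw [setIntegral_congr_fun isClosed_frontier.measurableSet hint, integral_add (hi hg hB v)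
    (integrable_finsetSum _ fun j _ => hi (hg.fderiv_apply _) hA _),
    integral_finsetSum _ fun j _ => hi (hg.fderiv_apply _) hA _] at hstokes
  rw [layer_apply hΩ hbdd hΩs hg hB hX', ContinuousAlternatingMap.neg_apply,
    ContinuousAlternatingMap.sum_apply, neg_eq_iff_add_eq_zero, add_comm, ← hstokes]
  congr 1
  refine Finset.sum_congr rfl fun j _ => ?_
  rw [ContinuousAlternatingMap.curryLeft_apply_apply, fderiv_layer hΩ hbdd hΩs hg hA hX',
    layer_apply hΩ hbdd hΩs (hg.fderiv_apply _) hA hX']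

/-- The single-layer potential solves the Helmholtz equation. -/
lemma laplaceBeltrami_singleLayer (hm : 1 ≤ m) (hΩ : IsOpen Ω) (hbdd : Bornology.IsBounded Ω)
    (hΩs : HasSmoothBoundary Ω) (hr₀ : 0 < r₀) {p r : ℕ} (h : p + (r + 1) = m + 1)
    {α : BdryForm Ω p} (hα : α.IsSmooth) {X' : E (m + 1)} (hX' : X' ∈ Ω) :
    laplaceBeltrami p (r + 1) h (singleLayer k r₀ α) X' = k ^ 2 • singleLayer k r₀ α X' := by
  have hcd := (contDiffOn_singleLayer (k := k) hm hΩ hbdd hΩs hr₀ hα).contDiffAt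
    (hΩ.mem_nhds hX')
  rw [laplaceBeltrami_eq_sum h (hcd.of_le ENat.LEInfty.out)]
  obtain ⟨η, hη, rfl⟩ := hα
  obtain ⟨N, g, hNs, hN, hg, hhelm, hS⟩ := exists_singleLayer_eq_layer hm hΩ hΩs k hr₀
  have hA := (contDiff_tangPart hNs hη).continuous
  have hev : ∀ X ∈ Ω, singleLayer k r₀ (tangTrace Ω η) =ᶠ[𝓝 X] layer Ω g (tangPart N η) :=
    fun X hX => (hΩ.eventually_mem hX).mono fun X hX => (hS η X hX).2
  have hev2 : ∀ j, (fun y => fderiv ℝ (singleLayer k r₀ (tangTrace Ω η)) y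
      (basisVec (m + 1) j)) =ᶠ[𝓝 X']
      layer Ω (fun x => fderiv ℝ g x (basisVec (m + 1) j)) (tangPart N η) := fun j =>
    (hΩ.eventually_mem hX').mono fun X hX => by
      beta_reduce
      rw [(hev X hX).fderiv_eq, fderiv_layer hΩ hbdd hΩs hg hA hX]
  have hd : ∀ j, fderiv ℝ (fun y => fderiv ℝ (singleLayer k r₀ (tangTrace Ω η)) y
      (basisVec (m + 1) j)) X' (basisVec (m + 1) j) = layer Ω (fun x => fderiv ℝ
        (fun y => fderiv ℝ g y (basisVec (m + 1) j)) x (basisVec (m + 1) j)) (tangPart N η) X' :=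
    fun j => by
      rw [(hev2 j).fderiv_eq, fderiv_layer hΩ hbdd hΩs (hg.fderiv_apply _) hA hX']
  simp_rw [hd]
  rw [(hS η X' hX').2]
  simp only [layer]
  rw [← integral_finsetSum _ fun j _ =>
    ((hg.fderiv_apply _).fderiv_apply _).integrableOn hΩ hbdd hΩs hA hX', ← integral_smul,
    ← integral_neg]
  refine setIntegral_congr_fun isClosed_frontier.measurableSet fun X hX => ?_
  beta_reduce
  rw [← Finset.sum_smul, hhelm _ (sub_ne_zero_of_mem_frontier hΩ hX hX'), ← neg_smul, smul_smul]
  congr 1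
  ring

end PotentialDerivatives

/-! ### Hodge duality in `ℝⁿ` -/

section Signs

lemma neg_one_pow_eq {a b : ℕ} (h : Even (a + b)) : (-1 : ℂ) ^ a = (-1) ^ b :=
  neg_one_pow_congr (Nat.even_add.mp h)

end Signs

section HodgeEuclidean

variable {n : ℕ}

lemma euclStar_euclStar {p q : ℕ} (h : p + q = n) (h' : q + p = n)
    (φ : E n [⋀^Fin p]→L[ℝ] ℂ) : euclStar h' (euclStar h φ) = (-1 : ℂ) ^ (p * q) • φ :=
  hodgeStar_hodgeStar (by simp) (isUnitVolume_euclVol n) h h' φ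

lemma euclStarInv_eq {p q : ℕ} (h : p + q = n) (h' : q + p = n) (φ : E n [⋀^Fin q]→L[ℝ] ℂ) :
    euclStarInv h φ = (-1 : ℂ) ^ (p * q) • euclStar h' φ := rfl

lemma euclStar_euclStarInv {p q : ℕ} (h : p + q = n) (φ : E n [⋀^Fin q]→L[ℝ] ℂ) :
    euclStar h (euclStarInv h φ) = φ :=
  hodgeStar_hodgeStarInv (by simp) (isUnitVolume_euclVol n) h φ

lemma euclStarInv_euclStar {p q : ℕ} (h : p + q = n) (φ : E n [⋀^Fin p]→L[ℝ] ℂ) :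
    euclStarInv h (euclStar h φ) = φ :=
  hodgeStarInv_hodgeStar (by simp) (isUnitVolume_euclVol n) h φ

lemma euclStar_smul {p q : ℕ} (h : p + q = n) (a : ℂ) (φ : E n [⋀^Fin p]→L[ℝ] ℂ) :
    euclStar h (a • φ) = a • euclStar h φ := hodgeStar_smul _ _ _ _ _

lemma euclStar_add {p q : ℕ} (h : p + q = n) (φ ψ : E n [⋀^Fin p]→L[ℝ] ℂ) :
    euclStar h (φ + ψ) = euclStar h φ + euclStar h ψ := hodgeStar_add _ _ _ _ _

lemma euclStarInv_smul {p q : ℕ} (h : p + q = n) (a : ℂ) (φ : E n [⋀^Fin q]→L[ℝ] ℂ) :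
    euclStarInv h (a • φ) = a • euclStarInv h φ := by
  rw [euclStarInv_eq h (by omega), euclStarInv_eq h (by omega), euclStar_smul, smul_comm]

lemma euclStarInv_zero {p q : ℕ} (h : p + q = n) :
    euclStarInv h (0 : E n [⋀^Fin q]→L[ℝ] ℂ) = 0 := by
  have := euclStarInv_smul h (0 : ℂ) (0 : E n [⋀^Fin q]→L[ℝ] ℂ)
  have h0 : ∀ {r : ℕ} (φ : E n [⋀^Fin r]→L[ℝ] ℂ), (0 : ℂ) • φ = 0 := fun φ => by ext v; simp
  rwa [h0, h0] at this

lemma euclStarInv_add {p q : ℕ} (h : p + q = n) (φ ψ : E n [⋀^Fin q]→L[ℝ] ℂ) :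
    euclStarInv h (φ + ψ) = euclStarInv h φ + euclStarInv h ψ := by
  rw [euclStarInv_eq h (by omega), euclStarInv_eq h (by omega), euclStarInv_eq h (by omega),
    euclStar_add, smul_add]

/-- `d * = (-1)^{p+1} * δ` on `(p+1)`-forms. -/
lemma extDeriv_euclStar {p q : ℕ} (h : p + 1 + q = n) (h' : p + (q + 1) = n)
    (θ : Form n (p + 1)) (x : E n) :
    extDeriv (fun y => euclStar h (θ y)) x = (-1 : ℂ) ^ (p + 1) • euclStar h' (coderiv h θ x) := by
  rw [coderiv, euclStar_smul, euclStar_euclStarInv, smul_smul, ← mul_pow]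
  simp

lemma coderiv_congr {p q : ℕ} (h : p + 1 + q = n) {θ θ' : Form n (p + 1)} {x : E n}
    (hθ : θ =ᶠ[nhds x] θ') : coderiv h θ x = coderiv h θ' x := by
  have h1 : (fun y => euclStar h (θ y)) =ᶠ[nhds x] fun y => euclStar h (θ' y) :=
    hθ.mono fun y hy => by beta_reduce; rw [hy]
  rw [coderiv, coderiv, h1.extDeriv_eq]

lemma coderiv_add {p q : ℕ} (h : p + 1 + q = n) {θ θ' : Form n (p + 1)} {x : E n}
    (hθ : DifferentiableAt ℝ θ x) (hθ' : DifferentiableAt ℝ θ' x) :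
    coderiv h (fun y => θ y + θ' y) x = coderiv h θ x + coderiv h θ' x := by
  have h1 : (fun y => euclStar h (θ y + θ' y)) =
      (fun y => euclStar h (θ y)) + fun y => euclStar h (θ' y) :=
    funext fun y => euclStar_add h _ _
  have h2 := extDeriv_add ((euclStarL h).differentiableAt.comp x hθ)
    ((euclStarL h).differentiableAt.comp x hθ')
  change extDeriv ((fun y => euclStar h (θ y)) + fun y => euclStar h (θ' y)) x = _ at h2
  rw [coderiv, h1, h2, euclStarInv_add, smul_add]
  rfl

lemma contDiffOn_extDeriv {p : ℕ} {Ω : Set (E n)} (hΩ : IsOpen Ω) {θ : Form n p}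
    (hθ : ContDiffOn ℝ ∞ θ Ω) : ContDiffOn ℝ ∞ (extDeriv θ) Ω := by
  rw [show extDeriv θ = fun x => _ from funext fun x => extDeriv_eq_sum_wedge θ x]
  refine ContDiffOn.sum fun j _ => ?_
  exact (wedgeL (innerSL ℝ (basisVec _ j))).contDiff.comp_contDiffOn
    ((hθ.fderiv_of_isOpen hΩ (m := ∞) (by simp)).clm_apply contDiffOn_const)

end HodgeEuclidean

/-! ### The double-layer potential -/

section DoubleLayer

open Filter Topology

variable {m : ℕ} {Ω : Set (E (m + 1))} {k : ℂ} {r₀ : ℝ}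

lemma contDiffOn_doubleLayer (hm : 1 ≤ m) (hΩ : IsOpen Ω) (hbdd : Bornology.IsBounded Ω)
    (hΩs : HasSmoothBoundary Ω) (hr₀ : 0 < r₀) {p r : ℕ} (h : p + r = m) {α : BdryForm Ω p}
    (hα : α.IsSmooth) : ContDiffOn ℝ ∞ (doubleLayer k r₀ h α) Ω := by
  have hβ : (bdryStarInv (p := r) (r := p) (by omega) α).IsSmooth := hα.bdryStarInv hΩ hΩs _
  exact ((euclStarL (by omega : r + 1 + p = m + 1)).contDiff.comp_contDiffOn
    (contDiffOn_extDeriv hΩ (contDiffOn_singleLayer (k := k) hm hΩ hbdd hΩs hr₀ hβ))).neg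

lemma extDeriv_singleLayer_smul (hm : 1 ≤ m) (hΩ : IsOpen Ω) (hbdd : Bornology.IsBounded Ω)
    (hΩs : HasSmoothBoundary Ω) (hr₀ : 0 < r₀) {p : ℕ} (a : ℂ) {α : BdryForm Ω p}
    (hα : α.IsSmooth) {X' : E (m + 1)} (hX' : X' ∈ Ω) :
    extDeriv (singleLayer k r₀ (a • α)) X' = a • extDeriv (singleLayer k r₀ α) X' := by
  have hev : singleLayer k r₀ (a • α) =ᶠ[𝓝 X'] a • singleLayer k r₀ α :=
    (hΩ.eventually_mem hX').mono fun X hX => singleLayer_smul hm hΩ hΩs hr₀ a hα hX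
  rw [hev.extDeriv_eq]
  exact extDeriv_const_smul_complex a (((contDiffOn_singleLayer hm hΩ hbdd hΩs hr₀ hα).contDiffAt
    (hΩ.mem_nhds hX')).differentiableAt (by simp))

/-- The Hodge dual of the double-layer potential is an exact form, since `*⁻¹ α` and `*α` differ by
a sign on `Γ`. -/
lemma euclStar_doubleLayer (hm : 1 ≤ m) (hΩ : IsOpen Ω) (hbdd : Bornology.IsBounded Ω)
    (hΩs : HasSmoothBoundary Ω) (hr₀ : 0 < r₀) {p r : ℕ} (h : p + r = m)
    (h' : p + (r + 1) = m + 1) {α : BdryForm Ω p} (hα : α.IsSmooth) {X' : E (m + 1)}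
    (hX' : X' ∈ Ω) :
    euclStar h' (doubleLayer k r₀ h α X') =
      (-1 : ℂ) ^ (p + 1) • extDeriv (singleLayer k r₀ (bdryStar h α)) X' := by
  rw [doubleLayer, bdryStarInv_eq (by omega : r + p = m) h,
    extDeriv_singleLayer_smul hm hΩ hbdd hΩs hr₀ _ (hα.bdryStar hΩ hΩs h) hX', euclStar_smul,
    ← neg_one_smul ℂ, euclStar_smul, euclStar_smul, euclStar_euclStar, smul_smul, smul_smul,
    mul_assoc, ← pow_add, ← pow_succ']
  congr 1
  refine neg_one_pow_eq ⟨r * p + p + 1, ?_⟩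
  ring

/-- This is `d² = 0`, applied to the Hodge dual. -/
lemma coderiv_doubleLayer (hm : 1 ≤ m) (hΩ : IsOpen Ω) (hbdd : Bornology.IsBounded Ω)
    (hΩs : HasSmoothBoundary Ω) (hr₀ : 0 < r₀) {p r : ℕ} (h : p + 1 + r = m)
    (h' : p + 1 + (r + 1) = m + 1) {α : BdryForm Ω (p + 1)} (hα : α.IsSmooth) {X' : E (m + 1)}
    (hX' : X' ∈ Ω) : coderiv h' (doubleLayer k r₀ h α) X' = 0 := by
  have hcd := contDiffOn_singleLayer (k := k) hm hΩ hbdd hΩs hr₀ (hα.bdryStar hΩ hΩs h)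
  have hev : (fun y => euclStar h' (doubleLayer k r₀ h α y)) =ᶠ[𝓝 X']
      (-1 : ℂ) ^ (p + 1 + 1) • extDeriv (singleLayer k r₀ (bdryStar h α)) :=
    (hΩ.eventually_mem hX').mono fun X hX =>
      euclStar_doubleLayer hm hΩ hbdd hΩs hr₀ h h' hα hX
  rw [coderiv, hev.extDeriv_eq, extDeriv_const_smul_complex _
    (((contDiffOn_extDeriv hΩ hcd).contDiffAt (hΩ.mem_nhds hX')).differentiableAt (by simp)),
    extDeriv_extDeriv_apply (hcd.contDiffAt (hΩ.mem_nhds hX'))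
      (by simpa using ENat.LEInfty.out), smul_zero, euclStarInv_zero]
  ext v
  simp

/-- The exterior derivative of the double-layer potential, as a coderivative of the derivative of
the single-layer potential. -/
lemma extDeriv_doubleLayer_eq_coderiv {p r : ℕ} (h : p + r = m) (h' : r + 1 + p = m + 1)
    (h'' : r + (p + 1) = m + 1) (α : BdryForm Ω p) (X' : E (m + 1)) :
    extDeriv (doubleLayer k r₀ h α) X' = (-1 : ℂ) ^ r • euclStar h''
      (coderiv h' (extDeriv (singleLayer k r₀ (bdryStarInv (by omega) α))) X') := by
  have h1 : doubleLayer k r₀ h α = (-1 : ℝ) • fun y => euclStar h'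
      (extDeriv (singleLayer k r₀ (bdryStarInv (by omega) α)) y) := by
    funext y
    exact (neg_one_smul ℝ _).symm
  rw [h1, extDeriv_smul, extDeriv_euclStar h' h'', pow_succ]
  ext v
  simp

/-- The single-layer potential of `*⁻¹ α` is, up to the Hodge operators, that of `* α`. -/
lemma euclStar_singleLayer_bdryStarInv (hm : 1 ≤ m) (hΩ : IsOpen Ω)
    (hΩs : HasSmoothBoundary Ω) (hr₀ : 0 < r₀) {p r : ℕ} (h : p + r = m) (h' : r + p = m)
    (h₁ : r + (p + 1) = m + 1) (h₂ : p + 1 + r = m + 1)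
    {α : BdryForm Ω p} (hα : α.IsSmooth) {X' : E (m + 1)} (hX' : X' ∈ Ω) :
    (-1 : ℂ) ^ r • euclStar h₁ (singleLayer k r₀ (bdryStarInv h' α) X') =
      euclStarInv h₂ (singleLayer k r₀ (bdryStar h α) X') := by
  rw [bdryStarInv_eq h' h, singleLayer_smul hm hΩ hΩs hr₀ _ (hα.bdryStar hΩ hΩs h) hX',
    euclStar_smul, smul_smul, ← pow_add, euclStarInv_eq h₂ h₁]
  congr 1
  refine neg_one_pow_eq ⟨r + r * p, ?_⟩
  ring

/-- In the top degree on `Γ`, the single-layer potential of the function `*⁻¹ α` satisfies the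
Helmholtz equation `δ d Ψ = k² Ψ`. -/
lemma extDeriv_doubleLayer_of_eq (hm : 1 ≤ m) (hΩ : IsOpen Ω) (hbdd : Bornology.IsBounded Ω)
    (hΩs : HasSmoothBoundary Ω) (hr₀ : 0 < r₀) {p : ℕ} (h : p + 0 = m)
    (h₂ : p + 1 + 0 = m + 1) {α : BdryForm Ω p} (hα : α.IsSmooth) {X' : E (m + 1)}
    (hX' : X' ∈ Ω) :
    extDeriv (doubleLayer k r₀ h α) X' =
      k ^ 2 • euclStarInv h₂ (singleLayer k r₀ (bdryStar h α) X') := by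
  have hβ : (bdryStarInv (p := 0) (r := p) (by omega) α).IsSmooth := hα.bdryStarInv hΩ hΩs _
  have hlap := laplaceBeltrami_singleLayer (k := k) hm hΩ hbdd hΩs hr₀
    (by omega : 0 + (p + 1) = m + 1) hβ hX'
  change coderiv (by omega : 0 + 1 + p = m + 1) _ X' = _ at hlap
  rw [extDeriv_doubleLayer_eq_coderiv h (by omega) (by omega), hlap, euclStar_smul, smul_comm,
    euclStar_singleLayer_bdryStarInv hm hΩ hΩs hr₀ h (by omega) (by omega) h₂ hα hX']

/-- In the Helmholtz equation `d δ Ψ + δ d Ψ = k² Ψ` for the single-layer potential `Ψ` of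
`β = *⁻¹ α`, the coderivative `δ Ψ` is the single-layer potential of `δ β = ± *⁻¹ d α`, so that
`d δ Ψ` is, up to the Hodge operator, the double-layer potential of `d α`. -/
lemma extDeriv_doubleLayer (hm : 1 ≤ m) (hΩ : IsOpen Ω) (hbdd : Bornology.IsBounded Ω)
    (hΩs : HasSmoothBoundary Ω) (hr₀ : 0 < r₀) {p r : ℕ} (h : p + (r + 1) = m)
    (h₁ : p + 1 + r = m) (h₂ : p + 1 + (r + 1) = m + 1) {α : BdryForm Ω p} (hα : α.IsSmooth)
    {X' : E (m + 1)} (hX' : X' ∈ Ω) :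
    extDeriv (doubleLayer k r₀ h α) X' = doubleLayer k r₀ h₁ (bdryExtDeriv α) X' +
      k ^ 2 • euclStarInv h₂ (singleLayer k r₀ (bdryStar h α) X') := by
  have hβ : (bdryStarInv (p := r + 1) (r := p) (by omega) α).IsSmooth := hα.bdryStarInv hΩ hΩs _
  have hdα := hα.bdryExtDeriv hΩ hΩs
  have hγ : (bdryStarInv (p := r) (r := p + 1) (by omega) (bdryExtDeriv α)).IsSmooth :=
    hdα.bdryStarInv hΩ hΩs _
  have hlap := laplaceBeltrami_singleLayer (k := k) hm hΩ hbdd hΩs hr₀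
    (by omega : r + 1 + (p + 1) = m + 1) hβ hX'
  change extDeriv (coderiv (by omega : r + 1 + (p + 1) = m + 1) _) X' +
    coderiv (by omega : r + 1 + 1 + p = m + 1) _ X' = _ at hlap
  have hδβ : bdryCoderiv (by omega : r + 1 + p = m)
      (bdryStarInv (p := r + 1) (r := p) (by omega) α) =
      (-1 : ℂ) ^ (r + 1) • bdryStarInv (p := r) (r := p + 1) (by omega) (bdryExtDeriv α) := by
    rw [bdryCoderiv, bdryStar_bdryStarInv hΩs]
  have hev : coderiv (by omega : r + 1 + (p + 1) = m + 1)
      (singleLayer k r₀ (bdryStarInv (p := r + 1) (r := p) (by omega) α)) =ᶠ[𝓝 X']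
      singleLayer k r₀ ((-1 : ℂ) ^ (r + 1) •
        bdryStarInv (p := r) (r := p + 1) (by omega) (bdryExtDeriv α)) :=
    (hΩ.eventually_mem hX').mono fun X hX => by
      rw [coderiv_singleLayer hm hΩ hbdd hΩs hr₀ (by omega : r + 1 + p = m) _ hβ hX, hδβ]
  rw [hev.extDeriv_eq, extDeriv_singleLayer_smul hm hΩ hbdd hΩs hr₀ _ hγ hX',
    ← eq_sub_iff_add_eq'] at hlap
  rw [extDeriv_doubleLayer_eq_coderiv h (by omega) (by omega), hlap, sub_eq_add_neg,
    ← neg_one_smul ℂ ((-1 : ℂ) ^ (r + 1) • _), euclStar_add, euclStar_smul, euclStar_smul,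
    euclStar_smul, smul_add, smul_comm _ (k ^ 2),
    euclStar_singleLayer_bdryStarInv hm hΩ hΩs hr₀ h (by omega) (by omega) h₂ hα hX']
  refine (add_comm _ _).trans ?_
  congr 1
  rw [doubleLayer, smul_comm _ (-1 : ℂ), smul_smul ((-1 : ℂ) ^ (r + 1)), ← mul_pow, neg_one_mul,
    neg_neg, one_pow, one_smul]
  ext v
  simp

/-- The double-layer potential satisfies `δ d Ψ = k² Ψ`: the coderivative of the formula for `d Ψ`
is taken, where the double-layer potential of `d α` contributes nothing. -/
lemma coderiv_extDeriv_doubleLayer (hm : 1 ≤ m) (hΩ : IsOpen Ω) (hbdd : Bornology.IsBounded Ω)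
    (hΩs : HasSmoothBoundary Ω) (hr₀ : 0 < r₀) {p r : ℕ} (h : p + r = m)
    (h' : p + 1 + r = m + 1) {α : BdryForm Ω p} (hα : α.IsSmooth) {X' : E (m + 1)}
    (hX' : X' ∈ Ω) :
    coderiv h' (extDeriv (doubleLayer k r₀ h α)) X' = k ^ 2 • doubleLayer k r₀ h α X' := by
  have hsmooth := contDiffOn_singleLayer (k := k) hm hΩ hbdd hΩs hr₀ (hα.bdryStar hΩ hΩs h)
  have hΨ : DifferentiableAt ℝ (singleLayer k r₀ (bdryStar h α)) X' :=
    (hsmooth.contDiffAt (hΩ.mem_nhds hX')).differentiableAt (by simp)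
  have hdual := euclStar_doubleLayer (k := k) hm hΩ hbdd hΩs hr₀ h
    (by omega : p + (r + 1) = m + 1) hα hX'
  -- `δ *⁻¹ = ± *⁻¹ d`, and `d Ψ_SL (*α)` is the Hodge dual of the double-layer potential
  have hkey : coderiv h' (fun y => k ^ 2 • euclStarInv h' (singleLayer k r₀ (bdryStar h α) y)) X' =
      k ^ 2 • doubleLayer k r₀ h α X' := by
    have h1 : (fun y => euclStar h' (k ^ 2 • euclStarInv h' (singleLayer k r₀ (bdryStar h α) y))) =
        k ^ 2 • singleLayer k r₀ (bdryStar h α) := by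
      funext y
      rw [euclStar_smul, euclStar_euclStarInv]
      rfl
    rw [coderiv, h1, extDeriv_const_smul_complex _ hΨ, euclStarInv_smul, smul_comm,
      ← euclStarInv_smul, ← hdual, euclStarInv_euclStar]
  rcases r with _ | r
  · have hev : extDeriv (doubleLayer k r₀ h α) =ᶠ[𝓝 X'] fun y =>
        k ^ 2 • euclStarInv h' (singleLayer k r₀ (bdryStar h α) y) :=
      (hΩ.eventually_mem hX').mono fun X hX =>
        extDeriv_doubleLayer_of_eq hm hΩ hbdd hΩs hr₀ h h' hα hX
    rw [coderiv_congr h' hev, hkey]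
  · have hev : extDeriv (doubleLayer k r₀ h α) =ᶠ[𝓝 X'] fun y =>
        doubleLayer k r₀ (by omega : p + 1 + r = m) (bdryExtDeriv α) y +
        k ^ 2 • euclStarInv h' (singleLayer k r₀ (bdryStar h α) y) :=
      (hΩ.eventually_mem hX').mono fun X hX =>
        extDeriv_doubleLayer hm hΩ hbdd hΩs hr₀ h _ h' hα hX
    have hdα := hα.bdryExtDeriv hΩ hΩs
    have hzero := coderiv_doubleLayer (k := k) hm hΩ hbdd hΩs hr₀ (by omega : p + 1 + r = m)
      h' hdα hX'
    have hd1 : DifferentiableAt ℝ (doubleLayer k r₀ (by omega : p + 1 + r = m)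
        (bdryExtDeriv α)) X' :=
      ((contDiffOn_doubleLayer hm hΩ hbdd hΩs hr₀ _ hdα).contDiffAt
        (hΩ.mem_nhds hX')).differentiableAt (by simp)
    have hd2 : DifferentiableAt ℝ (fun y => k ^ 2 • euclStarInv h'
        (singleLayer k r₀ (bdryStar h α) y)) X' := by
      have h2 : DifferentiableAt ℝ (fun y => euclStar (by omega : r + 1 + (p + 1) = m + 1)
          (singleLayer k r₀ (bdryStar h α) y)) X' :=
        (euclStarL (by omega : r + 1 + (p + 1) = m + 1)).differentiableAt.comp X' hΨ
      exact (h2.const_smul ((-1 : ℂ) ^ ((p + 1) * (r + 1)))).const_smul (k ^ 2)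
    rw [coderiv_congr h' hev, coderiv_add h' hd1 hd2, hzero, zero_add, hkey]

end DoubleLayer

end LayerPotential

end

open LayerPotential

theorem mainTheorem8 (m : ℕ) (hm : 1 ≤ m) (Ω : Set (E (m + 1))) (hopen : IsOpen Ω)
    (hbdd : Bornology.IsBounded Ω) (hsmooth : HasSmoothBoundary Ω)
    (k : ℂ) (hk₀ : 0 ≤ k.arg) (hk₁ : k.arg < Real.pi) (r₀ : ℝ) (hr₀ : 0 < r₀) :
    -- the potentials are well defined and smooth in `Ω`
    (∀ (p r : ℕ) (h : p + r = m) (α : BdryForm Ω p), α.IsSmooth →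
      (∀ X' ∈ Ω, MeasureTheory.Integrable (traceInner α (greenKernel m p k r₀) X')
        (surfaceMeasure Ω)) ∧
      ContDiffOn ℝ ∞ (singleLayer k r₀ α) Ω ∧ ContDiffOn ℝ ∞ (doubleLayer k r₀ h α) Ω) ∧
    -- (i)
    (∀ (p r : ℕ) (h : p + 1 + r = m) (α : BdryForm Ω (p + 1)), α.IsSmooth → ∀ X' ∈ Ω,
      coderiv (q := r + 1) (by omega) (singleLayer k r₀ α) X' -
        singleLayer k r₀ (bdryCoderiv h α) X' = 0) ∧
    -- (ii)
    (∀ (p r : ℕ) (_ : p + r = m) (α : BdryForm Ω p), α.IsSmooth → ∀ X' ∈ Ω,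
      laplaceBeltrami p (r + 1) (by omega) (singleLayer k r₀ α) X' -
        k ^ 2 • singleLayer k r₀ α X' = 0) ∧
    -- (iii)
    (∀ (p r : ℕ) (h : p + r = m) (α : BdryForm Ω p), α.IsSmooth → ∀ X' ∈ Ω,
      euclStar (q := r + 1) (by omega) (doubleLayer k r₀ h α X') =
        ((-1 : ℂ) ^ (p + 1)) • extDeriv (singleLayer k r₀ (bdryStar h α)) X') ∧
    -- (iv)
    (∀ (p r : ℕ) (h : p + 1 + r = m) (α : BdryForm Ω (p + 1)), α.IsSmooth → ∀ X' ∈ Ω,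
      coderiv (q := r + 1) (by omega) (doubleLayer k r₀ h α) X' = 0) ∧
    -- (v), for `p ≤ n - 2` and for `p = n - 1`
    (∀ (p r : ℕ) (h : p + (r + 1) = m) (α : BdryForm Ω p), α.IsSmooth → ∀ X' ∈ Ω,
      extDeriv (doubleLayer k r₀ h α) X' -
        doubleLayer k r₀ (p := p + 1) (r := r) (by omega) (bdryExtDeriv α) X' =
        k ^ 2 • euclStarInv (p := p + 1) (q := r + 1) (by omega)
          (singleLayer k r₀ (bdryStar h α) X')) ∧
    (∀ (p : ℕ) (h : p + 0 = m) (α : BdryForm Ω p), α.IsSmooth → ∀ X' ∈ Ω,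
      extDeriv (doubleLayer k r₀ h α) X' =
        k ^ 2 • euclStarInv (p := p + 1) (q := 0) (by omega)
          (singleLayer k r₀ (bdryStar h α) X')) ∧
    -- (vi), for `p ≤ n - 2` and for `p = n - 1`
    (∀ (p r : ℕ) (h : p + (r + 1) = m) (α : BdryForm Ω p), α.IsSmooth → ∀ X' ∈ Ω,
      euclStar (p := p + 1) (q := r + 1) (by omega) (extDeriv (doubleLayer k r₀ h α) X') =
        ((-1 : ℂ) ^ p) • extDeriv (singleLayer k r₀
            (bdryStar (p := p + 1) (r := r) (by omega) (bdryExtDeriv α))) X' +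
          k ^ 2 • singleLayer k r₀ (bdryStar h α) X') ∧
    (∀ (p : ℕ) (h : p + 0 = m) (α : BdryForm Ω p), α.IsSmooth → ∀ X' ∈ Ω,
      euclStar (p := p + 1) (q := 0) (by omega) (extDeriv (doubleLayer k r₀ h α) X') =
        k ^ 2 • singleLayer k r₀ (bdryStar h α) X') ∧
    -- (vii)
    (∀ (p r : ℕ) (h : p + r = m) (α : BdryForm Ω p), α.IsSmooth → ∀ X' ∈ Ω,
      coderiv (q := r) (by omega) (extDeriv (doubleLayer k r₀ h α)) X' -
        k ^ 2 • doubleLayer k r₀ h α X' = 0) := by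
  have hdDL : ∀ (p r : ℕ) (h : p + (r + 1) = m) (α : BdryForm Ω p), α.IsSmooth → ∀ X' ∈ Ω,
      extDeriv (doubleLayer k r₀ h α) X' =
        doubleLayer k r₀ (p := p + 1) (r := r) (by omega) (bdryExtDeriv α) X' +
        k ^ 2 • euclStarInv (p := p + 1) (q := r + 1) (by omega)
          (singleLayer k r₀ (bdryStar h α) X') := fun p r h α hα X' hX' =>
    extDeriv_doubleLayer hm hopen hbdd hsmooth hr₀ h _ _ hα hX'
  refine ⟨fun p r h α hα => ⟨fun X' hX' =>
      integrable_traceInner hm hopen hbdd hsmooth k hr₀ hα hX',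
      contDiffOn_singleLayer hm hopen hbdd hsmooth hr₀ hα,
      contDiffOn_doubleLayer hm hopen hbdd hsmooth hr₀ h hα⟩,
    fun p r h α hα X' hX' => sub_eq_zero.mpr
      (coderiv_singleLayer hm hopen hbdd hsmooth hr₀ h _ hα hX'),
    fun p r h α hα X' hX' => sub_eq_zero.mpr
      (laplaceBeltrami_singleLayer hm hopen hbdd hsmooth hr₀ _ hα hX'),
    fun p r h α hα X' hX' => euclStar_doubleLayer hm hopen hbdd hsmooth hr₀ h _ hα hX',
    fun p r h α hα X' hX' => coderiv_doubleLayer hm hopen hbdd hsmooth hr₀ h _ hα hX',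
    fun p r h α hα X' hX' => sub_eq_of_eq_add' (hdDL p r h α hα X' hX'),
    fun p h α hα X' hX' => extDeriv_doubleLayer_of_eq hm hopen hbdd hsmooth hr₀ h _ hα hX',
    fun p r h α hα X' hX' => ?_, fun p h α hα X' hX' => ?_,
    fun p r h α hα X' hX' => sub_eq_zero.mpr
      (coderiv_extDeriv_doubleLayer hm hopen hbdd hsmooth hr₀ h _ hα hX')⟩
  -- the Hodge dual of the formulas for `d Ψ_DL`
  · rw [hdDL p r h α hα X' hX', euclStar_add, euclStar_smul, euclStar_euclStarInv,
      euclStar_doubleLayer hm hopen hbdd hsmooth hr₀ _ _ (hα.bdryExtDeriv hopen hsmooth) hX']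
    congr 2
    exact neg_one_pow_eq ⟨p + 1, by ring⟩
  · rw [extDeriv_doubleLayer_of_eq hm hopen hbdd hsmooth hr₀ h (by omega) hα hX', euclStar_smul,
      euclStar_euclStarInv]
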